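/- Let $\mathcal S$ be a measurable space with a probability measure $P$, let $d\ge 0$, $m\ge 1$ be integers, let $f(\cdot;s),r\colon\mathbb R^d\to(-\infty,+\infty]$, $F(x)=\mathbb E_{s\sim P}[f(x;s)]$, $\phi=F+r$ and $\mathrm{dom}(r)=\{r<\infty\}$. Here $\mathbb Z_+=\{1,2,\dots\}$, $\|x\|_M^2=\langle x,Mx\rangle$, and a function $p$ is called (proper, closed and) $\bar\tau$-weakly convex if $p+\frac{\bar\tau}{2}\|\cdot\|_2^2$ is proper, lower semicontinuous and convex. For a self-adjoint positive-definite $M$ and $\alpha>0$ put $\mathrm{prox}^M_{\alpha p}(x)=\arg\min_y\{p(y)+\frac1{2\alpha}\|y-x\|_M^2\}$ and $e^M_{\alpha p}(x)=\inf_y\{p(y)+\frac1{2\alpha}\|y-x\|_M^2\}$. Assume the following. 1. (Model functions) There are $\bar\eta\in\mathbb R$, an open convex set $V\supset\mathrm{dom}(r)$ and a measurable real function $(x,y,s)\mapsto f_x(y;s)$ on $V\times V\times\mathcal S$ such that for $P$-almost every $s$: $f_x(x;s)=f(x;s)$ and $|f_x(y;s)-f(y;s)|\le\frac{\bar\eta}{2}\|y-x\|_2^2$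 for all $x,y\in V$. 2. (Preconditioners) $(S_k^i)_{k\in\mathbb Z_+,1\le i\le m}$ are i.i.d. random variables with law $P$, $S_k^{1:m}=(S_k^1,\dots,S_k^m)$, $\mathcal F_k=\sigma(S_1^{1:m},\dots,S_k^{1:m})$ ($\mathcal F_0$ trivial) and $\mathbb E_k=\mathbb E[\,\cdot\mid\mathcal F_{k-1}]$. $M_0=I_d$, and for $k\in\mathbb Z_+$, $M_k$ is an $\mathcal F_k$-measurable random linear map of $\mathbb R^d$ that is almost surely self-adjoint and positive-definite. There are constants $\mu_\infty\in(0,1]$, $L_\infty\in[1,\infty)$ such that for every $k\in\mathbb Z_+$ there are $\mu_k\in[\mu_\infty,\infty)$, $L_k\in(0,L_\infty]$ with, almost surely, $\mu_k\|x\|_{M_k}\le\|x\|_2\le L_k\|x\|_{M_k}$ for all $x$; and there are constants $\rho_0=1$, $\rho_k\in[1,\infty)$ such that for all $k\in\mathbb Z_+$ and $x\ne0$, $\rho_k^{-2}\le\mathbb E_k\big[\|x\|_{M_k}^2/\|x\|_{M_{k-1}}^2\big]\le\rho_k^2$ almost surely, and $\prod_{k=0}^\infty\rho_k<\infty$. 3.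 (Regularity) $F(x)$ is a well-defined real number for every $x\in\mathbb R^d$ and $F$ is locally Lipschitz; $r$ is proper and lower semicontinuous; for $P$-almost every $s$, $f(\cdot;s)$ is proper and lower semicontinuous with $\mathrm{dom}(f(\cdot;s))\supset\mathrm{dom}(r)$, and for all $x\in V$ the function $\varphi_x(\cdot;s)$, equal to $f_x(\cdot;s)+r$ on $\mathrm{dom}(r)$ and to $+\infty$ elsewhere, is (proper, closed and) $\bar\tau$-weakly convex, where $\bar\tau\ge0$. 4. (Sublevel sets) $\phi$ is bounded from below and $\{\phi\le t\}$ is bounded for every $t\in\mathbb R$. 5. (Generalized local Lipschitz condition) There are a nondecreasing $\mathsf G_{\mathrm{Lip}}\colon\mathbb R_+\to\mathbb R_+$ and a measurable $\bar L_f\colon\mathcal S\to\mathbb R_+$ with $\mathbb E_{s\sim P}[\bar L_f(s)^2]<\infty$ such that for $P$-almost every $s$, $|f_x(x;s)-f_x(y;s)|\le\bar L_f(s)\,\mathsf G_{\mathrm{Lip}}(\|x\|_2)\,\|x-y\|_2$ for all $x,y\in V$. Put $\eta=L_\infty^2\bar\eta$, $\tau=L_\infty^2\bar\tau$, $B_\rho=\sup_{k\in\mathbb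 Z_+}\rho_k^2$. Let $(x_k)_{k\in\mathbb Z_+}$ be iterates of the model-based inexact stochastic preconditioned proximal point algorithm (ispPPA): $x_1$ is deterministic, $x_{k+1}$ is $\mathcal F_k$-measurable, almost surely all $x_k$ lie in $V$, and almost surely for every $k$, with $\bar\varphi_k(y)=\frac1m\sum_{i=1}^m\varphi_{x_k}(y;S_k^i)$ and $\Phi_k(y)=\bar\varphi_k(y)+\frac{1}{2\alpha_k}\|y-x_k\|_{M_k}^2$, the point $x_{k+1}$ satisfies at least one of * (A) $\big\|x_{k+1}-\mathrm{prox}^{M_k}_{\alpha_k\bar\varphi_k}(x_k)\big\|_{M_k}\le\epsilon_k$; * (B) $\Phi_k(x_{k+1})-\inf\Phi_k\le\frac{1-\tau\alpha_k}{2\alpha_k}\epsilon_k^2$; * (C) $\mathrm{dist}_{M_k^{-1}}\big(0,\partial\Phi_k(x_{k+1})\big)\le\frac{1-\tau\alpha_k}{\alpha_k}\epsilon_k$, where $\partial p(x)=\{v:\liminf_{x\ne y\to x}\frac{p(y)-p(x)-\langle v,y-x\rangle}{\|y-x\|_2}\ge0\}$ for $p(x)$ finite and $\partial p(x)=\emptyset$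 otherwise. Suppose there are $\gamma\ge0$, $\bar\rho>B_\rho(\eta+\tau)$ and deterministic $\bar\alpha_k>0$ such that for all $k\in\mathbb Z_+$ $$\alpha_k=\frac{\bar\alpha_k}{\max\{1,\mathsf G_{\mathrm{Lip}}(\|x_k\|_2)\}},\qquad \epsilon_k=\gamma\alpha_k^2,$$ where $\sup_{k}\bar\alpha_k<(\bar\rho\max\{2,B_\rho\}+\eta)^{-1}$ and $\sum_{k=1}^\infty\bar\alpha_k^2<\infty$. Then $\sup_{k\in\mathbb Z_+}\|x_k\|_2<\infty$ with probability $1$. If in addition $\sum_{k=1}^\infty\bar\alpha_k=\infty$, then with probability $1$, for every $k\in\mathbb Z_+$ the Moreau envelope $e^{M_{k-1}}_{\bar\rho^{-1}\phi}$ is finite on $\mathbb R^d$ and differentiable at $x_k$, and $$\liminf_{k\to\infty}\big\|\nabla e^{M_{k-1}}_{\bar\rho^{-1}\phi}(x_k)\big\|_2=0 .$$ -/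

import Mathlib

open MeasureTheory ProbabilityTheory Filter Topology

noncomputable section

namespace IspPPA

/-- The Euclidean space `ℝ^d`. -/
abbrev Vec (d : ℕ) : Type := EuclideanSpace ℝ (Fin d)

section ExtendedValued

variable {d : ℕ}

/-- A function `p : ℝ^d → (-∞, +∞]` that is not identically `+∞`. -/
def IsProper (p : Vec d → EReal) : Prop :=
  (∀ x, p x ≠ ⊥) ∧ ∃ x, p x ≠ ⊤

/-- Closed functions are the lower semicontinuous ones. -/
def IsClosedFun (p : Vec d → EReal) : Prop :=
  LowerSemicontinuous p

/-- Convexity of an extended-valued function: its epigraph is convex. -/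
def IsConvexFun (p : Vec d → EReal) : Prop :=
  Convex ℝ {q : Vec d × ℝ | p q.1 ≤ (q.2 : EReal)}

/-- `p` is proper, closed and `τ`-weakly convex: `p + (τ/2)‖·‖²` is proper, closed and convex. -/
def IsWeaklyConvex (τ : ℝ) (p : Vec d → EReal) : Prop :=
  IsProper (fun y => p y + ((τ / 2 * ‖y‖ ^ 2 : ℝ) : EReal)) ∧
  IsClosedFun (fun y => p y + ((τ / 2 * ‖y‖ ^ 2 : ℝ) : EReal)) ∧
  IsConvexFun (fun y => p y + ((τ / 2 * ‖y‖ ^ 2 : ℝ) : EReal))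

/-- The regular (Fréchet) subdifferential of `p` at a point `x` of its domain
(empty if `x` is not in the domain). -/
def regularSubdifferential (p : Vec d → EReal) (x : Vec d) : Set (Vec d) :=
  {v | p x ≠ ⊤ ∧ p x ≠ ⊥ ∧
    0 ≤ liminf (fun y => (p y - p x - ((inner ℝ v (y - x) : ℝ) : EReal)) / ((‖y - x‖ : ℝ) : EReal))
      (𝓝[≠] x)}

/-- Self-adjoint and positive-definite linear mappings of `ℝ^d`. -/
def IsSPD (M : Vec d →L[ℝ] Vec d) : Prop :=
  IsSelfAdjoint M ∧ ∀ x, x ≠ 0 → 0 < inner ℝ x (M x)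

/-- The norm `‖x‖_M = √⟨x, M x⟩`. -/
def normM (M : Vec d →L[ℝ] Vec d) (x : Vec d) : ℝ :=
  √(inner ℝ x (M x))

/-- The function `y ↦ p y + (1/(2α)) ‖y - x‖_M²`. -/
def proxObjective (M : Vec d →L[ℝ] Vec d) (α : ℝ) (p : Vec d → EReal) (x y : Vec d) : EReal :=
  p y + ((1 / (2 * α) * normM M (y - x) ^ 2 : ℝ) : EReal)

/-- The set `prox_{αp}^M(x)` of all minimizers of `y ↦ p y + (1/(2α)) ‖y - x‖_M²`. -/
def proxSet (M : Vec d →L[ℝ] Vec d) (α : ℝ) (p : Vec d → EReal) (x : Vec d) : Set (Vec d) :=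
  {z | ∀ y, proxObjective M α p x z ≤ proxObjective M α p x y}

/-- The Moreau envelope `e_{αp}^M(x)`, as an extended real number. -/
def moreauEnvelope (M : Vec d →L[ℝ] Vec d) (α : ℝ) (p : Vec d → EReal) (x : Vec d) : EReal :=
  ⨅ y, proxObjective M α p x y

end ExtendedValued

section Problem

variable {d : ℕ} {𝒮 : Type*} [MeasurableSpace 𝒮]

/-- `F(x) = E_{s ∼ P} f(x; s)`. -/
def expectedCost (P : Measure 𝒮) (f : Vec d → 𝒮 → EReal) (x : Vec d) : ℝ :=
  ∫ s, (f x s).toReal ∂P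

/-- The objective `φ = F + r`. -/
def objective (P : Measure 𝒮) (f : Vec d → 𝒮 → EReal) (r : Vec d → EReal) (x : Vec d) : EReal :=
  (expectedCost P f x : EReal) + r x

/-- The composite component model function `y ↦ φ_x(y; s) = f_x(y; s) + r(y)`; since `f_x(y; s)` is
real, its value is `+∞` outside the domain of `r`. -/
def modelComposite (fm : Vec d → Vec d → 𝒮 → ℝ) (r : Vec d → EReal) (x : Vec d) (s : 𝒮)
    (y : Vec d) : EReal :=
  (fm x y s : EReal) + r y

/-- The minibatch model function `y ↦ (1/m) ∑ᵢ f_x(y; sᵢ) + r(y)`. -/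
def minibatchComposite {m : ℕ} (fm : Vec d → Vec d → 𝒮 → ℝ) (r : Vec d → EReal) (x : Vec d)
    (s : Fin m → 𝒮) (y : Vec d) : EReal :=
  (((1 / (m : ℝ)) * ∑ i, fm x y (s i) : ℝ) : EReal) + r y

/-- The stochastic model function assumption, with constant `ηbar` and open convex set `V`.
The model `fm x y s = f_x(y; s)` only matters for `x, y ∈ V`. -/
structure ModelAssumption (P : Measure 𝒮) (f : Vec d → 𝒮 → EReal) (r : Vec d → EReal)
    (fm : Vec d → Vec d → 𝒮 → ℝ) (V : Set (Vec d)) (ηbar : ℝ) : Prop where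
  isOpen : IsOpen V
  convex : Convex ℝ V
  dom_subset : {x | r x ≠ ⊤} ⊆ V
  measurable : Measurable (fun q : V × V × 𝒮 => fm q.1 q.2.1 q.2.2)
  model : ∀ᵐ s ∂P, ∀ x ∈ V, ∀ y ∈ V,
    (fm x x s : EReal) = f x s ∧
      ((fm x y s : EReal) - f y s ≤ ((ηbar / 2 * ‖y - x‖ ^ 2 : ℝ) : EReal) ∧
        f y s - (fm x y s : EReal) ≤ ((ηbar / 2 * ‖y - x‖ ^ 2 : ℝ) : EReal))

/-- The regularity assumption on `F`, `r`, `f` and on the composite models. The field `finite` says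
that `F(x) = E f(x; s)` is a well-defined real number for every `x`. -/
structure RegularityAssumption (P : Measure 𝒮) (f : Vec d → 𝒮 → EReal) (r : Vec d → EReal)
    (fm : Vec d → Vec d → 𝒮 → ℝ) (V : Set (Vec d)) (τbar : ℝ) : Prop where
  finite : ∀ x, (∀ᵐ s ∂P, f x s ≠ ⊤) ∧ Integrable (fun s => (f x s).toReal) P
  locallyLipschitz : LocallyLipschitz (expectedCost P f)
  proper_r : IsProper r
  closed_r : IsClosedFun r
  component : ∀ᵐ s ∂P, IsProper (fun x => f x s) ∧ IsClosedFun (fun x => f x s) ∧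
    {x | r x ≠ ⊤} ⊆ {x | f x s ≠ ⊤}
  nonneg : 0 ≤ τbar
  weaklyConvex : ∀ᵐ s ∂P, ∀ x ∈ V, IsWeaklyConvex τbar (modelComposite fm r x s)

/-- The objective is bounded from below and has bounded sublevel sets. -/
structure SublevelAssumption (φ : Vec d → EReal) : Prop where
  bddBelow : ⊥ < ⨅ x, φ x
  bounded : ∀ t : ℝ, Bornology.IsBounded {x | φ x ≤ (t : EReal)}

/-- The generalized Lipschitz condition on the model functions with growth function `G`. -/
structure GrowthLipschitzAssumption (P : Measure 𝒮) (fm : Vec d → Vec d → 𝒮 → ℝ)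
    (V : Set (Vec d)) (G : NNReal → NNReal) : Prop where
  monotone : Monotone G
  lipschitz : ∃ (Lf : 𝒮 → NNReal) (LF : NNReal), Measurable Lf ∧
    Integrable (fun s => (Lf s : ℝ) ^ 2) P ∧ √(∫ s, (Lf s : ℝ) ^ 2 ∂P) ≤ LF ∧
    ∀ᵐ s ∂P, ∀ x ∈ V, ∀ y ∈ V, |fm x x s - fm x y s| ≤ Lf s * G ‖x‖₊ * ‖x - y‖

end Problem

section Algorithm

variable {d m : ℕ} {𝒮 Ω : Type*} [MeasurableSpace 𝒮] [MeasurableSpace Ω]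

/-- `ℱ_k = σ(S_1^{1:m}, …, S_k^{1:m})`; in particular `ℱ_0` is trivial. -/
@[reducible] def sampleFiltration (S : ℕ → Fin m → Ω → 𝒮) (k : ℕ) : MeasurableSpace Ω :=
  ⨆ j ∈ Finset.Icc 1 k, ⨆ i, MeasurableSpace.comap (S j i) inferInstance

/-- The samples `S_k^i`, `k ≥ 1`, `1 ≤ i ≤ m`, are i.i.d. with law `P`. -/
structure IIDSamples (Prob : Measure Ω) (P : Measure 𝒮) (S : ℕ → Fin m → Ω → 𝒮) : Prop where
  measurable : ∀ k, 1 ≤ k → ∀ i, Measurable (S k i)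
  law : ∀ k, 1 ≤ k → ∀ i, Prob.map (S k i) = P
  indep : iIndepFun (fun q : ℕ+ × Fin m => S q.1 q.2) Prob

/-- The assumption on the (random) preconditioners `M_k`, with constants `μinf`, `Linf` and the
deterministic sequence `ρ`. -/
structure PreconditionerAssumption (Prob : Measure Ω) (S : ℕ → Fin m → Ω → 𝒮)
    (M : ℕ → Ω → Vec d →L[ℝ] Vec d) (μinf Linf : ℝ) (ρ : ℕ → ℝ) : Prop where
  μinf_pos : 0 < μinf
  μinf_le : μinf ≤ 1
  Linf_ge : 1 ≤ Linf
  zero : ∀ ω, M 0 ω = ContinuousLinearMap.id ℝ (Vec d)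
  adapted : ∀ k, 1 ≤ k → Measurable[sampleFiltration S k] (M k)
  spd : ∀ᵐ ω ∂Prob, ∀ k, 1 ≤ k → IsSPD (M k ω)
  norm_bounds : ∀ k, 1 ≤ k → ∃ μ L : ℝ, μinf ≤ μ ∧ 0 < L ∧ L ≤ Linf ∧
    ∀ᵐ ω ∂Prob, ∀ z, μ * normM (M k ω) z ≤ ‖z‖ ∧ ‖z‖ ≤ L * normM (M k ω) z
  ρ_zero : ρ 0 = 1
  ρ_ge : ∀ k, 1 ≤ k → 1 ≤ ρ k
  condExp_bounds : ∀ k, 1 ≤ k → ∀ z, z ≠ 0 → ∀ᵐ ω ∂Prob,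
    (ρ k ^ 2)⁻¹ ≤ (Prob[fun ω' => normM (M k ω') z ^ 2 / normM (M (k - 1) ω') z ^ 2 |
        sampleFiltration S (k - 1)]) ω ∧
      (Prob[fun ω' => normM (M k ω') z ^ 2 / normM (M (k - 1) ω') z ^ 2 |
        sampleFiltration S (k - 1)]) ω ≤ ρ k ^ 2
  prod_converges : ∃ νinf : ℝ, Tendsto (fun k => ∏ i ∈ Finset.range k, ρ i) atTop (𝓝 νinf)

/-- Criterion (A): `x'` is `ε`-close, in the `M`-norm, to the proximal point of `p` at `x`. -/
def CriterionA (M : Vec d →L[ℝ] Vec d) (α ε : ℝ) (p : Vec d → EReal) (x x' : Vec d) : Prop :=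
  ∃ z ∈ proxSet M α p x, normM M (x' - z) ≤ ε

/-- Criterion (B): the objective gap of the subproblem at `x'` is at most `(1 - τα)ε²/(2α)`. -/
def CriterionB (τ : ℝ) (M : Vec d →L[ℝ] Vec d) (α ε : ℝ) (p : Vec d → EReal) (x x' : Vec d) :
    Prop :=
  proxObjective M α p x x' ≤
    (⨅ y, proxObjective M α p x y) + (((1 - τ * α) / (2 * α) * ε ^ 2 : ℝ) : EReal)

/-- Criterion (C): the `M⁻¹`-distance from `0` to the subdifferential of the objective of the
subproblem at `x'` is at most `(1 - τα)ε/α` (the distance to the empty set is `+∞`). -/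
def CriterionC (τ : ℝ) (M : Vec d →L[ℝ] Vec d) (α ε : ℝ) (p : Vec d → EReal) (x x' : Vec d) :
    Prop :=
  (⨅ v ∈ regularSubdifferential (proxObjective M α p x) x',
      ((normM (ContinuousLinearMap.inverse M) (0 - v) : ℝ) : EReal)) ≤
    (((1 - τ * α) / α * ε : ℝ) : EReal)

/-- `x_1, x_2, …` are iterates of the model-based inexact stochastic preconditioned proximal point
algorithm with samples `S`, preconditioners `M`, stepsizes `α` and accuracies `ε`. The iterate `x_k`
is determined by the first `k - 1` minibatches (so `x_1` is deterministic) and lies in the set `V`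
on which the models are defined. At each step any one of the three criteria may be used. -/
structure IsIspPPA (Prob : Measure Ω) (r : Vec d → EReal) (fm : Vec d → Vec d → 𝒮 → ℝ)
    (V : Set (Vec d)) (τ : ℝ) (S : ℕ → Fin m → Ω → 𝒮) (M : ℕ → Ω → Vec d →L[ℝ] Vec d)
    (α ε : ℕ → Ω → ℝ) (x : ℕ → Ω → Vec d) : Prop where
  adapted : ∀ k, 1 ≤ k → Measurable[sampleFiltration S (k - 1)] (x k)
  mem : ∀ᵐ ω ∂Prob, ∀ k, 1 ≤ k → x k ω ∈ V
  step : ∀ᵐ ω ∂Prob, ∀ k, 1 ≤ k →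
    CriterionA (M k ω) (α k ω) (ε k ω)
        (minibatchComposite fm r (x k ω) (fun i => S k i ω)) (x k ω) (x (k + 1) ω) ∨
      CriterionB τ (M k ω) (α k ω) (ε k ω)
        (minibatchComposite fm r (x k ω) (fun i => S k i ω)) (x k ω) (x (k + 1) ω) ∨
      CriterionC τ (M k ω) (α k ω) (ε k ω)
        (minibatchComposite fm r (x k ω) (fun i => S k i ω)) (x k ω) (x (k + 1) ω)

end Algorithm

end IspPPA

end

open IspPPA

/-! The Moreau envelope of `φ = F + r`, taken in the metric of the previous iteration, is a
stochastic Lyapunov function. Let `m₀` be a lower bound of `φ`, let `y_k` be the proximal point of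
`φ` at `x_k` in the metric `M_{k-1}` with parameter `1/ρbar`, and put `W_k = e^{M_{k-1}}(x_k) - m₀ ≥
0` and `D_k = ‖y_k - x_k‖²` in the `M_{k-1}`-norm. All of these are known before the `k`-th
minibatch is drawn.

Testing the envelope at `x_{k+1}` with the competitor `y_k` gives `W_{k+1} ≤ φ(y_k) - m₀ + ρbar/2
‖y_k - x_{k+1}‖²` in the `M_k`-norm, so only this distance has to be bounded. Each criterion puts
`x_{k+1}` within `ε_k` of the exact minimizer `z` of the subproblem (`exists_min_of_criteria`). The
strong convexity of the subproblem, used at `z` against `y_k`, and the optimality of `y_k` against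
`z` eliminate `r` (`prox_step_bound`). The stepsize rule cancels the growth function, so the
Lipschitz errors are of order `αbar_k²`. On average over the new minibatch, `M_k` may be replaced by
`M_{k-1}` at the cost of a factor `ρ_k²` (`integral_quad_le_of_condExp_le`), and the model error is
controlled by `η` (`ModelCore.expected_model_le`). This yields `ModelCore.expected_step`: `E_k
W_{k+1} ≤ (1 + a_k) W_k - δ α_k D_k + β αbar_k²`, where `a_k`, made of `ρ_k² - 1` and a multiple of
`αbar_k²`, is summable and `δ > 0` because `ρbar > Bρ (η + τ)`.

By `robbins_siegmund`, almost surely `W_k` is bounded and `∑ α_k D_k` converges. Then `y_k` stays in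
a sublevel set of `φ`, and `D_k ≤ 2 W_k / ρbar`, so `x_k` is bounded. Hence the growth function is
bounded along the path and `∑ α_k` diverges together with `∑ αbar_k`, so `D_k` is arbitrarily small
infinitely often. The gradient of the envelope is `ρbar M_{k-1}(x_k - y_k)`, whose norm is at most a
constant times `√D_k`. -/

namespace IspPPA

/-! ### Convexity with a quadratic modulus and existence of minimizers -/

section ModulusConvex

variable {d : ℕ}

/-- The quadratic form `v ↦ ⟨v, N v⟩`. -/
noncomputable def quad (N : Vec d →L[ℝ] Vec d) (v : Vec d) : ℝ := inner ℝ v (N v)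

/-- Convexity of `g` on `C` with the modulus `q`, which may be negative. -/
def ModulusConvexOn (C : Set (Vec d)) (g q : Vec d → ℝ) : Prop :=
  Convex ℝ C ∧ ∀ y ∈ C, ∀ z ∈ C, ∀ t : ℝ, 0 ≤ t → t ≤ 1 →
    g (z + t • (y - z)) ≤ g z + t * (g y - g z) - t * (1 - t) * q (y - z)

/-- The extension of `g` by `+∞` outside `C` is lower semicontinuous. -/
def ClosedOn (C : Set (Vec d)) (g : Vec d → ℝ) : Prop :=
  ∀ y₀ t, (y₀ ∈ C → t < g y₀) → ∀ᶠ y in 𝓝 y₀, y ∈ C → t < g y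

/-- A quadratic form satisfies the modulus inequality with equality and with itself as modulus.
Adding a multiple of it therefore just shifts the modulus, which lets one notion serve for weak and
strong convexity. -/
lemma quad_add_smul (N : Vec d →L[ℝ] Vec d) (y z : Vec d) (t : ℝ) :
    quad N (z + t • (y - z)) =
      quad N z + t * (quad N y - quad N z) - t * (1 - t) * quad N (y - z) := by
  simp only [quad, map_add, map_smul, map_sub, inner_add_left, inner_add_right, inner_sub_left,
    inner_sub_right, real_inner_smul_left, real_inner_smul_right]
  ring

lemma continuous_quad (N : Vec d →L[ℝ] Vec d) : Continuous (quad N) := by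
  unfold quad; fun_prop

lemma quad_sub_comm (N : Vec d →L[ℝ] Vec d) (y z : Vec d) : quad N (y - z) = quad N (z - y) := by
  rw [← neg_sub z y, quad, map_neg, inner_neg_neg, quad]

lemma ModulusConvexOn.add_quad {C : Set (Vec d)} {g q : Vec d → ℝ} (h : ModulusConvexOn C g q)
    (N : Vec d →L[ℝ] Vec d) (c : ℝ) (x : Vec d) :
    ModulusConvexOn C (fun y => g y + c * quad N (y - x)) (fun v => q v + c * quad N v) := by
  refine ⟨h.1, fun y hy z hz t h0 h1 => ?_⟩
  have h2 := h.2 y hy z hz t h0 h1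
  have h3 := quad_add_smul N (y - x) (z - x) t
  have e1 : z - x + t • (y - x - (z - x)) = z + t • (y - z) - x := by
    rw [sub_sub_sub_cancel_right]; abel
  rw [e1, sub_sub_sub_cancel_right] at h3
  simp only [h3]
  linarith

lemma ModulusConvexOn.const_mul {C : Set (Vec d)} {g q : Vec d → ℝ} {c : ℝ}
    (h : ModulusConvexOn C g q) (hc : 0 ≤ c) :
    ModulusConvexOn C (fun y => c * g y) (fun v => c * q v) := by
  refine ⟨h.1, fun y hy z hz t h0 h1 => ?_⟩
  have := mul_le_mul_of_nonneg_left (h.2 y hy z hz t h0 h1) hc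
  simp only
  linarith

lemma ModulusConvexOn.sum {ι : Type*} {C : Set (Vec d)} (hC : Convex ℝ C) (s : Finset ι)
    {g : ι → Vec d → ℝ} {q : ι → Vec d → ℝ} (h : ∀ i ∈ s, ModulusConvexOn C (g i) (q i)) :
    ModulusConvexOn C (fun y => ∑ i ∈ s, g i y) (fun v => ∑ i ∈ s, q i v) := by
  refine ⟨hC, fun y hy z hz t h0 h1 => ?_⟩
  simp only [← Finset.sum_sub_distrib, Finset.mul_sum, ← Finset.sum_add_distrib]
  exact Finset.sum_le_sum fun i hi => (h i hi).2 y hy z hz t h0 h1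

lemma ClosedOn.add {C : Set (Vec d)} {g₁ g₂ : Vec d → ℝ} (h₁ : ClosedOn C g₁)
    (h₂ : ClosedOn C g₂) : ClosedOn C (fun y => g₁ y + g₂ y) := by
  intro y₀ t ht
  by_cases hy : y₀ ∈ C
  · have := ht hy
    set δ := (g₁ y₀ + g₂ y₀ - t) / 2 with hδ
    have a := h₁ y₀ (g₁ y₀ - δ) (fun _ => by linarith)
    have b := h₂ y₀ (g₂ y₀ - δ) (fun _ => by linarith)
    filter_upwards [a, b] with y ha hb hyC
    linarith [ha hyC, hb hyC]
  · filter_upwards [h₁ y₀ t (fun h => absurd h hy), h₂ y₀ 0 (fun h => absurd h hy)]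
      with y ha hb hyC
    linarith [ha hyC, hb hyC]

lemma ClosedOn.of_continuous {C : Set (Vec d)} {g k : Vec d → ℝ} (h : ClosedOn C g)
    (hk : Continuous k) : ClosedOn C (fun y => g y + k y) := by
  intro y₀ t ht
  by_cases hy : y₀ ∈ C
  · have := ht hy
    set δ := (g y₀ + k y₀ - t) / 2 with hδ
    have a := h y₀ (g y₀ - δ) (fun _ => by linarith)
    have b := (hk.tendsto y₀).eventually (lt_mem_nhds (a := k y₀ - δ) (by linarith))
    filter_upwards [a, b] with y ha hb hyC
    linarith [ha hyC]
  · have b := (hk.tendsto y₀).eventually (lt_mem_nhds (a := k y₀ - 1) (by linarith))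
    filter_upwards [h y₀ (t - k y₀ + 1) (fun h => absurd h hy), b] with y ha hb hyC
    linarith [ha hyC]

lemma ClosedOn.const_mul {C : Set (Vec d)} {g : Vec d → ℝ} {c : ℝ} (h : ClosedOn C g)
    (hc : 0 < c) : ClosedOn C (fun y => c * g y) := by
  intro y₀ t ht
  filter_upwards [h y₀ (t / c) (fun hy => by rw [div_lt_iff₀' hc]; exact ht hy)] with y ha hyC
  have := ha hyC
  rwa [div_lt_iff₀' hc] at this

lemma ClosedOn.sum {ι : Type*} {C : Set (Vec d)} {s : Finset ι} (hs : s.Nonempty)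
    {g : ι → Vec d → ℝ} (h : ∀ i ∈ s, ClosedOn C (g i)) :
    ClosedOn C (fun y => ∑ i ∈ s, g i y) := by
  classical
  induction hs using Finset.Nonempty.cons_induction with
  | singleton a => simpa using h a (by simp)
  | cons a s ha hs ih =>
    simp only [Finset.sum_cons]
    exact (h a (by simp)).add (ih fun i hi => h i (by simp [hi]))

/-- The extension by `⊤` is lower semicontinuous into `EReal`, hence attains its minimum on a
compact set. One finite value forces the minimizer into `C`. -/
lemma ClosedOn.exists_min_compact {C K : Set (Vec d)} {g : Vec d → ℝ} (h : ClosedOn C g)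
    (hK : IsCompact K) (hne : (C ∩ K).Nonempty) :
    ∃ z ∈ C ∩ K, ∀ y ∈ C ∩ K, g z ≤ g y := by
  classical
  obtain ⟨y₁, hy₁C, hy₁K⟩ := hne
  set e : Vec d → EReal := fun y => if y ∈ C then (g y : EReal) else ⊤ with he
  have hl : LowerSemicontinuousOn e K := by
    intro y₀ _ t ht
    refine Filter.Eventually.filter_mono nhdsWithin_le_nhds ?_
    induction t using EReal.rec with
    | bot => filter_upwards with y; simp only [he]; split_ifs <;> simp [EReal.bot_lt_coe]
    | top => simp at ht
    | coe t =>
      have h1 : y₀ ∈ C → t < g y₀ := by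
        intro hy; simpa [he, hy] using ht
      filter_upwards [h y₀ t h1] with y hy
      simp only [he]
      split_ifs with hyC
      · exact_mod_cast hy hyC
      · exact EReal.coe_lt_top _
  obtain ⟨z, hzK, hz⟩ := hl.exists_isMinOn ⟨y₁, hy₁K⟩ hK
  have hzC : z ∈ C := by
    by_contra hzC
    have := hz hy₁K
    simp [he, hzC, hy₁C] at this
  refine ⟨z, ⟨hzC, hzK⟩, fun y hy => ?_⟩
  have := hz hy.2
  simpa [he, hzC, hy.1] using this

/-- Coercivity comes from strong convexity alone. A minimum `g w` over the unit ball around `y₀`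
bounds `g` from below on the unit sphere. Comparing a point `y` at distance `s > 1` with the point
of the segment on that sphere (`t = s⁻¹`) gives `s⁻¹ (g y - g y₀) ≥ c (s - 1) - (g y₀ - g w)`, which
is nonnegative as soon as `s > r`. -/
lemma ModulusConvexOn.exists_min {C : Set (Vec d)} {g q : Vec d → ℝ} {c : ℝ}
    (h : ModulusConvexOn C g q) (hcl : ClosedOn C g) (hne : C.Nonempty) (hc : 0 < c)
    (hq : ∀ v, c * ‖v‖ ^ 2 ≤ q v) : ∃ z ∈ C, ∀ y ∈ C, g z ≤ g y := by
  obtain ⟨y₀, hy₀⟩ := hne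
  obtain ⟨w, -, hw⟩ := hcl.exists_min_compact (isCompact_closedBall y₀ 1)
    ⟨y₀, hy₀, by simp⟩
  have hlb : g w ≤ g y₀ := hw y₀ ⟨hy₀, by simp⟩
  set r := 1 + (g y₀ - g w) / c with hr
  have hr1 : 1 ≤ r := by
    have : 0 ≤ (g y₀ - g w) / c := div_nonneg (by linarith) hc.le
    linarith
  obtain ⟨z, hz, hzm⟩ := hcl.exists_min_compact (isCompact_closedBall y₀ r)
    ⟨y₀, hy₀, by simp; linarith⟩
  refine ⟨z, hz.1, fun y hy => ?_⟩
  by_cases hyr : ‖y - y₀‖ ≤ r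
  · exact hzm y ⟨hy, by simpa [dist_eq_norm] using hyr⟩
  push Not at hyr
  refine (hzm y₀ ⟨hy₀, by simp; linarith⟩).trans ?_
  set s := ‖y - y₀‖ with hs
  have hs1 : 1 < s := by linarith
  have hs0 : 0 < s := by linarith
  have ht0 : 0 ≤ s⁻¹ := by positivity
  have ht1 : s⁻¹ ≤ 1 := inv_le_one_of_one_le₀ hs1.le
  have h1 := h.2 y hy y₀ hy₀ s⁻¹ ht0 ht1
  have h2 : g w ≤ g (y₀ + s⁻¹ • (y - y₀)) := by
    refine hw _ ⟨h.1.add_smul_sub_mem hy₀ hy ⟨ht0, ht1⟩, ?_⟩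
    simp [norm_smul, ← hs, abs_of_pos hs0, hs0.ne']
  have h3 : s⁻¹ * (1 - s⁻¹) * (c * s ^ 2) ≤ s⁻¹ * (1 - s⁻¹) * q (y - y₀) :=
    mul_le_mul_of_nonneg_left (hq _) (mul_nonneg ht0 (by linarith))
  have h4 : s⁻¹ * (1 - s⁻¹) * (c * s ^ 2) = c * (s - 1) := by field_simp
  have h5 : g y₀ - g w ≤ c * (s - 1) := by
    have : (g y₀ - g w) / c < s - 1 := by linarith
    rw [div_lt_iff₀' hc] at this
    exact this.le
  have h6 : 0 ≤ s⁻¹ * (g y - g y₀) := by linarith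
  have h7 : 0 ≤ g y - g y₀ := by
    by_contra hneg
    push Not at hneg
    have : s⁻¹ * (g y - g y₀) < 0 := mul_neg_of_pos_of_neg (by positivity) hneg
    linarith
  linarith

lemma le_of_eventually_one_sub_mul_le {q b : ℝ} (h : ∀ᶠ t in 𝓝[>] (0 : ℝ), (1 - t) * q ≤ b) :
    q ≤ b := by
  have h1 : Tendsto (fun t : ℝ => (1 - t) * q) (𝓝[>] 0) (𝓝 ((1 - 0) * q)) :=
    ((continuous_const.sub continuous_id).mul continuous_const).continuousAt.tendsto.mono_left
      nhdsWithin_le_nhds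
  simpa using le_of_tendsto h1 h

/-- Minimality of `z` bounds the value on the segment from below; dividing the modulus inequality by
`t` and letting `t → 0` leaves the full modulus. -/
lemma ModulusConvexOn.growth {C : Set (Vec d)} {g q : Vec d → ℝ} (h : ModulusConvexOn C g q)
    {z : Vec d} (hz : z ∈ C) (hmin : ∀ y ∈ C, g z ≤ g y) {y : Vec d} (hy : y ∈ C) :
    g z + q (y - z) ≤ g y := by
  suffices q (y - z) ≤ g y - g z by linarith
  refine le_of_eventually_one_sub_mul_le ?_
  filter_upwards [Ioo_mem_nhdsGT (zero_lt_one (α := ℝ))] with t ht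
  have h1 := h.2 y hy z hz t ht.1.le ht.2.le
  have h2 := hmin _ (h.1.add_smul_sub_mem hz hy ⟨ht.1.le, ht.2.le⟩)
  have h3 : t * ((1 - t) * q (y - z)) ≤ t * (g y - g z) := by linarith
  exact le_of_mul_le_mul_left h3 ht.1

/-- A Fréchet subgradient is only a local first-order condition; the modulus makes it global. Along
the segment its error is at most `ε t`, which survives the division by `t` and then vanishes with
`ε`. -/
lemma ModulusConvexOn.subgradient_growth {C : Set (Vec d)} {g q : Vec d → ℝ}
    (h : ModulusConvexOn C g q) {z v : Vec d} (hz : z ∈ C)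
    (hv : ∀ ε > 0, ∀ᶠ y in 𝓝 z, y ∈ C → -(ε * ‖y - z‖) ≤ g y - g z - inner ℝ v (y - z))
    {y : Vec d} (hy : y ∈ C) : g z + inner ℝ v (y - z) + q (y - z) ≤ g y := by
  suffices q (y - z) ≤ g y - g z - inner ℝ v (y - z) by linarith
  refine le_of_forall_pos_le_add fun ε hε => ?_
  refine le_of_eventually_one_sub_mul_le ?_
  set δ := ε / (‖y - z‖ + 1) with hδ
  have hδ0 : 0 < δ := by positivity
  have hδε : δ * ‖y - z‖ ≤ ε := by
    rw [hδ, div_mul_eq_mul_div, div_le_iff₀ (by positivity)]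
    nlinarith [norm_nonneg (y - z)]
  have hc : Tendsto (fun t : ℝ => z + t • (y - z)) (𝓝[>] 0) (𝓝 z) := by
    have : Continuous (fun t : ℝ => z + t • (y - z)) := by fun_prop
    simpa using (this.tendsto 0).mono_left nhdsWithin_le_nhds
  filter_upwards [Ioo_mem_nhdsGT (zero_lt_one (α := ℝ)), hc.eventually (hv δ hδ0)] with t ht h0
  have h1 := h.2 y hy z hz t ht.1.le ht.2.le
  have h2 := h0 (h.1.add_smul_sub_mem hz hy ⟨ht.1.le, ht.2.le⟩)
  rw [add_sub_cancel_left, norm_smul, real_inner_smul_right, Real.norm_of_nonneg ht.1.le] at h2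
  have h4 : t * (δ * ‖y - z‖) ≤ t * ε := mul_le_mul_of_nonneg_left hδε ht.1.le
  have h3 : t * ((1 - t) * q (y - z)) ≤ t * (g y - g z - inner ℝ v (y - z) + ε) := by linarith
  exact le_of_mul_le_mul_left h3 ht.1

end ModulusConvex

/-! ### From extended-valued functions to real functions on their domain -/

section Represents

variable {d : ℕ}

/-- The extended-valued function `p` equals the real function `g` on `C` and is `+∞` elsewhere. -/
def Represents (p : Vec d → EReal) (C : Set (Vec d)) (g : Vec d → ℝ) : Prop :=
  (∀ y ∈ C, p y = (g y : EReal)) ∧ ∀ y ∉ C, p y = ⊤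

lemma Represents.mem_of_le {p : Vec d → EReal} {C : Set (Vec d)} {g : Vec d → ℝ}
    (h : Represents p C g) {y : Vec d} {t : ℝ} (hy : p y ≤ t) : y ∈ C ∧ g y ≤ t := by
  have hC : y ∈ C := by
    by_contra hC
    rw [h.2 y hC] at hy
    simp at hy
  refine ⟨hC, ?_⟩
  rw [h.1 y hC] at hy
  exact_mod_cast hy

lemma Represents.add_real {p : Vec d → EReal} {C : Set (Vec d)} {g : Vec d → ℝ}
    (h : Represents p C g) (k : Vec d → ℝ) :
    Represents (fun y => p y + (k y : EReal)) C (fun y => g y + k y) := by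
  refine ⟨fun y hy => ?_, fun y hy => ?_⟩
  · simp [h.1 y hy]
  · simp [h.2 y hy]

lemma Represents.modulusConvexOn {p : Vec d → EReal} {C : Set (Vec d)} {g : Vec d → ℝ}
    (h : Represents p C g) {τ : ℝ} (hp : IsWeaklyConvex τ p) :
    ModulusConvexOn C g (fun v => -(τ / 2 * ‖v‖ ^ 2)) := by
  have hr := h.add_real (fun y => τ / 2 * ‖y‖ ^ 2)
  have key : ∀ y ∈ C, ∀ z ∈ C, ∀ t : ℝ, 0 ≤ t → t ≤ 1 → z + t • (y - z) ∈ C ∧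
      g (z + t • (y - z)) + τ / 2 * ‖z + t • (y - z)‖ ^ 2 ≤
        (g z + τ / 2 * ‖z‖ ^ 2) + t * ((g y + τ / 2 * ‖y‖ ^ 2) - (g z + τ / 2 * ‖z‖ ^ 2)) := by
    intro y hy z hz t h0 h1
    have hy' : (y, g y + τ / 2 * ‖y‖ ^ 2) ∈
        {q : Vec d × ℝ | p q.1 + ((τ / 2 * ‖q.1‖ ^ 2 : ℝ) : EReal) ≤ (q.2 : EReal)} := by
      simp only [Set.mem_ofPred_eq]; exact (hr.1 y hy).le
    have hz' : (z, g z + τ / 2 * ‖z‖ ^ 2) ∈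
        {q : Vec d × ℝ | p q.1 + ((τ / 2 * ‖q.1‖ ^ 2 : ℝ) : EReal) ≤ (q.2 : EReal)} := by
      simp only [Set.mem_ofPred_eq]; exact (hr.1 z hz).le
    have := hp.2.2.add_smul_sub_mem hz' hy' ⟨h0, h1⟩
    exact hr.mem_of_le this
  refine ⟨convex_iff_add_mem.2 fun y hy z hz a b ha hb hab => ?_, fun y hy z hz t h0 h1 => ?_⟩
  · have := (key y hy z hz a ha (by linarith)).1
    have e : z + a • (y - z) = a • y + b • z := by
      rw [show b = 1 - a by linarith]; module
    rwa [e] at this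
  · have h2 := (key y hy z hz t h0 h1).2
    have h3 := quad_add_smul (ContinuousLinearMap.id ℝ (Vec d)) y z t
    simp only [quad, ContinuousLinearMap.id_apply, real_inner_self_eq_norm_sq] at h3
    rw [h3] at h2
    linarith

lemma Represents.closedOn {p : Vec d → EReal} {C : Set (Vec d)} {g : Vec d → ℝ}
    (h : Represents p C g) (hp : LowerSemicontinuous p) : ClosedOn C g := by
  intro y₀ t ht
  have h0 : (t : EReal) < p y₀ := by
    by_cases hy : y₀ ∈ C
    · rw [h.1 y₀ hy]; exact_mod_cast ht hy
    · rw [h.2 y₀ hy]; exact EReal.coe_lt_top _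
  filter_upwards [hp y₀ t h0] with y hy hyC
  rw [h.1 y hyC] at hy
  exact_mod_cast hy

lemma Represents.closedOn_of_weaklyConvex {p : Vec d → EReal} {C : Set (Vec d)} {g : Vec d → ℝ}
    (h : Represents p C g) {τ : ℝ} (hp : IsWeaklyConvex τ p) : ClosedOn C g := by
  have h1 := (h.add_real (fun y => τ / 2 * ‖y‖ ^ 2)).closedOn hp.2.1
  have h2 := h1.of_continuous (k := fun y => -(τ / 2 * ‖y‖ ^ 2)) (by fun_prop)
  simpa using h2

end Represents

end IspPPA

namespace IspPPA

/-! ### Metrics uniformly comparable to the Euclidean one -/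

section Metric

variable {d : ℕ}

/-- Self-adjoint maps whose quadratic form is comparable to the squared Euclidean norm. -/
structure IsMetric (μ L : ℝ) (N : Vec d →L[ℝ] Vec d) : Prop where
  selfAdjoint : IsSelfAdjoint N
  lower : ∀ v, ‖v‖ ^ 2 ≤ L ^ 2 * quad N v
  upper : ∀ v, μ ^ 2 * quad N v ≤ ‖v‖ ^ 2

lemma _root_.IsSelfAdjoint.inner_apply_comm {N : Vec d →L[ℝ] Vec d} (h : IsSelfAdjoint N)
    (u v : Vec d) : inner ℝ u (N v) = inner ℝ v (N u) := by
  have := h.isSymmetric u v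
  simp only [ContinuousLinearMap.coe_coe] at this
  rw [← this, real_inner_comm]

variable {μ L : ℝ} {N : Vec d →L[ℝ] Vec d}

lemma IsMetric.quad_nonneg (h : IsMetric μ L N) (hL : 0 < L) (v : Vec d) : 0 ≤ quad N v := by
  have h1 : 0 ≤ L ^ 2 * quad N v := (sq_nonneg _).trans (h.lower v)
  exact nonneg_of_mul_nonneg_right h1 (by positivity)

lemma quad_le_opNorm (N : Vec d →L[ℝ] Vec d) (v : Vec d) : quad N v ≤ ‖N‖ * ‖v‖ ^ 2 := by
  refine (real_inner_le_norm _ _).trans ?_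
  have := mul_le_mul_of_nonneg_left (N.le_opNorm v) (norm_nonneg v)
  linarith [this, show ‖v‖ * (‖N‖ * ‖v‖) = ‖N‖ * ‖v‖ ^ 2 by ring]

lemma inner_sq_le_quad_mul_quad (hN : IsSelfAdjoint N) (h0 : ∀ v, 0 ≤ quad N v) (u v : Vec d) :
    inner ℝ u (N v) ^ 2 ≤ quad N u * quad N v := by
  have key : ∀ t : ℝ, 0 ≤ quad N v * (t * t) + (2 * inner ℝ u (N v)) * t + quad N u := by
    intro t
    have h1 := h0 (u + t • v)
    have h2 := hN.inner_apply_comm v u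
    simp only [quad, map_add, map_smul, inner_add_left, inner_add_right, real_inner_smul_left,
      real_inner_smul_right] at h1 ⊢
    rw [h2] at h1
    linarith
  have := discrim_le_zero key
  unfold discrim at this
  linarith

/-- Cauchy–Schwarz for the form of `N`, applied to `N v` and `v`, combined with the upper bound at
`N v`. No square root of `N` is needed. -/
lemma IsMetric.norm_apply_sq_le (h : IsMetric μ L N) (hμ : 0 < μ) (hL : 0 < L) (v : Vec d) :
    μ ^ 2 * ‖N v‖ ^ 2 ≤ quad N v := by
  have h1 := inner_sq_le_quad_mul_quad h.selfAdjoint (h.quad_nonneg hL) (N v) v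
  rw [real_inner_self_eq_norm_sq] at h1
  have h2 := h.upper (N v)
  have h3 := h.quad_nonneg hL v
  rcases eq_or_ne (N v) 0 with h0 | h0
  · simpa [h0] using h3
  have h4 : 0 < ‖N v‖ ^ 2 := by positivity
  have h5 : ‖N v‖ ^ 2 * (μ ^ 2 * ‖N v‖ ^ 2) ≤ ‖N v‖ ^ 2 * quad N v := by
    calc _ = μ ^ 2 * (‖N v‖ ^ 2) ^ 2 := by ring
      _ ≤ μ ^ 2 * (quad N (N v) * quad N v) := by gcongr
      _ = (μ ^ 2 * quad N (N v)) * quad N v := by ring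
      _ ≤ _ := by gcongr
  exact le_of_mul_le_mul_left h5 h4

lemma isMetric_id (hμ : 0 < μ) (hμ1 : μ ≤ 1) (hL : 1 ≤ L) :
    IsMetric μ L (ContinuousLinearMap.id ℝ (Vec d)) := by
  refine ⟨IsSelfAdjoint.one _, fun v => ?_, fun v => ?_⟩ <;>
    simp only [quad, ContinuousLinearMap.id_apply, real_inner_self_eq_norm_sq]
  · have : 1 ≤ L ^ 2 := one_le_pow₀ hL
    nlinarith [sq_nonneg ‖v‖]
  · have : μ ^ 2 ≤ 1 := pow_le_one₀ hμ.le hμ1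
    nlinarith [sq_nonneg ‖v‖]

lemma normM_sq (h0 : ∀ v, 0 ≤ quad N v) (v : Vec d) : normM N v ^ 2 = quad N v :=
  Real.sq_sqrt (h0 v)

/-- Closedness makes this set Borel, so that preconditioners can be altered off it without losing
adaptedness. -/
lemma isClosed_isMetric (μ L : ℝ) : IsClosed {N : Vec d →L[ℝ] Vec d | IsMetric μ L N} := by
  have : {N : Vec d →L[ℝ] Vec d | IsMetric μ L N} =
      {N | star N = N} ∩ ((⋂ v, {N | ‖v‖ ^ 2 ≤ L ^ 2 * quad N v}) ∩
        ⋂ v, {N | μ ^ 2 * quad N v ≤ ‖v‖ ^ 2}) := by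
    ext N
    simp only [Set.mem_ofPred_eq, Set.mem_inter_iff, Set.mem_iInter]
    exact ⟨fun h => ⟨h.1, h.2, h.3⟩, fun h => ⟨h.1, h.2.1, h.2.2⟩⟩
  rw [this]
  have hq : ∀ v : Vec d, Continuous fun N : Vec d →L[ℝ] Vec d => quad N v := fun v => by
    unfold quad; fun_prop
  refine (isClosed_eq (ContinuousLinearMap.adjoint (𝕜 := ℝ) (E := Vec d) (F := Vec d)).continuous
    continuous_id).inter
    ((isClosed_iInter fun v => isClosed_le (by fun_prop) ((hq v).const_mul _)).inter
      (isClosed_iInter fun v => isClosed_le ((hq v).const_mul _) (by fun_prop)))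

end Metric

/-! ### Proximal points and Moreau envelopes in a variable metric -/

section Prox

variable {d : ℕ}

/-- The proximal point of `g` on `C` at `x` in the metric `N`, with parameter `1 / ρ`. -/
noncomputable def proxPt (C : Set (Vec d)) (g : Vec d → ℝ) (ρ : ℝ) (N : Vec d →L[ℝ] Vec d)
    (x : Vec d) : Vec d :=
  Classical.epsilon fun z => z ∈ C ∧
    ∀ y ∈ C, g z + ρ / 2 * quad N (z - x) ≤ g y + ρ / 2 * quad N (y - x)

/-- The Moreau envelope as a real number. -/
noncomputable def env (C : Set (Vec d)) (g : Vec d → ℝ) (ρ : ℝ) (N : Vec d →L[ℝ] Vec d)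
    (x : Vec d) : ℝ :=
  g (proxPt C g ρ N x) + ρ / 2 * quad N (proxPt C g ρ N x - x)

/-- A closed `κ`-weakly convex function together with a prox parameter `ρ` that is large enough
for all metrics with lower constant `L`. -/
structure ProxRegular (C : Set (Vec d)) (g : Vec d → ℝ) (κ ρ μ L : ℝ) : Prop where
  nonempty : C.Nonempty
  closedOn : ClosedOn C g
  convex : ModulusConvexOn C g (fun v => -(κ / 2 * ‖v‖ ^ 2))
  μ_pos : 0 < μ
  L_pos : 0 < L
  ρ_pos : 0 < ρ
  lt : L ^ 2 * κ < ρ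

variable {C : Set (Vec d)} {g : Vec d → ℝ} {κ ρ μ L : ℝ} {N N' : Vec d →L[ℝ] Vec d}

/-- Strong convexity constant of the proximal subproblems. -/
noncomputable def proxModulus (κ ρ L : ℝ) : ℝ := (ρ - L ^ 2 * κ) / (2 * L ^ 2)

lemma ProxRegular.modulus_pos (h : ProxRegular C g κ ρ μ L) : 0 < proxModulus κ ρ L :=
  div_pos (by linarith [h.lt]) (by have := h.L_pos; positivity)

lemma ProxRegular.modulus_le (h : ProxRegular C g κ ρ μ L) (hN : IsMetric μ L N) (v : Vec d) :
    proxModulus κ ρ L * ‖v‖ ^ 2 ≤ -(κ / 2 * ‖v‖ ^ 2) + ρ / 2 * quad N v := by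
  have hL := h.L_pos
  have h1 : proxModulus κ ρ L * ‖v‖ ^ 2 = ρ / (2 * L ^ 2) * ‖v‖ ^ 2 - κ / 2 * ‖v‖ ^ 2 := by
    unfold proxModulus; field_simp
  have h2 : ρ / (2 * L ^ 2) * ‖v‖ ^ 2 ≤ ρ / 2 * quad N v := by
    calc ρ / (2 * L ^ 2) * ‖v‖ ^ 2 ≤ ρ / (2 * L ^ 2) * (L ^ 2 * quad N v) := by
          have := h.ρ_pos
          exact mul_le_mul_of_nonneg_left (hN.lower v) (by positivity)
      _ = _ := by field_simp
  linarith

lemma ProxRegular.proxPt_spec (h : ProxRegular C g κ ρ μ L) (hN : IsMetric μ L N) (x : Vec d) :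
    proxPt C g ρ N x ∈ C ∧ ∀ y ∈ C, env C g ρ N x ≤ g y + ρ / 2 * quad N (y - x) := by
  have hcl : ClosedOn C (fun y => g y + ρ / 2 * quad N (y - x)) :=
    h.closedOn.of_continuous (continuous_const.mul
      ((continuous_quad N).comp (continuous_id.sub continuous_const)))
  obtain ⟨z, hz, hm⟩ := (h.convex.add_quad N (ρ / 2) x).exists_min hcl h.nonempty h.modulus_pos
    (h.modulus_le hN)
  exact Classical.epsilon_spec (p := fun z => z ∈ C ∧
    ∀ y ∈ C, g z + ρ / 2 * quad N (z - x) ≤ g y + ρ / 2 * quad N (y - x)) ⟨z, hz, hm⟩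

lemma ProxRegular.growth (h : ProxRegular C g κ ρ μ L) (hN : IsMetric μ L N) (x : Vec d)
    {y : Vec d} (hy : y ∈ C) :
    env C g ρ N x + proxModulus κ ρ L * ‖y - proxPt C g ρ N x‖ ^ 2 ≤
      g y + ρ / 2 * quad N (y - x) := by
  obtain ⟨hz, hm⟩ := h.proxPt_spec hN x
  have h1 := (h.convex.add_quad N (ρ / 2) x).growth hz hm hy
  have h2 := h.modulus_le hN (y - proxPt C g ρ N x)
  unfold env
  linarith

/-- The growth inequalities at the two proximal points, each tested with the other one, are added;
the values of `g` cancel. Varying the metric gives measurability of proximal points, and `N = N'`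
gives their Lipschitz dependence on the centre. -/
lemma ProxRegular.dist_proxPt_le (h : ProxRegular C g κ ρ μ L) (hN : IsMetric μ L N)
    (hN' : IsMetric μ L N') (x x' : Vec d) :
    (2 * proxModulus κ ρ L - ρ / 2 * ‖N - N'‖) *
        ‖proxPt C g ρ N' x' - proxPt C g ρ N x‖ ≤
      ρ * (‖N - N'‖ * ‖proxPt C g ρ N x‖ + ‖N x - N' x'‖) := by
  have h1 := h.growth hN x (h.proxPt_spec hN' x').1
  have h2 := h.growth hN' x' (h.proxPt_spec hN x).1
  unfold env at h1 h2
  set y := proxPt C g ρ N x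
  set y' := proxPt C g ρ N' x'
  set c := proxModulus κ ρ L
  rw [norm_sub_rev y y'] at h2
  set s := ‖y' - y‖ with hs
  have hρ := h.ρ_pos
  -- This double difference carries a factor `y' - y`, so one power of `s` can be divided out at the
  -- end.
  have key : quad N (y' - x) - quad N' (y' - x') - (quad N (y - x) - quad N' (y - x')) =
      inner ℝ (y' - y) ((N - N') ((2 : ℝ) • y) + (N - N') (y' - y) -
        (2 : ℝ) • (N x - N' x')) := by
    have a1 := hN.selfAdjoint.inner_apply_comm y y'
    have a2 := hN.selfAdjoint.inner_apply_comm x y'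
    have a3 := hN.selfAdjoint.inner_apply_comm x y
    have b1 := hN'.selfAdjoint.inner_apply_comm y y'
    have b2 := hN'.selfAdjoint.inner_apply_comm x' y'
    have b3 := hN'.selfAdjoint.inner_apply_comm x' y
    simp only [quad, sub_apply, map_sub, map_smul, inner_add_right,
      inner_sub_left, inner_sub_right, real_inner_smul_right]
    linear_combination a1 - b1 - a2 + a3 + b2 - b3
  have hb : inner ℝ (y' - y) ((N - N') ((2 : ℝ) • y) + (N - N') (y' - y) -
        (2 : ℝ) • (N x - N' x')) ≤
      s * (2 * (‖N - N'‖ * ‖y‖) + ‖N - N'‖ * s + 2 * ‖N x - N' x'‖) := by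
    refine (real_inner_le_norm _ _).trans (mul_le_mul_of_nonneg_left ?_ (norm_nonneg _))
    refine (norm_sub_le _ _).trans (add_le_add ((norm_add_le _ _).trans (add_le_add ?_ ?_)) ?_)
    · rw [map_smul, norm_smul]
      simpa using (N - N').le_opNorm y
    · exact (N - N').le_opNorm _
    · rw [norm_smul]; simp
  have h3 : 2 * c * s ^ 2 ≤ ρ / 2 *
      (s * (2 * (‖N - N'‖ * ‖y‖) + ‖N - N'‖ * s + 2 * ‖N x - N' x'‖)) := by
    have := mul_le_mul_of_nonneg_left (key.trans_le hb) (by positivity : 0 ≤ ρ / 2)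
    linarith
  rcases (norm_nonneg (y' - y)).eq_or_lt with h0 | h0
  · rw [← hs] at h0
    rw [← h0, mul_zero]
    positivity
  · have h4 : s * ((2 * c - ρ / 2 * ‖N - N'‖) * s) ≤
        s * (ρ * (‖N - N'‖ * ‖y‖ + ‖N x - N' x'‖)) := by linarith
    exact le_of_mul_le_mul_left h4 h0

/-- Once `ρ / 2 * ‖N - N'‖` is below the strong convexity constant `c`, the coefficient in
`dist_proxPt_le` is at least `c`. Joint continuity is what makes the proximal point, defined by
choice, measurable in a random metric and a random centre. -/
lemma ProxRegular.continuous_proxPt (h : ProxRegular C g κ ρ μ L) :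
    Continuous fun q : {N : Vec d →L[ℝ] Vec d // IsMetric μ L N} × Vec d =>
      proxPt C g ρ q.1.1 q.2 := by
  rw [continuous_iff_continuousAt]
  rintro ⟨⟨N, hN⟩, x⟩
  have hc := h.modulus_pos
  set c := proxModulus κ ρ L with hcdef
  set B : {N : Vec d →L[ℝ] Vec d // IsMetric μ L N} × Vec d → ℝ := fun q =>
    c⁻¹ * (ρ * (‖N - q.1.1‖ * ‖proxPt C g ρ N x‖ + ‖N x - q.1.1 q.2‖)) with hB
  have hval : Continuous fun q : {N : Vec d →L[ℝ] Vec d // IsMetric μ L N} × Vec d =>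
      (q.1.1 : Vec d →L[ℝ] Vec d) := continuous_subtype_val.comp continuous_fst
  have happ : Continuous fun q : {N : Vec d →L[ℝ] Vec d // IsMetric μ L N} × Vec d =>
      q.1.1 q.2 := hval.clm_apply continuous_snd
  have hB0 : Tendsto B (𝓝 (⟨N, hN⟩, x)) (𝓝 0) := by
    have : Continuous B := by fun_prop
    simpa [hB] using this.tendsto (⟨N, hN⟩, x)
  have hsmall : ∀ᶠ q : {N : Vec d →L[ℝ] Vec d // IsMetric μ L N} × Vec d
      in 𝓝 (⟨N, hN⟩, x), ρ / 2 * ‖N - q.1.1‖ < c := by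
    have : Continuous fun q : {N : Vec d →L[ℝ] Vec d // IsMetric μ L N} × Vec d =>
      ρ / 2 * ‖N - q.1.1‖ := by fun_prop
    exact (this.tendsto _).eventually (gt_mem_nhds (by simpa using hc))
  refine tendsto_iff_norm_sub_tendsto_zero.2 (squeeze_zero' (by simp) ?_ hB0)
  filter_upwards [hsmall] with q hq
  have h1 := h.dist_proxPt_le hN q.1.2 x q.2
  have h2 : c * ‖proxPt C g ρ q.1.1 q.2 - proxPt C g ρ N x‖ ≤
      (2 * c - ρ / 2 * ‖N - q.1.1‖) * ‖proxPt C g ρ q.1.1 q.2 - proxPt C g ρ N x‖ :=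
    mul_le_mul_of_nonneg_right (by linarith) (norm_nonneg _)
  rw [hB]
  simp only
  rw [inv_mul_eq_div, le_div_iff₀' hc]
  exact h2.trans h1

/-- Testing each envelope value with the proximal point of the other centre sandwiches the
increment. The two bounds agree with the linear term up to `K ‖x' - x‖²`, because the proximal point
is Lipschitz in the centre. -/
lemma ProxRegular.hasGradientAt_env (h : ProxRegular C g κ ρ μ L) (hN : IsMetric μ L N)
    (x : Vec d) :
    HasGradientAt (env C g ρ N) (ρ • N (x - proxPt C g ρ N x)) x := by
  have hc := h.modulus_pos
  have hρ := h.ρ_pos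
  rw [hasGradientAt_iff_isLittleO]
  set c := proxModulus κ ρ L with hcdef
  set y := proxPt C g ρ N x with hy
  set K := ρ * ‖N‖ * (ρ / (2 * c) * ‖N‖) + ρ / 2 * ‖N‖ with hK
  have hdist : ∀ x', ‖proxPt C g ρ N x' - y‖ ≤ ρ / (2 * c) * ‖N‖ * ‖x' - x‖ := by
    intro x'
    have h1 := h.dist_proxPt_le hN hN x x'
    simp only [sub_self, norm_zero, mul_zero, sub_zero, zero_mul, zero_add] at h1
    rw [← map_sub] at h1
    have h2 := N.le_opNorm (x - x')
    rw [norm_sub_rev x x'] at h2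
    have h3 : 2 * c * ‖proxPt C g ρ N x' - y‖ ≤ ρ * (‖N‖ * ‖x' - x‖) :=
      h1.trans (mul_le_mul_of_nonneg_left h2 hρ.le)
    rw [show ρ / (2 * c) * ‖N‖ * ‖x' - x‖ = (ρ * (‖N‖ * ‖x' - x‖)) / (2 * c) by ring,
      le_div_iff₀' (by positivity)]
    exact h3
  have hquad : ∀ u x', ρ / 2 * quad N (u - x') - ρ / 2 * quad N (u - x) =
      ρ * inner ℝ (N (x - u)) (x' - x) + ρ / 2 * quad N (x' - x) := by
    intro u x'
    have a1 := hN.selfAdjoint.inner_apply_comm u x'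
    have a2 := hN.selfAdjoint.inner_apply_comm u x
    have a3 := hN.selfAdjoint.inner_apply_comm x' x
    rw [real_inner_comm (x' - x)]
    simp only [quad, map_sub, inner_sub_left, inner_sub_right]
    linear_combination (-ρ / 2) * a1 + ρ / 2 * a2 - ρ / 2 * a3
  refine Asymptotics.isLittleO_iff.2 fun ε hε => ?_
  have hK0 : 0 ≤ K := by positivity
  have hball : ∀ᶠ x' in 𝓝 x, K * ‖x' - x‖ < ε := by
    have : Continuous fun x' : Vec d => K * ‖x' - x‖ := by fun_prop
    exact (this.tendsto x).eventually (gt_mem_nhds (by simpa using hε))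
  filter_upwards [hball] with x' hx'
  set y' := proxPt C g ρ N x' with hy'
  have u1 := (h.proxPt_spec hN x').2 y (h.proxPt_spec hN x).1
  have u2 := (h.proxPt_spec hN x).2 y' (h.proxPt_spec hN x').1
  have e1 := hquad y x'
  have e2 := hquad y' x'
  have d1 : env C g ρ N x = g y + ρ / 2 * quad N (y - x) := rfl
  have d2 : env C g ρ N x' = g y' + ρ / 2 * quad N (y' - x') := rfl
  have q1 := hN.quad_nonneg h.L_pos (x' - x)
  have q2 := quad_le_opNorm N (x' - x)
  have e3 : ρ * inner ℝ (N (x - y')) (x' - x) =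
      ρ * inner ℝ (N (x - y)) (x' - x) - ρ * inner ℝ (N (y' - y)) (x' - x) := by
    rw [show x - y' = (x - y) - (y' - y) by abel, map_sub, inner_sub_left]
    ring
  have e4 : inner ℝ (N (y' - y)) (x' - x) ≤ ‖N‖ * (ρ / (2 * c) * ‖N‖) * ‖x' - x‖ ^ 2 := by
    calc inner ℝ (N (y' - y)) (x' - x) ≤ ‖N (y' - y)‖ * ‖x' - x‖ := real_inner_le_norm _ _
      _ ≤ (‖N‖ * (ρ / (2 * c) * ‖N‖ * ‖x' - x‖)) * ‖x' - x‖ := by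
          refine mul_le_mul_of_nonneg_right ((N.le_opNorm _).trans ?_) (norm_nonneg _)
          exact mul_le_mul_of_nonneg_left (hdist x') (norm_nonneg _)
      _ = _ := by ring
  have e4' := mul_le_mul_of_nonneg_left e4 hρ.le
  have q1' : 0 ≤ ρ / 2 * quad N (x' - x) := by positivity
  have q2' := mul_le_mul_of_nonneg_left q2 (by positivity : 0 ≤ ρ / 2)
  have hKs : K * ‖x' - x‖ ^ 2 = ρ * (‖N‖ * (ρ / (2 * c) * ‖N‖) * ‖x' - x‖ ^ 2) +
      ρ / 2 * (‖N‖ * ‖x' - x‖ ^ 2) := by rw [hK]; ring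
  have hp1 : 0 ≤ ρ * (‖N‖ * (ρ / (2 * c) * ‖N‖) * ‖x' - x‖ ^ 2) := by positivity
  have hp2 : 0 ≤ ρ / 2 * (‖N‖ * ‖x' - x‖ ^ 2) := by positivity
  have hfin : |env C g ρ N x' - env C g ρ N x - ρ * inner ℝ (N (x - y)) (x' - x)| ≤
      K * ‖x' - x‖ ^ 2 := by
    rw [abs_le]
    constructor <;> linarith
  rw [real_inner_smul_left, Real.norm_eq_abs]
  refine hfin.trans ?_
  rw [pow_two, ← mul_assoc]
  exact mul_le_mul_of_nonneg_right hx'.le (norm_nonneg _)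

lemma ProxRegular.moreauEnvelope_eq (h : ProxRegular C g κ ρ μ L) (hN : IsMetric μ L N)
    {p : Vec d → EReal} (hp : Represents p C g) (x : Vec d) :
    moreauEnvelope N ρ⁻¹ p x = (env C g ρ N x : EReal) := by
  have hobj : ∀ y, proxObjective N ρ⁻¹ p x y = p y + ((ρ / 2 * quad N (y - x) : ℝ) : EReal) := by
    intro y
    unfold proxObjective
    rw [normM_sq (hN.quad_nonneg h.L_pos)]
    congr 3
    field_simp
  have hr := hp.add_real (fun y => ρ / 2 * quad N (y - x))
  refine le_antisymm ?_ (le_iInf fun y => ?_)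
  · refine (iInf_le _ (proxPt C g ρ N x)).trans ?_
    rw [hobj]
    exact (hr.1 _ (h.proxPt_spec hN x).1).le
  · rw [hobj]
    by_cases hy : y ∈ C
    · refine le_trans ?_ (hr.1 y hy).ge
      exact_mod_cast (h.proxPt_spec hN x).2 y hy
    · exact le_top.trans (hr.2 y hy).ge

end Prox

end IspPPA

namespace IspPPA

/-! ### Accuracy criteria for the subproblem -/

section Criteria

variable {d : ℕ} {μ L : ℝ} {M : Vec d →L[ℝ] Vec d}

/-- Writing `v = M w`, this is Cauchy–Schwarz for the form of `M` at `u` and `w`. The lower bound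
makes `M` injective, hence invertible, so `ContinuousLinearMap.inverse` is not its default value
`0`. -/
lemma abs_inner_le_normM_inverse (hM : IsMetric μ L M) (hL : 0 < L) (v u : Vec d) :
    |inner ℝ v u| ≤ normM (ContinuousLinearMap.inverse M) v * normM M u := by
  have hinj : Function.Injective M := by
    refine (injective_iff_map_eq_zero M).2 fun w hw => ?_
    have := hM.lower w
    simp only [quad, hw, inner_zero_right, mul_zero] at this
    simpa using (sq_nonneg ‖w‖).antisymm this |>.symm
  set e := (LinearEquiv.ofInjectiveEndo (M : Vec d →ₗ[ℝ] Vec d) hinj).toContinuousLinearEquiv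
  have he : (e : Vec d →L[ℝ] Vec d) = M := by
    ext w; rfl
  have hinv : ContinuousLinearMap.inverse M = (e.symm : Vec d →L[ℝ] Vec d) := by
    rw [← he, ContinuousLinearMap.inverse_equiv]
  obtain ⟨w, rfl⟩ : ∃ w, M w = v := ⟨e.symm v, by rw [← he]; simp⟩
  have h1 : ContinuousLinearMap.inverse M (M w) = w := by
    rw [hinv, ← he]; simp
  rw [normM, normM, h1, ← Real.sqrt_mul']
  · refine Real.abs_le_sqrt ?_
    have h2 := inner_sq_le_quad_mul_quad hM.selfAdjoint (hM.quad_nonneg hL) u w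
    rw [real_inner_comm u, mul_comm, real_inner_comm w (M w)]
    exact h2
  · exact hM.quad_nonneg hL u

lemma regularSubdifferential_eventually {p : Vec d → EReal} {C : Set (Vec d)} {g : Vec d → ℝ}
    (hp : Represents p C g) {x v : Vec d} (hv : v ∈ regularSubdifferential p x) :
    x ∈ C ∧ ∀ ε > 0, ∀ᶠ y in 𝓝 x, y ∈ C →
      -(ε * ‖y - x‖) ≤ g y - g x - inner ℝ v (y - x) := by
  have hx : x ∈ C := by
    by_contra hx
    exact hv.1 (hp.2 x hx)
  refine ⟨hx, fun ε hε => ?_⟩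
  have h1 : ((-ε : ℝ) : EReal) < liminf (fun y =>
      (p y - p x - ((inner ℝ v (y - x) : ℝ) : EReal)) / ((‖y - x‖ : ℝ) : EReal)) (𝓝[≠] x) :=
    lt_of_lt_of_le (by exact_mod_cast neg_neg_of_pos hε) hv.2.2
  have h2 := eventually_lt_of_lt_liminf h1
  rw [eventually_nhdsWithin_iff] at h2
  filter_upwards [h2] with y hy hyC
  rcases eq_or_ne y x with rfl | hne
  · simp
  have h3 := hy hne
  rw [hp.1 y hyC, hp.1 x hx] at h3
  have h4 : -ε < (g y - g x - inner ℝ v (y - x)) / ‖y - x‖ := by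
    rw [← EReal.coe_sub, ← EReal.coe_sub, ← EReal.coe_div] at h3
    exact_mod_cast h3
  have hpos : 0 < ‖y - x‖ := norm_pos_iff.2 (sub_ne_zero.2 hne)
  rw [lt_div_iff₀ hpos] at h4
  linarith

/-- Each of the three accuracy criteria implies closeness to the exact minimizer. -/
lemma exists_min_of_criteria (hM : IsMetric μ L M) (hL : 0 < L) {p : Vec d → EReal}
    {C : Set (Vec d)} {g : Vec d → ℝ} (hp : Represents p C g) (hC : C.Nonempty)
    (hcl : ClosedOn C g) {τ α ε : ℝ}
    (hg : ModulusConvexOn C g (fun v => -(τ / 2 * ‖v‖ ^ 2))) (hτ : 0 ≤ τ)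
    (hα : 0 < α) (hτα : L ^ 2 * τ * α < 1) (hε : 0 ≤ ε) {x x' : Vec d}
    (h : CriterionA M α ε p x x' ∨ CriterionB (L ^ 2 * τ) M α ε p x x' ∨
      CriterionC (L ^ 2 * τ) M α ε p x x') :
    ∃ z ∈ C, quad M (x' - z) ≤ ε ^ 2 ∧ ∀ y ∈ C,
      g z + 1 / (2 * α) * quad M (z - x) +
        (1 - L ^ 2 * τ * α) / (2 * α) * quad M (y - z) ≤ g y + 1 / (2 * α) * quad M (y - x) := by
  have hq0 := hM.quad_nonneg hL
  -- Strong convexity constant of the subproblem in the `M`-norm: the weak convexity of `g` costs at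
  -- most `τ / 2 * L ^ 2` of the `1 / (2 * α)` supplied by the proximal term.
  set k := (1 - L ^ 2 * τ * α) / (2 * α) with hk
  have hk0 : 0 < k := div_pos (by linarith) (by positivity)
  have hobj : Represents (proxObjective M α p x) C
      (fun y => g y + 1 / (2 * α) * quad M (y - x)) := by
    have := hp.add_real (fun y => 1 / (2 * α) * normM M (y - x) ^ 2)
    refine ⟨fun y hy => (this.1 y hy).trans ?_, this.2⟩
    simp only [normM_sq hq0]
  set G : Vec d → ℝ := fun y => g y + 1 / (2 * α) * quad M (y - x) with hG
  have hconv := hg.add_quad M (1 / (2 * α)) x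
  have hmod : ∀ v, k * quad M v ≤ -(τ / 2 * ‖v‖ ^ 2) + 1 / (2 * α) * quad M v := by
    intro v
    have h1 := mul_le_mul_of_nonneg_left (hM.lower v) (by linarith : 0 ≤ τ / 2)
    have h2 : k * quad M v = 1 / (2 * α) * quad M v - τ / 2 * (L ^ 2 * quad M v) := by
      rw [hk]; field_simp
    linarith
  have hgrow : ∀ z ∈ C, (∀ y ∈ C, G z ≤ G y) → ∀ y ∈ C, G z + k * quad M (y - z) ≤ G y := by
    intro z hz hmin y hy
    have := hconv.growth hz hmin hy
    have := hmod (y - z)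
    simp only [hG] at *
    linarith
  have hex : ∃ z ∈ C, ∀ y ∈ C, G z ≤ G y := by
    have hclG : ClosedOn C G := hcl.of_continuous (continuous_const.mul
      ((continuous_quad M).comp (continuous_id.sub continuous_const)))
    refine hconv.exists_min hclG hC (c := k / L ^ 2) (by positivity) fun v => ?_
    refine le_trans ?_ (hmod v)
    calc k / L ^ 2 * ‖v‖ ^ 2 ≤ k / L ^ 2 * (L ^ 2 * quad M v) :=
          mul_le_mul_of_nonneg_left (hM.lower v) (by positivity)
      _ = _ := by field_simp
  rcases h with ⟨z, hz, hzε⟩ | h | h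
  · obtain ⟨w, hw⟩ := hC
    have hzC : z ∈ C := (hobj.mem_of_le ((hz w).trans (hobj.1 w hw).le)).1
    refine ⟨z, hzC, ?_, hgrow z hzC fun y hy => ?_⟩
    · rw [← normM_sq hq0]
      exact pow_le_pow_left₀ (Real.sqrt_nonneg _) hzε 2
    · have := hz y
      rw [hobj.1 z hzC, hobj.1 y hy] at this
      exact_mod_cast this
  · obtain ⟨z, hz, hmin⟩ := hex
    refine ⟨z, hz, ?_, hgrow z hz hmin⟩
    have h1 : proxObjective M α p x x' ≤ ((G z + k * ε ^ 2 : ℝ) : EReal) := by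
      refine h.trans ?_
      rw [EReal.coe_add]
      exact add_le_add ((iInf_le _ z).trans (hobj.1 z hz).le) le_rfl
    obtain ⟨hx', h2⟩ := hobj.mem_of_le h1
    -- For (B), quadratic growth bounds `k ‖x' - z‖²` by the objective gap, which is at most `k ε²`.
    have h3 := hgrow z hz hmin x' hx'
    have h4 : k * quad M (x' - z) ≤ k * ε ^ 2 := by linarith
    exact le_of_mul_le_mul_left h4 hk0
  · obtain ⟨z, hz, hmin⟩ := hex
    refine ⟨z, hz, ?_, hgrow z hz hmin⟩
    -- For (C), growth at `z` plus subgradient growth at `x'` gives `2k ‖x' - z‖² ≤ ‖v‖ ‖x' - z‖`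
    -- with the dual norm of `v`. The slack `δ` selects a subgradient without requiring the infimum
    -- to be attained.
    have hkey : ∀ δ > 0, normM M (x' - z) ≤ ε + δ := by
      intro δ hδ
      have h1 : (⨅ v ∈ regularSubdifferential (proxObjective M α p x) x',
          ((normM (ContinuousLinearMap.inverse M) (0 - v) : ℝ) : EReal)) <
          ((2 * k * (ε + δ) : ℝ) : EReal) := by
        refine lt_of_le_of_lt h ?_
        have h2 : (1 - L ^ 2 * τ * α) / α * ε < 2 * k * (ε + δ) := by
          have : (1 - L ^ 2 * τ * α) / α * ε = 2 * k * ε := by rw [hk]; field_simp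
          rw [this]
          have : 0 < k * δ := by positivity
          linarith
        exact_mod_cast h2
      simp only [iInf_lt_iff] at h1
      obtain ⟨v, hv, hvn⟩ := h1
      have hvn' : normM (ContinuousLinearMap.inverse M) (0 - v) < 2 * k * (ε + δ) := by
        exact_mod_cast hvn
      obtain ⟨hx', hev⟩ := regularSubdifferential_eventually hobj hv
      have h3 := hconv.subgradient_growth hx' hev hz
      have h4 := hmod (z - x')
      have h5 := hgrow z hz hmin x' hx'
      have h6 := abs_inner_le_normM_inverse hM hL (0 - v) (z - x')
      rw [zero_sub, inner_neg_left, abs_neg] at h6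
      have h7 := neg_abs_le (inner ℝ v (z - x'))
      have e1 : normM M (z - x') = normM M (x' - z) := by
        have := quad_sub_comm M z x'
        unfold quad at this
        rw [normM, normM, this]
      rw [quad_sub_comm M z x'] at h4 h3
      rw [e1] at h6
      have h8 : 2 * k * quad M (x' - z) ≤
          normM (ContinuousLinearMap.inverse M) (-v) * normM M (x' - z) := by
        simp only [hG] at *
        linarith
      rw [← normM_sq hq0, zero_sub] at *
      have hn0 : 0 ≤ normM M (x' - z) := Real.sqrt_nonneg _
      rcases hn0.eq_or_lt with h0 | h0
      · rw [← h0]; positivity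
      · have h9 : normM M (x' - z) * (2 * k * normM M (x' - z)) ≤
            normM M (x' - z) * (2 * k * (ε + δ)) := by
          have := mul_le_mul_of_nonneg_right hvn'.le h0.le
          linarith
        have h10 := le_of_mul_le_mul_left h9 h0
        exact le_of_mul_le_mul_left h10 (by positivity)
    rw [← normM_sq hq0]
    exact pow_le_pow_left₀ (Real.sqrt_nonneg _) (le_of_forall_pos_le_add hkey) 2

end Criteria

/-! ### Deterministic estimates for one step -/

section Step

variable {d : ℕ}

lemma quad_add_le {N : Vec d →L[ℝ] Vec d} (hN : IsSelfAdjoint N) (h0 : ∀ v, 0 ≤ quad N v)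
    {a : ℝ} (ha : 0 < a) (u v : Vec d) :
    quad N (u + v) ≤ (1 + a) * quad N u + (1 + a⁻¹) * quad N v := by
  have h1 := h0 (a • u - v)
  have h2 := hN.inner_apply_comm u v
  have e1 : quad N (a • u - v) = a ^ 2 * quad N u - 2 * a * inner ℝ v (N u) + quad N v := by
    simp only [quad, map_sub, map_smul, inner_sub_left, inner_sub_right, real_inner_smul_left,
      real_inner_smul_right, h2]
    ring
  have e2 : quad N (u + v) = quad N u + 2 * inner ℝ v (N u) + quad N v := by
    simp only [quad, map_add, inner_add_left, inner_add_right, h2]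
    ring
  rw [e1] at h1
  have h3 : 2 * inner ℝ v (N u) ≤ a * quad N u + a⁻¹ * quad N v := by
    have h4 := mul_le_mul_of_nonneg_left h1 (inv_nonneg.2 ha.le)
    have : a⁻¹ * (a ^ 2 * quad N u - 2 * a * inner ℝ v (N u) + quad N v) =
        a * quad N u - 2 * inner ℝ v (N u) + a⁻¹ * quad N v := by field_simp
    rw [this] at h4
    linarith
  rw [e2]
  linarith

/-- The descent inequality of one exact proximal step, measured at the proximal point `y` of
the true objective. -/
lemma prox_step_bound {M N : Vec d →L[ℝ] Vec d} {μ L : ℝ} (hM : IsMetric μ L M)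
    (hN : IsMetric μ L N) (hL : 0 < L) (hμ : 0 < μ) {F R fb : Vec d → ℝ} {x y z : Vec d}
    {α A g l l₁ ηb τ ρ : ℝ} (hα : 0 < α) (hαA : α ≤ A) (hg : α * g ≤ A) (hl : 0 ≤ l + l₁)
    (hηb : 0 ≤ ηb) (hρ : 0 ≤ ρ) (hA : A * (ρ * (L ^ 2 / μ ^ 2) + L ^ 2 * ηb) ≤ 1 / 2)
    (hz : fb z + R z + 1 / (2 * α) * quad M (z - x) + (1 - τ * α) / (2 * α) * quad M (y - z) ≤
      fb y + R y + 1 / (2 * α) * quad M (y - x))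
    (hfb : fb x - fb z ≤ l * g * ‖z - x‖)
    (hF : F z - F x ≤ l₁ * g * ‖z - x‖ + ηb / 2 * ‖z - x‖ ^ 2)
    (hy : F y + R y + ρ / 2 * quad N (y - x) ≤ F z + R z + ρ / 2 * quad N (z - x)) :
    (1 - τ * α) * quad M (y - z) ≤ quad M (y - x) - α * ρ * quad N (y - x) +
      2 * α * ((fb y - fb x) - (F y - F x)) + 2 * A ^ 2 * L ^ 2 * (l + l₁) ^ 2 := by
  have hA0 : 0 < A := hα.trans_le hαA
  have h1 := mul_le_mul_of_nonneg_left hz (by positivity : 0 ≤ 2 * α)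
  have e1 : 2 * α * (fb z + R z + 1 / (2 * α) * quad M (z - x) +
      (1 - τ * α) / (2 * α) * quad M (y - z)) =
      2 * α * (fb z + R z) + quad M (z - x) + (1 - τ * α) * quad M (y - z) := by
    field_simp
  have e2 : 2 * α * (fb y + R y + 1 / (2 * α) * quad M (y - x)) =
      2 * α * (fb y + R y) + quad M (y - x) := by field_simp
  rw [e1, e2] at h1
  -- The term `u ^ 2` gained from the proximal penalty at `z` pays for all errors at `z`. By the
  -- smallness of `A`, one half absorbs the quadratic errors from `ηb` and `ρ`; the other absorbs
  -- the Lipschitz error by Young's inequality, leaving `2 A² L² (l + l₁)²`.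
  set u := √(quad M (z - x)) with hu
  have hu2 : u ^ 2 = quad M (z - x) := Real.sq_sqrt (hM.quad_nonneg hL _)
  have hu0 : 0 ≤ u := Real.sqrt_nonneg _
  have hn : ‖z - x‖ ≤ L * u := by
    refine abs_le_of_sq_le_sq' ?_ (by positivity) |>.2
    rw [mul_pow, hu2]; exact hM.lower _
  have hK : quad N (z - x) ≤ L ^ 2 / μ ^ 2 * u ^ 2 := by
    have := (hN.upper (z - x)).trans (hM.lower (z - x))
    rw [hu2, div_mul_eq_mul_div, le_div_iff₀' (by positivity)]
    exact this
  have b1 : α * g * (l + l₁) * ‖z - x‖ ≤ A * (l + l₁) * (L * u) := by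
    have := mul_le_mul_of_nonneg_right hg hl
    have h5 : 0 ≤ A * (l + l₁) := by positivity
    calc α * g * (l + l₁) * ‖z - x‖ ≤ A * (l + l₁) * ‖z - x‖ :=
          mul_le_mul_of_nonneg_right this (norm_nonneg _)
      _ ≤ _ := mul_le_mul_of_nonneg_left hn h5
  have b2 : α * ηb * ‖z - x‖ ^ 2 ≤ A * (L ^ 2 * ηb) * u ^ 2 := by
    calc α * ηb * ‖z - x‖ ^ 2 ≤ A * ηb * (L * u) ^ 2 := by gcongr
      _ = _ := by ring
  have b3 : α * ρ * quad N (z - x) ≤ A * (ρ * (L ^ 2 / μ ^ 2)) * u ^ 2 := by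
    calc α * ρ * quad N (z - x) ≤ α * ρ * (L ^ 2 / μ ^ 2 * u ^ 2) :=
          mul_le_mul_of_nonneg_left hK (by positivity)
      _ ≤ A * ρ * (L ^ 2 / μ ^ 2 * u ^ 2) := by gcongr
      _ = _ := by ring
  have b4 : A * (ρ * (L ^ 2 / μ ^ 2) + L ^ 2 * ηb) * u ^ 2 ≤ 1 / 2 * u ^ 2 :=
    mul_le_mul_of_nonneg_right hA (sq_nonneg _)
  have b5 : 2 * (A * (l + l₁) * (L * u)) ≤
      1 / 2 * u ^ 2 + 2 * A ^ 2 * L ^ 2 * (l + l₁) ^ 2 := by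
    nlinarith [sq_nonneg (u - 2 * A * L * (l + l₁))]
  -- Here `hy` trades `R y - R z` for a difference of `F` and the proximal terms. Since `R x` never
  -- occurs, `x` may lie outside the domain of `r`.
  have c1 := mul_le_mul_of_nonneg_left hfb hα.le
  have c2 := mul_le_mul_of_nonneg_left hF hα.le
  have c3 := mul_le_mul_of_nonneg_left hy hα.le
  rw [← hu2] at h1
  linarith

/-- Passing from an exact to an inexact step costs a factor close to one. -/
lemma inexact_step_bound {α A γ τ Y B Q E : ℝ} (hα : 0 < α) (hαA : α ≤ A) (hA1 : A ≤ 1)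
    (hτ : 0 ≤ τ) (hτα : τ * A ≤ 1 / 2) (hY : 0 ≤ Y) (hYB : (1 - τ * α) * Y ≤ B)
    (hE : E ≤ (γ * α ^ 2) ^ 2)
    (hQ : Q ≤ (1 + A ^ 2) * Y + (1 + (A ^ 2)⁻¹) * E) :
    0 ≤ B ∧ Q ≤ (1 + τ * α + (1 + τ + 4 * τ ^ 2) * A ^ 2) * B + 2 * γ ^ 2 * A ^ 2 := by
  have hA0 : 0 < A := hα.trans_le hαA
  have hta : τ * α ≤ 1 / 2 := (mul_le_mul_of_nonneg_left hαA hτ).trans hτα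
  have hta0 : 0 ≤ τ * α := by positivity
  have hB : 0 ≤ B := (mul_nonneg (by linarith) hY).trans hYB
  refine ⟨hB, ?_⟩
  -- This is `1 / (1 - t) ≤ 1 + t + 2 t²` for `0 ≤ t ≤ 1/2`; the first-order term has to keep its
  -- exact coefficient `τ`.
  have h1 : Y ≤ (1 + τ * α + 2 * (τ * α) ^ 2) * B := by
    have h2 := mul_le_mul_of_nonneg_left hYB (by positivity : 0 ≤ 1 + τ * α + 2 * (τ * α) ^ 2)
    have h3 : Y ≤ (1 + τ * α + 2 * (τ * α) ^ 2) * ((1 - τ * α) * Y) := by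
      have h4 : 0 ≤ (τ * α) ^ 2 * (1 - 2 * (τ * α)) * Y :=
        mul_nonneg (mul_nonneg (sq_nonneg _) (by linarith)) hY
      linarith
    linarith
  have h5 : (1 + A ^ 2) * (1 + τ * α + 2 * (τ * α) ^ 2) ≤
      1 + τ * α + (1 + τ + 4 * τ ^ 2) * A ^ 2 := by
    have hα1 : α ≤ 1 := hαA.trans hA1
    have i1 : (τ * α) ^ 2 ≤ τ ^ 2 * A ^ 2 := by
      rw [mul_pow]; gcongr
    have i2 : A ^ 2 * (τ * α) ≤ A ^ 2 * τ := by
      have : τ * α ≤ τ * 1 := mul_le_mul_of_nonneg_left hα1 hτ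
      exact mul_le_mul_of_nonneg_left (by linarith) (sq_nonneg _)
    have i3 : A ^ 2 * (τ * α) ^ 2 ≤ τ ^ 2 * A ^ 2 := by
      have : A ^ 2 ≤ 1 := pow_le_one₀ hA0.le hA1
      calc A ^ 2 * (τ * α) ^ 2 ≤ 1 * (τ ^ 2 * A ^ 2) := by gcongr
        _ = _ := one_mul _
    linarith
  -- The accuracy `γ α²` makes `E` of order `A ^ 4`, which compensates the Young weight `(A ^ 2)⁻¹`
  -- and leaves a summable error.
  have h6 : (1 + (A ^ 2)⁻¹) * E ≤ 2 * γ ^ 2 * A ^ 2 := by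
    have i1 : (γ * α ^ 2) ^ 2 ≤ γ ^ 2 * A ^ 4 := by
      calc (γ * α ^ 2) ^ 2 = γ ^ 2 * α ^ 4 := by ring
        _ ≤ _ := by gcongr
    have i2 : A ^ 4 ≤ A ^ 2 := pow_le_pow_of_le_one hA0.le hA1 (by norm_num)
    calc (1 + (A ^ 2)⁻¹) * E ≤ (1 + (A ^ 2)⁻¹) * (γ ^ 2 * A ^ 4) := by
          gcongr; exact hE.trans i1
      _ = γ ^ 2 * A ^ 4 + γ ^ 2 * A ^ 2 := by field_simp
      _ ≤ _ := by nlinarith [sq_nonneg γ]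
  calc Q ≤ (1 + A ^ 2) * Y + (1 + (A ^ 2)⁻¹) * E := hQ
    _ ≤ (1 + A ^ 2) * ((1 + τ * α + 2 * (τ * α) ^ 2) * B) + 2 * γ ^ 2 * A ^ 2 := by gcongr
    _ = ((1 + A ^ 2) * (1 + τ * α + 2 * (τ * α) ^ 2)) * B + 2 * γ ^ 2 * A ^ 2 := by ring
    _ ≤ _ := by gcongr

end Step

end IspPPA

namespace IspPPA

/-! ### The Robbins–Siegmund theorem -/

section RobbinsSiegmund

variable {Ω : Type*} [mΩ : MeasurableSpace Ω]

/-- The Robbins–Siegmund theorem with deterministic perturbations, in integrated form. -/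
theorem robbins_siegmund {Prob : Measure Ω} [IsFiniteMeasure Prob] (ℱ : Filtration ℕ mΩ)
    {V Z : ℕ → Ω → ℝ} {a b : ℕ → ℝ} (hV : ∀ n, Measurable[ℱ n] (V n))
    (hZ : ∀ n, Measurable[ℱ n] (Z n)) (hV0 : ∀ n ω, 0 ≤ V n ω) (hZ0 : ∀ n ω, 0 ≤ Z n ω)
    (ha0 : ∀ n, 0 ≤ a n) (hb0 : ∀ n, 0 ≤ b n) (ha : Summable a) (hb : Summable b)
    (hint0 : Integrable (V 0) Prob)
    (hint : ∀ n, Integrable (V n) Prob → Integrable (V (n + 1)) Prob ∧ Integrable (Z n) Prob)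
    (hstep : ∀ n, Integrable (V n) Prob → ∀ s, MeasurableSet[ℱ n] s →
      ∫ ω in s, V (n + 1) ω ∂Prob ≤ ∫ ω in s, ((1 + a n) * V n ω - Z n ω + b n) ∂Prob) :
    ∀ᵐ ω ∂Prob, BddAbove (Set.range fun n => V n ω) ∧ Summable fun n => Z n ω := by
  have hVint : ∀ n, Integrable (V n) Prob := fun n => by
    induction n with
    | zero => exact hint0
    | succ n ih => exact (hint n ih).1
  have hZint : ∀ n, Integrable (Z n) Prob := fun n => (hint n (hVint n)).2
  -- Discount factors that cancel the growth `1 + a n`. Summability of `a` keeps them above a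
  -- positive constant, so bounds on discounted quantities transfer back.
  set p : ℕ → ℝ := fun n => (∏ j ∈ Finset.range n, (1 + a j))⁻¹ with hp
  have hprod1 : ∀ n, 1 ≤ ∏ j ∈ Finset.range n, (1 + a j) := fun n =>
    Finset.prod_induction _ (1 ≤ ·) (fun _ _ => one_le_mul_of_one_le_of_one_le) le_rfl
      fun j _ => by linarith [ha0 j]
  have hp0 : ∀ n, 0 < p n := fun n => inv_pos.2 (zero_lt_one.trans_le (hprod1 n))
  have hp1 : ∀ n, p n ≤ 1 := fun n => inv_le_one_of_one_le₀ (hprod1 n)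
  have hps : ∀ n, p (n + 1) * (1 + a n) = p n := fun n => by
    have : 0 < 1 + a n := by linarith [ha0 n]
    simp only [hp, Finset.prod_range_succ, mul_inv]
    field_simp
  have hprodle : ∀ n, ∏ j ∈ Finset.range n, (1 + a j) ≤ Real.exp (∑' j, a j) := fun n => by
    calc ∏ j ∈ Finset.range n, (1 + a j) ≤ ∏ j ∈ Finset.range n, Real.exp (a j) := by
          refine Finset.prod_le_prod (fun j _ => by linarith [ha0 j]) fun j _ => ?_
          linarith [Real.add_one_le_exp (a j)]
      _ = Real.exp (∑ j ∈ Finset.range n, a j) := (Real.exp_sum _ _).symm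
      _ ≤ _ := Real.exp_le_exp.2 (ha.sum_le_tsum _ fun j _ => ha0 j)
  set κ := (Real.exp (∑' j, a j))⁻¹ with hκ
  have hκ0 : 0 < κ := inv_pos.2 (Real.exp_pos _)
  have hpκ : ∀ n, κ ≤ p n := fun n =>
    inv_anti₀ (zero_lt_one.trans_le (hprod1 n)) (hprodle n)
  -- Compensated process: discounted value, plus discounted past decreases, minus discounted past
  -- noise. It is a supermartingale bounded below by `-∑ b`.
  set X : ℕ → Ω → ℝ := fun n ω => p n * V n ω +
    ∑ j ∈ Finset.range n, p (j + 1) * (Z j ω - b j) with hX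
  have hXint : ∀ n, Integrable (X n) Prob := fun n =>
    ((hVint n).const_mul _).add (integrable_finsetSum _ fun j _ =>
      ((hZint j).sub (integrable_const _)).const_mul _)
  have hXmeas : ∀ n, Measurable[ℱ n] (X n) := fun n => by
    refine ((hV n).const_mul _).add (Finset.measurable_fun_sum _ fun j hj => ?_)
    have := (hZ j).mono (ℱ.mono (Finset.mem_range.1 hj).le) le_rfl
    exact (this.sub_const _).const_mul _
  have hsuper : Supermartingale X ℱ Prob := by
    refine supermartingale_of_setIntegral_succ_le (fun n => (hXmeas n).stronglyMeasurable) hXint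
      fun n s hs => ?_
    have h1 := mul_le_mul_of_nonneg_left (hstep n (hVint n) s hs) (hp0 (n + 1)).le
    rw [← integral_const_mul, ← integral_const_mul] at h1
    have e1 : ∫ ω in s, X (n + 1) ω ∂Prob = ∫ ω in s, p (n + 1) * V (n + 1) ω ∂Prob +
        ∫ ω in s, ∑ j ∈ Finset.range (n + 1), p (j + 1) * (Z j ω - b j) ∂Prob :=
      integral_add ((hVint _).const_mul _).integrableOn
        (integrable_finsetSum _ fun j _ =>
          ((hZint j).sub (integrable_const _)).const_mul _).integrableOn
    rw [e1]
    refine (add_le_add_left h1 _).trans_eq ?_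
    rw [← integral_add]
    · refine integral_congr_ae (Eventually.of_forall fun ω => ?_)
      simp only [hX, Finset.sum_range_succ, ← hps n]
      ring
    · exact (((((hVint n).const_mul _).sub (hZint n)).add (integrable_const _)).const_mul
        _).integrableOn
    · exact (integrable_finsetSum _ fun j _ =>
          ((hZint j).sub (integrable_const _)).const_mul _).integrableOn
  set β := ∑' j, b j with hβ
  have hsumb : ∀ n, ∑ j ∈ Finset.range n, p (j + 1) * b j ≤ β := fun n =>
    (Finset.sum_le_sum fun j _ => mul_le_of_le_one_left (hb0 j) (hp1 _)).trans
      (hb.sum_le_tsum _ fun j _ => hb0 j)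
  have hXeq : ∀ n ω, X n ω = p n * V n ω + ∑ j ∈ Finset.range n, p (j + 1) * Z j ω -
      ∑ j ∈ Finset.range n, p (j + 1) * b j := fun n ω => by
    simp only [hX, mul_sub, Finset.sum_sub_distrib]; ring
  have hZs0 : ∀ n ω, 0 ≤ ∑ j ∈ Finset.range n, p (j + 1) * Z j ω := fun n ω =>
    Finset.sum_nonneg fun j _ => mul_nonneg (hp0 _).le (hZ0 j ω)
  have hpV0 : ∀ n ω, 0 ≤ p n * V n ω := fun n ω => mul_nonneg (hp0 n).le (hV0 n ω)
  have hXlow : ∀ n ω, -β ≤ X n ω := fun n ω => by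
    rw [hXeq]; linarith [hZs0 n ω, hpV0 n ω, hsumb n]
  have hβ0 : 0 ≤ β := tsum_nonneg hb0
  have hEX : ∀ n, ∫ ω, X n ω ∂Prob ≤ ∫ ω, X 0 ω ∂Prob := fun n => by
    simpa using hsuper.setIntegral_le (Nat.zero_le n) MeasurableSet.univ
  set R : ℝ := ∫ ω, X 0 ω ∂Prob + 2 * β * Prob.real Set.univ with hR
  have hbdd : ∀ n, eLpNorm ((-X) n) 1 Prob ≤ (R.toNNReal : ENNReal) := fun n => by
    rw [Pi.neg_apply, eLpNorm_neg, eLpNorm_one_eq_lintegral_enorm,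
      ← ofReal_integral_norm_eq_lintegral_enorm (hXint n)]
    refine ENNReal.ofReal_le_ofReal ?_
    calc ∫ ω, ‖X n ω‖ ∂Prob ≤ ∫ ω, (X n ω + 2 * β) ∂Prob := by
          refine integral_mono (hXint n).norm ((hXint n).add (integrable_const _)) fun ω => ?_
          rw [Real.norm_eq_abs, abs_le]
          constructor <;> linarith [hXlow n ω]
      _ = ∫ ω, X n ω ∂Prob + 2 * β * Prob.real Set.univ := by
          rw [integral_add (hXint n) (integrable_const _), integral_const, smul_eq_mul]
          ring
      _ ≤ R := by linarith [hEX n]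
  -- Almost sure convergence of `X` bounds it along the path; since `p n * V n` and the partial sums
  -- of `Z` are nonnegative, each of them is bounded separately.
  filter_upwards [hsuper.neg.exists_ae_tendsto_of_bdd hbdd] with ω ⟨c, hc⟩
  have hcX : Tendsto (fun n => X n ω) atTop (𝓝 (-c)) := by
    simpa using hc.neg
  obtain ⟨B, hB⟩ := hcX.bddAbove_range
  have hBn : ∀ n, X n ω ≤ B := fun n => hB ⟨n, rfl⟩
  constructor
  · refine ⟨(B + β) / κ, ?_⟩
    rintro _ ⟨n, rfl⟩
    simp only
    rw [le_div_iff₀' hκ0]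
    have h1 := hBn n
    rw [hXeq] at h1
    have h2 := mul_le_mul_of_nonneg_right (hpκ n) (hV0 n ω)
    linarith [hZs0 n ω, hsumb n]
  · refine summable_of_sum_range_le (c := (B + β) / κ) (fun n => hZ0 n ω) fun n => ?_
    rw [le_div_iff₀' hκ0, Finset.mul_sum]
    have h1 := hBn n
    rw [hXeq] at h1
    have h2 : ∑ j ∈ Finset.range n, κ * Z j ω ≤ ∑ j ∈ Finset.range n, p (j + 1) * Z j ω :=
      Finset.sum_le_sum fun j _ => mul_le_mul_of_nonneg_right (hpκ _) (hZ0 j ω)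
    linarith [hpV0 n ω, hsumb n]

end RobbinsSiegmund

/-! ### Freezing the past in integrals over an independent sample -/

section Freezing

variable {Ω E 𝒮 : Type*} {mΩ : MeasurableSpace Ω} {mE : MeasurableSpace E} [MeasurableSpace 𝒮]

/-- Integrals of functions of two independent variables can be computed iteratively. -/
lemma _root_.ProbabilityTheory.IndepFun.integral_comp_eq {Prob : Measure Ω}
    [IsProbabilityMeasure Prob] {P : Measure 𝒮} [IsProbabilityMeasure P] {X : Ω → E} {S : Ω → 𝒮}
    (hX : Measurable X) (hS : Measurable S) (hlaw : Prob.map S = P) (hind : IndepFun X S Prob)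
    {ψ : E → 𝒮 → ℝ} (hψ : Measurable (Function.uncurry ψ)) {a : E → ℝ} {l : 𝒮 → ℝ}
    (ha : Measurable a) (haint : Integrable (fun ω => a (X ω)) Prob)
    (hl : Integrable l P) (hb : ∀ᵐ s ∂P, ∀ e, |ψ e s| ≤ a e * l s) :
    Integrable (fun ω => ψ (X ω) (S ω)) Prob ∧ Integrable (fun ω => ∫ s, ψ (X ω) s ∂P) Prob ∧
      ∫ ω, ψ (X ω) (S ω) ∂Prob = ∫ ω, ∫ s, ψ (X ω) s ∂P ∂Prob := by
  have hmap := (indepFun_iff_map_prod_eq_prod_map_map hX.aemeasurable hS.aemeasurable).1 hind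
  rw [hlaw] at hmap
  have := Measure.isProbabilityMeasure_map (μ := Prob) hX.aemeasurable
  have hψint : Integrable (Function.uncurry ψ) ((Prob.map X).prod P) := by
    have h0 : Integrable a (Prob.map X) :=
      (integrable_map_measure ha.aestronglyMeasurable hX.aemeasurable).2 haint
    refine (h0.mul_prod hl).mono' hψ.aestronglyMeasurable ?_
    have h2 : ∀ᵐ q ∂((Prob.map X).prod P), ∀ e, |ψ e q.2| ≤ a e * l q.2 :=
      Measure.quasiMeasurePreserving_snd.ae hb
    filter_upwards [h2] with q hq
    exact hq q.1
  have hpair : Measurable fun ω => (X ω, S ω) := hX.prodMk hS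
  have hψint' := hψint
  rw [← hmap] at hψint'
  have hin : StronglyMeasurable fun e => ∫ s, ψ e s ∂P :=
    hψ.stronglyMeasurable.integral_prod_right
  refine ⟨(integrable_map_measure hψ.aestronglyMeasurable hpair.aemeasurable).1 hψint', ?_, ?_⟩
  · exact (integrable_map_measure hin.aestronglyMeasurable hX.aemeasurable).1
      hψint.integral_prod_left
  · have e1 : ∫ ω, ψ (X ω) (S ω) ∂Prob =
        ∫ q, Function.uncurry ψ q ∂(Prob.map fun ω => (X ω, S ω)) :=
      (integral_map hpair.aemeasurable hψ.aestronglyMeasurable).symm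
    rw [e1, hmap, integral_prod _ hψint]
    exact integral_map hX.aemeasurable hin.aestronglyMeasurable

/-- Integrals of functions of an `m`-measurable argument and a sample independent of `m`. -/
lemma integral_comp_indep {Ω 𝒮 : Type*} {m mΩ : MeasurableSpace Ω} [MeasurableSpace 𝒮]
    {Prob : Measure Ω} [IsProbabilityMeasure Prob] {P : Measure 𝒮}
    [IsProbabilityMeasure P] (hm : m ≤ mΩ) {S : Ω → 𝒮}
    (hS : Measurable S) (hlaw : Prob.map S = P)
    (hind : Indep m (MeasurableSpace.comap S inferInstance) Prob) {ψ : Ω → 𝒮 → ℝ}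
    (hψ : @Measurable (Ω × 𝒮) ℝ (@Prod.instMeasurableSpace Ω 𝒮 m _) _ (Function.uncurry ψ))
    {a : Ω → ℝ} {l : 𝒮 → ℝ} (ha : Measurable[m] a) (haint : Integrable a Prob)
    (hl : Integrable l P) (hb : ∀ᵐ s ∂P, ∀ ω, |ψ ω s| ≤ a ω * l s) :
    Integrable (fun ω => ψ ω (S ω)) Prob ∧ Integrable (fun ω => ∫ s, ψ ω s ∂P) Prob ∧
      ∫ ω, ψ ω (S ω) ∂Prob = ∫ ω, ∫ s, ψ ω s ∂P ∂Prob := by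
  -- The whole past is encoded by the identity, viewed as a random variable with values in `Ω` with
  -- the σ-algebra `m`.
  have h1 : @IndepFun Ω Ω 𝒮 mΩ m _ id S Prob :=
    (@IndepFun_iff_Indep Ω Ω 𝒮 mΩ m _ id S Prob).2 (by rwa [MeasurableSpace.comap_id])
  exact @ProbabilityTheory.IndepFun.integral_comp_eq Ω Ω 𝒮 mΩ m _ Prob _ P _ id S
    (measurable_id'' hm) hS hlaw h1 ψ hψ a l ha haint hl hb

end Freezing

end IspPPA

namespace IspPPA

/-! ### Conditional metric comparison at random vectors -/

section CondQuad

variable {d : ℕ}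

/-- The uniform operator bound makes a random metric Bochner integrable, so that it has an
operator-valued conditional expectation. -/
lemma IsMetric.opNorm_le {μ L : ℝ} {N : Vec d →L[ℝ] Vec d} (h : IsMetric μ L N) (hμ : 0 < μ)
    (hL : 0 < L) : ‖N‖ ≤ (μ ^ 2)⁻¹ := by
  refine N.opNorm_le_bound (by positivity) fun v => ?_
  have h1 := h.norm_apply_sq_le hμ hL v
  have h2 := h.upper v
  have h3 : (μ ^ 2 * ‖N v‖) ^ 2 ≤ ‖v‖ ^ 2 := by
    have := mul_le_mul_of_nonneg_left h1 (by positivity : 0 ≤ μ ^ 2)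
    linarith [show (μ ^ 2 * ‖N v‖) ^ 2 = μ ^ 2 * (μ ^ 2 * ‖N v‖ ^ 2) by ring]
  have h4 := abs_le_of_sq_le_sq' h3 (norm_nonneg _) |>.2
  rw [inv_mul_eq_div, le_div_iff₀' (by positivity)]
  exact h4

/-- Evaluation of the quadratic form at `v`, as a functional of the linear map. -/
noncomputable def quadEval (v : Vec d) : (Vec d →L[ℝ] Vec d) →L[ℝ] ℝ :=
  (innerSL ℝ v).comp (ContinuousLinearMap.apply ℝ (Vec d) v)

lemma continuous_quadEval : Continuous (quadEval (d := d)) := by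
  unfold quadEval
  exact (innerSL ℝ).continuous.clm_comp (ContinuousLinearMap.apply ℝ (Vec d)).continuous

lemma continuous_quad_uncurry :
    Continuous fun q : (Vec d →L[ℝ] Vec d) × Vec d => quad q.1 q.2 := by
  unfold quad
  exact continuous_snd.inner (continuous_fst.clm_apply continuous_snd)

variable {Ω : Type*} {m mΩ : MeasurableSpace Ω} {Prob : Measure Ω} [IsProbabilityMeasure Prob]

/-- A conditional bound on the quadratic forms at fixed vectors extends to random vectors that
are known at the time of conditioning. -/
lemma integral_quad_le_of_condExp_le (hm : m ≤ mΩ) {M N : Ω → Vec d →L[ℝ] Vec d} {μ L c : ℝ}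
    (hμ : 0 < μ) (hL : 0 < L) (hM : ∀ ω, IsMetric μ L (M ω)) (hN : ∀ ω, IsMetric μ L (N ω))
    (hMm : Measurable M) (hNm : Measurable[m] N)
    (hle : ∀ z, z ≠ 0 →
      ∀ᵐ ω ∂Prob, (Prob[fun ω' => quad (M ω') z / quad (N ω') z | m]) ω ≤ c)
    {v : Ω → Vec d} {w : Ω → ℝ} (hv : Measurable[m] v) (hw : Measurable[m] w)
    (hw0 : ∀ ω, 0 ≤ w ω) (hint : Integrable (fun ω => w ω * ‖v ω‖ ^ 2) Prob) :
    Integrable (fun ω => w ω * quad (M ω) (v ω)) Prob ∧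
      ∫ ω, w ω * quad (M ω) (v ω) ∂Prob ≤ ∫ ω, c * (w ω * quad (N ω) (v ω)) ∂Prob := by
  have hv' : Measurable v := hv.mono hm le_rfl
  have hw' : Measurable w := hw.mono hm le_rfl
  have hNm' : Measurable N := hNm.mono hm le_rfl
  have hquadm : ∀ {A : Ω → Vec d →L[ℝ] Vec d}, Measurable A → (∀ ω, IsMetric μ L (A ω)) →
      Integrable (fun ω => w ω * quad (A ω) (v ω)) Prob := by
    intro A hA hAm
    refine (hint.const_mul (μ ^ 2)⁻¹).mono' ?_ (Eventually.of_forall fun ω => ?_)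
    · exact (hw'.mul (continuous_quad_uncurry.measurable.comp (hA.prodMk hv'))).aestronglyMeasurable
    · have h0 := (hAm ω).quad_nonneg hL (v ω)
      rw [Real.norm_of_nonneg (mul_nonneg (hw0 ω) h0)]
      have h1 : quad (A ω) (v ω) ≤ (μ ^ 2)⁻¹ * ‖v ω‖ ^ 2 := by
        rw [inv_mul_eq_div, le_div_iff₀' (by positivity)]
        exact (hAm ω).upper _
      calc w ω * quad (A ω) (v ω) ≤ w ω * ((μ ^ 2)⁻¹ * ‖v ω‖ ^ 2) :=
            mul_le_mul_of_nonneg_left h1 (hw0 ω)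
        _ = _ := by ring
  have hMint : Integrable M Prob :=
    (integrable_const ((μ ^ 2)⁻¹ : ℝ)).mono' hMm.aestronglyMeasurable
      (Eventually.of_forall fun ω => (hM ω).opNorm_le hμ hL)
  refine ⟨hquadm hMm hM, ?_⟩
  -- The hypothesis has an exceptional null set for each `z`. Conditioning the operator itself gives
  -- a single random quadratic form, continuous in `z`, on which the bounds can be combined.
  set Mb := Prob[M | m] with hMb
  have hfix : ∀ z : Vec d, ∀ᵐ ω ∂Prob, quad (Mb ω) z ≤ c * quad (N ω) z := by
    intro z
    rcases eq_or_ne z 0 with rfl | hz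
    · exact Eventually.of_forall fun ω => by simp [quad]
    have hNz : ∀ ω, 0 < quad (N ω) z := fun ω => by
      have h1 := (hN ω).lower z
      have h2 : 0 < ‖z‖ ^ 2 := by positivity
      exact pos_of_mul_pos_right (h2.trans_le h1) (by positivity)
    have hMz : Integrable (fun ω => quad (M ω) z) Prob := (quadEval z).integrable_comp hMint
    have e1 : (fun ω => quad (Mb ω) z) =ᵐ[Prob] Prob[fun ω => quad (M ω) z | m] :=
      (quadEval z).comp_condExp_comm hMint
    have e2 : (fun ω => quad (M ω) z) =
        (fun ω => quad (N ω) z) * fun ω => quad (M ω) z / quad (N ω) z := by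
      ext ω
      simp only [Pi.mul_apply]
      field_simp [(hNz ω).ne']
    have hNzm : Measurable[m] fun ω => quad (N ω) z :=
      (quadEval z).continuous.measurable.comp hNm
    have hMzm : Measurable fun ω => quad (M ω) z :=
      (quadEval z).continuous.measurable.comp hMm
    have hratio : Integrable (fun ω => quad (M ω) z / quad (N ω) z) Prob := by
      refine (integrable_const ((μ ^ 2)⁻¹ * L ^ 2 : ℝ)).mono'
        (hMzm.div (hNzm.mono hm le_rfl)).aestronglyMeasurable (Eventually.of_forall fun ω => ?_)
      rw [Real.norm_of_nonneg (div_nonneg ((hM ω).quad_nonneg hL z) (hNz ω).le),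
        div_le_iff₀ (hNz ω), mul_assoc, inv_mul_eq_div, le_div_iff₀' (by positivity)]
      exact ((hM ω).upper z).trans ((hN ω).lower z)
    have e3 : Prob[fun ω => quad (M ω) z | m] =ᵐ[Prob]
        (fun ω => quad (N ω) z) * Prob[fun ω => quad (M ω) z / quad (N ω) z | m] := by
      conv_lhs => rw [e2]
      exact condExp_mul_of_stronglyMeasurable_left hNzm.stronglyMeasurable (e2 ▸ hMz) hratio
    filter_upwards [e1, e3, hle z hz] with ω h1 h3 h4
    rw [h1, h3, Pi.mul_apply, mul_comm c]
    exact mul_le_mul_of_nonneg_left h4 (hNz ω).le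
  -- A countable dense set of vectors has one common null set, and closedness of the inequality
  -- extends it to all `z`.
  have hall : ∀ᵐ ω ∂Prob, ∀ z : Vec d, quad (Mb ω) z ≤ c * quad (N ω) z := by
    have h1 : ∀ᵐ ω ∂Prob, ∀ n, quad (Mb ω) (TopologicalSpace.denseSeq (Vec d) n) ≤
        c * quad (N ω) (TopologicalSpace.denseSeq (Vec d) n) := ae_all_iff.2 fun n => hfix _
    filter_upwards [h1] with ω hω z
    have hcl : IsClosed {z | quad (Mb ω) z ≤ c * quad (N ω) z} :=
      isClosed_le (continuous_quad _) ((continuous_quad _).const_mul c)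
    exact hcl.closure_subset_iff.2 (Set.range_subset_iff.2 hω)
      ((TopologicalSpace.denseRange_denseSeq (Vec d)).closure_range ▸ Set.mem_univ z)
  -- The form is quadratic in `v` but linear in `M`, so `T` is an `m`-measurable linear functional
  -- and can be pulled out of the conditional expectation.
  set T : Ω → (Vec d →L[ℝ] Vec d) →L[ℝ] ℝ := fun ω => w ω • quadEval (v ω) with hT
  have hTm : StronglyMeasurable[m] T :=
    hw.stronglyMeasurable.smul (continuous_quadEval.comp_stronglyMeasurable hv.stronglyMeasurable)
  have hpull : Prob[fun ω => w ω * quad (M ω) (v ω) | m] =ᵐ[Prob]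
      fun ω => w ω * quad (Mb ω) (v ω) := by
    have := condExp_bilin_of_aestronglyMeasurable_left (μ := Prob) (m := m)
      (B := ContinuousLinearMap.id ℝ ((Vec d →L[ℝ] Vec d) →L[ℝ] ℝ)) (f := T) (g := M)
      hTm.aestronglyMeasurable (hquadm hMm hM) hMint
    exact this
  rw [← integral_condExp hm]
  refine integral_mono_ae integrable_condExp ((hquadm hNm' hN).const_mul c) ?_
  filter_upwards [hpull, hall] with ω h1 h2
  rw [h1]
  have := mul_le_mul_of_nonneg_left (h2 (v ω)) (hw0 ω)
  linarith

end CondQuad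

end IspPPA

namespace IspPPA

/-! ### Properties of individual samples and minibatches -/

section Sample

variable {d : ℕ} {𝒮 : Type*}

/-- The properties of the model functions that hold for almost every sample. -/
structure GoodSample (fm : Vec d → Vec d → 𝒮 → ℝ) (V C : Set (Vec d)) (R : Vec d → ℝ)
    (ηb τb : ℝ) (G : NNReal → NNReal) (Lf : 𝒮 → NNReal) (s : 𝒮) : Prop where
  approx : ∀ x ∈ V, ∀ y ∈ V, |fm x y s - fm y y s| ≤ ηb / 2 * ‖y - x‖ ^ 2
  lipschitz : ∀ x ∈ V, ∀ y ∈ V, |fm x x s - fm x y s| ≤ Lf s * G ‖x‖₊ * ‖x - y‖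
  convex : ∀ x ∈ V, ModulusConvexOn C (fun y => fm x y s + R y) (fun v => -(τb / 2 * ‖v‖ ^ 2))
  closedOn : ∀ x ∈ V, ClosedOn C (fun y => fm x y s + R y)

variable {fm : Vec d → Vec d → 𝒮 → ℝ} {V C : Set (Vec d)} {R : Vec d → ℝ} {ηb τb : ℝ}
  {G : NNReal → NNReal} {Lf : 𝒮 → NNReal}

variable {m : ℕ}

/-- The minibatch average of the model functions. -/
noncomputable def batchModel (fm : Vec d → Vec d → 𝒮 → ℝ) (x : Vec d) (s : Fin m → 𝒮)
    (y : Vec d) : ℝ :=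
  (1 / (m : ℝ)) * ∑ i, fm x y (s i)

lemma batchModel_convex_closedOn (hm : 0 < m) {s : Fin m → 𝒮}
    (hs : ∀ i, GoodSample fm V C R ηb τb G Lf (s i)) {x : Vec d} (hx : x ∈ V) :
    ModulusConvexOn C (fun y => batchModel fm x s y + R y) (fun v => -(τb / 2 * ‖v‖ ^ 2)) ∧
      ClosedOn C (fun y => batchModel fm x s y + R y) := by
  have hm0 : (0 : ℝ) < m := by exact_mod_cast hm
  have : Nonempty (Fin m) := ⟨⟨0, hm⟩⟩
  have e1 : (fun y => batchModel fm x s y + R y) =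
      fun y => (1 / (m : ℝ)) * ∑ i, (fm x y (s i) + R y) := by
    ext y
    simp only [batchModel, Finset.sum_add_distrib, Finset.sum_const, Finset.card_univ,
      Fintype.card_fin, nsmul_eq_mul]
    field_simp
  have e2 : (fun v : Vec d => -(τb / 2 * ‖v‖ ^ 2)) =
      fun v => (1 / (m : ℝ)) * ∑ _i : Fin m, -(τb / 2 * ‖v‖ ^ 2) := by
    ext v
    simp only [Finset.sum_const, Finset.card_univ, Fintype.card_fin, nsmul_eq_mul]
    field_simp
  rw [e1, e2]
  exact ⟨(ModulusConvexOn.sum ((hs ⟨0, hm⟩).convex x hx).1 _ fun i _ =>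
      (hs i).convex x hx).const_mul (by positivity),
    (ClosedOn.sum Finset.univ_nonempty fun i _ => (hs i).closedOn x hx).const_mul
      (by positivity)⟩

lemma batchModel_lipschitz {s : Fin m → 𝒮}
    (hs : ∀ i, GoodSample fm V C R ηb τb G Lf (s i)) {x y : Vec d} (hx : x ∈ V) (hy : y ∈ V) :
    batchModel fm x s x - batchModel fm x s y ≤
      ((1 / (m : ℝ)) * ∑ i, (Lf (s i) : ℝ)) * G ‖x‖₊ * ‖y - x‖ := by
  unfold batchModel
  rw [← mul_sub, ← Finset.sum_sub_distrib, mul_assoc, mul_assoc, Finset.sum_mul]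
  refine mul_le_mul_of_nonneg_left (Finset.sum_le_sum fun i _ => ?_) (by positivity)
  have := (abs_le.1 ((hs i).lipschitz x hx y hy)).2
  rw [norm_sub_rev] at this
  linarith

end Sample

/-! ### The real-valued problem: regularity of the true objective -/

section Core

variable {d : ℕ} {𝒮 : Type*} [MeasurableSpace 𝒮]

/-- The assumptions on the problem, in terms of real-valued functions on `C = dom r`. -/
structure ModelCore (P : Measure 𝒮) (fm : Vec d → Vec d → 𝒮 → ℝ) (V C : Set (Vec d))
    (R F : Vec d → ℝ) (ηb τb : ℝ) (G : NNReal → NNReal) (Lf : 𝒮 → NNReal) : Prop where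
  isOpen : IsOpen V
  subset : C ⊆ V
  nonempty : C.Nonempty
  closedOn : ClosedOn C R
  measurableR : Measurable R
  continuousF : Continuous F
  measurable : Measurable (fun q : V × V × 𝒮 => fm q.1 q.2.1 q.2.2)
  good : ∀ᵐ s ∂P, GoodSample fm V C R ηb τb G Lf s
  η_nonneg : 0 ≤ ηb
  τ_nonneg : 0 ≤ τb
  monotone : Monotone G
  measurableL : Measurable Lf
  integrableL : Integrable (fun s => (Lf s : ℝ) ^ 2) P
  integrable : ∀ x ∈ V, Integrable (fun s => fm x x s) P
  integral_eq : ∀ x ∈ V, ∫ s, fm x x s ∂P = F x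

variable {P : Measure 𝒮} {fm : Vec d → Vec d → 𝒮 → ℝ}
  {V C : Set (Vec d)} {R F : Vec d → ℝ} {ηb τb : ℝ} {G : NNReal → NNReal} {Lf : 𝒮 → NNReal}

namespace ModelCore

lemma integrable_lipschitz [IsProbabilityMeasure P] (h : ModelCore P fm V C R F ηb τb G Lf) :
    Integrable (fun s => (Lf s : ℝ)) P := by
  refine (h.integrableL.add (integrable_const 1)).mono'
    (measurable_coe_nnreal_real.comp h.measurableL).aestronglyMeasurable
    (Eventually.of_forall fun s => ?_)
  have h0 : (0 : ℝ) ≤ Lf s := (Lf s).2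
  rw [Real.norm_of_nonneg h0, Pi.add_apply]
  nlinarith [sq_nonneg ((Lf s : ℝ) - 1)]

lemma convex [IsProbabilityMeasure P] (h : ModelCore P fm V C R F ηb τb G Lf) : Convex ℝ C := by
  obtain ⟨s, hs⟩ := h.good.exists
  obtain ⟨x, hx⟩ := h.nonempty
  exact (hs.convex x (h.subset hx)).1

lemma measurable_section (h : ModelCore P fm V C R F ηb τb G Lf) {x y : Vec d} (hx : x ∈ V)
    (hy : y ∈ V) : Measurable (fm x y) := by
  have h1 : Measurable fun s : 𝒮 => ((⟨x, hx⟩, ⟨y, hy⟩, s) : V × V × 𝒮) := by fun_prop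
  exact h.measurable.comp h1

lemma integrable_model [IsProbabilityMeasure P] (h : ModelCore P fm V C R F ηb τb G Lf) {x y : Vec d} (hx : x ∈ V)
    (hy : y ∈ V) : Integrable (fm x y) P := by
  have h1 : Integrable (fun s => fm x y s - fm y y s) P :=
    (integrable_const (ηb / 2 * ‖y - x‖ ^ 2)).mono'
      ((h.measurable_section hx hy).sub (h.measurable_section hy hy)).aestronglyMeasurable
      (by filter_upwards [h.good] with s hs using hs.approx x hx y hy)
  exact (h1.add (h.integrable y hy)).congr (Eventually.of_forall fun s => by simp)

lemma integral_model_le [IsProbabilityMeasure P] (h : ModelCore P fm V C R F ηb τb G Lf) {x y : Vec d} (hx : x ∈ V)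
    (hy : y ∈ V) : ∫ s, fm x y s ∂P ≤ F y + ηb / 2 * ‖y - x‖ ^ 2 := by
  have h1 : ∫ s, fm x y s ∂P ≤ ∫ s, (fm y y s + ηb / 2 * ‖y - x‖ ^ 2) ∂P := by
    refine integral_mono_ae (h.integrable_model hx hy)
      ((h.integrable y hy).add (integrable_const _)) ?_
    filter_upwards [h.good] with s hs
    linarith [(abs_le.1 (hs.approx x hx y hy)).2]
  rw [integral_add (h.integrable y hy) (integrable_const _), h.integral_eq y hy] at h1
  simpa using h1

/-- The increment of the cost is compared with the increment of the model centred at `x`: the latter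
is Lipschitz, the approximation error at `y` is quadratic, and at `x` the model is exact. -/
lemma abs_sub_le [IsProbabilityMeasure P] (h : ModelCore P fm V C R F ηb τb G Lf) {x y : Vec d} (hx : x ∈ V)
    (hy : y ∈ V) : |F y - F x| ≤
      (∫ s, (Lf s : ℝ) ∂P) * G ‖x‖₊ * ‖y - x‖ + ηb / 2 * ‖y - x‖ ^ 2 := by
  rw [← h.integral_eq x hx, ← h.integral_eq y hy,
    ← integral_sub (h.integrable y hy) (h.integrable x hx)]
  refine (norm_integral_le_of_norm_le (f := fun s => fm y y s - fm x x s) (g := fun s => (Lf s : ℝ) * (G ‖x‖₊ * ‖y - x‖) +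
    ηb / 2 * ‖y - x‖ ^ 2) ((h.integrable_lipschitz.mul_const _).add (integrable_const _))
    ?_).trans_eq ?_
  · filter_upwards [h.good] with s hs
    have h1 := abs_le.1 (hs.approx x hx y hy)
    have h2 := abs_le.1 (hs.lipschitz x hx y hy)
    rw [norm_sub_rev x y] at h2
    rw [Real.norm_eq_abs, abs_le]
    constructor <;> linarith
  · rw [integral_add (h.integrable_lipschitz.mul_const _) (integrable_const _),
      integral_mul_const]
    simp [mul_assoc]

/-- The model is centred at the intermediate point `x = z + t (y - z)`, where it is exact. Its
errors at `y` and `z`, weighted by `t` and `1 - t`, add up to `t (1 - t)² + (1 - t) t² = t (1 - t)`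
times `ηb / 2 ‖y - z‖²`, which is the form of a convexity modulus. -/
lemma objective_convex [IsProbabilityMeasure P] (h : ModelCore P fm V C R F ηb τb G Lf) :
    ModulusConvexOn C (fun y => F y + R y) (fun v => -((ηb + τb) / 2 * ‖v‖ ^ 2)) := by
  refine ⟨h.convex, fun y hy z hz t h0 h1 => ?_⟩
  set x := z + t • (y - z) with hx
  have hxC : x ∈ C := h.convex.add_smul_sub_mem hz hy ⟨h0, h1⟩
  have hxV := h.subset hxC
  have hyV := h.subset hy
  have hzV := h.subset hz
  have ny : ‖y - x‖ ^ 2 = (1 - t) ^ 2 * ‖y - z‖ ^ 2 := by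
    have : y - x = (1 - t) • (y - z) := by rw [hx]; module
    rw [this, norm_smul, mul_pow, Real.norm_eq_abs, sq_abs]
  have nz : ‖z - x‖ ^ 2 = t ^ 2 * ‖y - z‖ ^ 2 := by
    have : z - x = (-t) • (y - z) := by rw [hx]; module
    rw [this, norm_smul, mul_pow, Real.norm_eq_abs, sq_abs, neg_sq]
  set c := R z + t * (R y - R z) - R x + t * (1 - t) * ((ηb + τb) / 2 * ‖y - z‖ ^ 2) with hc
  have key : ∫ s, fm x x s ∂P ≤ ∫ s, ((1 - t) * fm z z s + t * fm y y s + c) ∂P := by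
    refine integral_mono_ae (h.integrable x hxV) ((((h.integrable z hzV).const_mul _).add
      ((h.integrable y hyV).const_mul _)).add (integrable_const _)) ?_
    filter_upwards [h.good] with s hs
    have h2 := (hs.convex x hxV).2 y hy z hz t h0 h1
    rw [← hx] at h2
    have h3 := mul_le_mul_of_nonneg_left (abs_le.1 (hs.approx x hxV y hyV)).2 h0
    have h4 := mul_le_mul_of_nonneg_left (abs_le.1 (hs.approx x hxV z hzV)).2 (sub_nonneg.2 h1)
    rw [ny] at h3
    rw [nz] at h4
    have e : t * (ηb / 2 * ((1 - t) ^ 2 * ‖y - z‖ ^ 2)) +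
        (1 - t) * (ηb / 2 * (t ^ 2 * ‖y - z‖ ^ 2)) =
        t * (1 - t) * (ηb / 2 * ‖y - z‖ ^ 2) := by ring
    have e2 : t * (1 - t) * ((ηb + τb) / 2 * ‖y - z‖ ^ 2) =
        t * (1 - t) * (ηb / 2 * ‖y - z‖ ^ 2) + t * (1 - t) * (τb / 2 * ‖y - z‖ ^ 2) := by ring
    rw [hc, e2]
    linarith
  have hadd : Integrable (fun s => (1 - t) * fm z z s + t * fm y y s) P :=
    ((h.integrable z hzV).const_mul _).add ((h.integrable y hyV).const_mul _)
  rw [integral_add hadd (integrable_const _), integral_add ((h.integrable z hzV).const_mul _)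
    ((h.integrable y hyV).const_mul _), integral_const_mul, integral_const_mul,
    h.integral_eq x hxV, h.integral_eq y hyV, h.integral_eq z hzV] at key
  simp only [integral_const, probReal_univ, smul_eq_mul, one_mul] at key
  simp only
  linarith

lemma objective_closedOn (h : ModelCore P fm V C R F ηb τb G Lf) :
    ClosedOn C (fun y => F y + R y) := by
  simpa only [add_comm] using h.closedOn.of_continuous h.continuousF

lemma proxRegular [IsProbabilityMeasure P] (h : ModelCore P fm V C R F ηb τb G Lf) {ρ μ L : ℝ} (hμ : 0 < μ) (hL : 0 < L)
    (hρ : L ^ 2 * (ηb + τb) < ρ) :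
    ProxRegular C (fun y => F y + R y) (ηb + τb) ρ μ L where
  nonempty := h.nonempty
  closedOn := h.objective_closedOn
  convex := h.objective_convex
  μ_pos := hμ
  L_pos := hL
  ρ_pos := lt_of_le_of_lt (mul_nonneg (sq_nonneg _) (add_nonneg h.η_nonneg h.τ_nonneg)) hρ
  lt := hρ

end ModelCore

end Core

end IspPPA

namespace IspPPA

/-! ### One step along a sample path -/

section Pathwise

variable {d m : ℕ} {𝒮 : Type*} [MeasurableSpace 𝒮] {P : Measure 𝒮} [IsProbabilityMeasure P]
  {fm : Vec d → Vec d → 𝒮 → ℝ} {V C : Set (Vec d)} {R F : Vec d → ℝ} {ηb τb : ℝ}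
  {G : NNReal → NNReal} {Lf : 𝒮 → NNReal}

/-- The stepsize rule. -/
noncomputable def stepsize (G : NNReal → NNReal) (A : ℝ) (x : Vec d) : ℝ :=
  A / max 1 (G ‖x‖₊ : ℝ)

lemma stepsize_pos {A : ℝ} (hA : 0 < A) (x : Vec d) : 0 < stepsize G A x :=
  div_pos hA (lt_max_of_lt_left one_pos)

lemma stepsize_le {A : ℝ} (hA : 0 < A) (x : Vec d) : stepsize G A x ≤ A :=
  div_le_self hA.le (le_max_left _ _)

/-- The stepsize cancels the growth function, which replaces a global Lipschitz bound throughout. -/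
lemma stepsize_mul_le {A : ℝ} (hA : 0 < A) (x : Vec d) : stepsize G A x * G ‖x‖₊ ≤ A := by
  have h1 : 0 < max 1 (G ‖x‖₊ : ℝ) := lt_max_of_lt_left one_pos
  rw [stepsize, div_mul_eq_mul_div, div_le_iff₀ h1]
  exact mul_le_mul_of_nonneg_left (le_max_right _ _) hA.le

/-- The admissible base stepsizes for the descent inequality. -/
structure SmallStep (ηb τb ρ μ L A : ℝ) : Prop where
  pos : 0 < A
  le_one : A ≤ 1
  tau : L ^ 2 * τb * A ≤ 1 / 2
  eta : A * (ρ * (L ^ 2 / μ ^ 2) + L ^ 2 * ηb) ≤ 1 / 2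

/-- The factor by which an inexact step may exceed the exact one. -/
noncomputable def slack (τ A α : ℝ) : ℝ := 1 + τ * α + (1 + τ + 4 * τ ^ 2) * A ^ 2

omit [MeasurableSpace 𝒮] in
lemma minibatchComposite_represents {r : Vec d → EReal} (hr : Represents r C R) (x : Vec d)
    (s : Fin m → 𝒮) :
    Represents (minibatchComposite fm r x s) C (fun y => batchModel fm x s y + R y) := by
  refine ⟨fun y hy => ?_, fun y hy => ?_⟩
  · simp only [minibatchComposite, hr.1 y hy, batchModel]
    exact (EReal.coe_add _ _).symm
  · simp only [minibatchComposite, hr.2 y hy]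
    exact EReal.coe_add_top _

/-- Jensen's inequality for the mean; it reduces the random error to individual second moments of
the Lipschitz constants. -/
lemma sq_mean_add_le (hm : 0 < m) (l : Fin m → ℝ) (a : ℝ) :
    ((1 / (m : ℝ)) * ∑ i, l i + a) ^ 2 ≤ 2 * ((1 / (m : ℝ)) * ∑ i, l i ^ 2) + 2 * a ^ 2 := by
  have hm0 : (0 : ℝ) < m := by exact_mod_cast hm
  have h1 := sq_sum_le_card_mul_sum_sq (s := Finset.univ) (f := l)
  simp only [Finset.card_univ, Fintype.card_fin] at h1
  have h2 : ((1 / (m : ℝ)) * ∑ i, l i) ^ 2 ≤ (1 / (m : ℝ)) * ∑ i, l i ^ 2 := by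
    calc ((1 / (m : ℝ)) * ∑ i, l i) ^ 2 = (1 / (m : ℝ)) ^ 2 * (∑ i, l i) ^ 2 := by ring
      _ ≤ (1 / (m : ℝ)) ^ 2 * (m * ∑ i, l i ^ 2) := by gcongr
      _ = _ := by field_simp
  nlinarith [sq_nonneg ((1 / (m : ℝ)) * ∑ i, l i - a)]

/-- The envelope at the new point is tested with the old proximal point `y`. The only quantities on
the right that depend on the new minibatch are the new metric, the model increments and the squared
Lipschitz constants, and each enters linearly. -/
lemma ModelCore.step_pathwise (h : ModelCore P fm V C R F ηb τb G Lf) (hm : 0 < m)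
    {μ L ρ A γ m₀ : ℝ} (hμ : 0 < μ) (hL : 0 < L) (hρ : L ^ 2 * (ηb + τb) < ρ)
    (hA : SmallStep ηb τb ρ μ L A) (hγ : 0 ≤ γ) {r : Vec d → EReal} (hr : Represents r C R)
    {M N : Vec d →L[ℝ] Vec d} (hM : IsMetric μ L M) (hN : IsMetric μ L N) {s : Fin m → 𝒮}
    (hs : ∀ i, GoodSample fm V C R ηb τb G Lf (s i)) {x x' y : Vec d} (hx : x ∈ V) {α : ℝ}
    (hα : α = stepsize G A x) (hy : y = proxPt C (fun y => F y + R y) ρ N x)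
    (hstep : CriterionA M α (γ * α ^ 2) (minibatchComposite fm r x s) x x' ∨
      CriterionB (L ^ 2 * τb) M α (γ * α ^ 2) (minibatchComposite fm r x s) x x' ∨
      CriterionC (L ^ 2 * τb) M α (γ * α ^ 2) (minibatchComposite fm r x s) x x') :
    env C (fun y => F y + R y) ρ M x' - m₀ ≤ (F y + R y - m₀) + ρ / 2 *
      (slack (L ^ 2 * τb) A α * (quad M (y - x) - α * ρ * quad N (y - x) +
        2 * α * ((1 / (m : ℝ)) * ∑ i, (fm x y (s i) - fm x x (s i)) - (F y - F x)) +
        2 * A ^ 2 * L ^ 2 * (2 * ((1 / (m : ℝ)) * ∑ i, (Lf (s i) : ℝ) ^ 2) +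
          2 * (∫ s, (Lf s : ℝ) ∂P) ^ 2)) + 2 * γ ^ 2 * A ^ 2) := by
  have hreg := h.proxRegular hμ hL hρ
  have hα0 : 0 < α := hα ▸ stepsize_pos hA.pos x
  have hαA : α ≤ A := hα ▸ stepsize_le hA.pos x
  have hαG : α * G ‖x‖₊ ≤ A := hα ▸ stepsize_mul_le hA.pos x
  have hτ0 : 0 ≤ L ^ 2 * τb := mul_nonneg (sq_nonneg _) h.τ_nonneg
  have hτα : L ^ 2 * τb * α ≤ 1 / 2 := (mul_le_mul_of_nonneg_left hαA hτ0).trans hA.tau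
  obtain ⟨hconv, hcl⟩ := batchModel_convex_closedOn hm hs hx
  obtain ⟨z, hzC, hzd, hz⟩ := exists_min_of_criteria hM hL
    (minibatchComposite_represents hr x s) h.nonempty hcl hconv h.τ_nonneg hα0
    (by linarith) (by positivity) hstep
  obtain ⟨hyC, hymin⟩ := hreg.proxPt_spec hN x
  have hyz : F y + R y + ρ / 2 * quad N (y - x) ≤ F z + R z + ρ / 2 * quad N (z - x) := by
    have := hymin z hzC
    rw [env, ← hy] at this
    exact this
  rw [← hy] at hyC
  set l₁ := ∫ s, (Lf s : ℝ) ∂P with hl₁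
  have hl₁0 : 0 ≤ l₁ := integral_nonneg fun s => (Lf s).2
  set l := (1 / (m : ℝ)) * ∑ i, (Lf (s i) : ℝ) with hl
  have hl0 : 0 ≤ l := mul_nonneg (by positivity) (Finset.sum_nonneg fun i _ => (Lf (s i)).2)
  have h1 := prox_step_bound hM hN hL hμ hα0 hαA hαG (add_nonneg hl0 hl₁0) h.η_nonneg
    hreg.ρ_pos.le hA.eta (hz y hyC) (batchModel_lipschitz hs hx (h.subset hzC))
    ((abs_le.1 (h.abs_sub_le hx (h.subset hzC))).2) hyz
  have e1 : batchModel fm x s y - batchModel fm x s x =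
      (1 / (m : ℝ)) * ∑ i, (fm x y (s i) - fm x x (s i)) := by
    rw [batchModel, batchModel, ← mul_sub, Finset.sum_sub_distrib]
  rw [e1] at h1
  have h2 := sq_mean_add_le hm (fun i => (Lf (s i) : ℝ)) l₁
  have h3 := h1.trans (add_le_add_right
    (mul_le_mul_of_nonneg_left h2 (by positivity : 0 ≤ 2 * A ^ 2 * L ^ 2)) _)
  -- The distance from `y` to `x'` is split at the exact minimizer `z`; weight `A ^ 2` keeps the
  -- loss in the main term summable.
  have h4 := quad_add_le hM.selfAdjoint (hM.quad_nonneg hL) (pow_pos hA.pos 2) (y - z) (z - x')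
  rw [sub_add_sub_cancel, quad_sub_comm M z x'] at h4
  have h5 := (inexact_step_bound hα0 hαA hA.le_one hτ0 hA.tau (hM.quad_nonneg hL _) h3 hzd
    h4).2
  have h6 := (hreg.proxPt_spec hM x').2 y hyC
  have h7 := mul_le_mul_of_nonneg_left h5 (by linarith [hreg.ρ_pos] : 0 ≤ ρ / 2)
  unfold slack
  linarith

/-- The pointwise comparison of the conditional bound with the previous value. -/
lemma drift_bound {c ρ η τ B A α D Q E γ κ : ℝ} (hα : 0 ≤ α) (hαA : α ≤ A) (hA1 : A ≤ 1)
    (hτ : 0 ≤ τ) (hη : 0 ≤ η) (hB : 1 ≤ B) (hcB : c ≤ B) (hc1 : 1 ≤ c) (hρ : B * (η + τ) < ρ)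
    (hD : 0 ≤ D) (hQ : 0 ≤ Q) (hE : 0 ≤ E) (hκ : κ = 1 + τ + 4 * τ ^ 2) :
    Q + ρ / 2 * (slack τ A α * (c * D - α * ρ * D + α * η * D + A ^ 2 * E) + 2 * γ ^ 2 * A ^ 2) ≤
      (1 + (c - 1 + κ * B * A ^ 2)) * (Q + ρ / 2 * D) - ρ / 2 * (ρ - B * (η + τ)) * (α * D) +
        ρ / 2 * ((1 + τ + κ) * E + 2 * γ ^ 2) * A ^ 2 := by
  have hA0 : 0 ≤ A := hα.trans hαA
  have hκ0 : 0 ≤ κ := by rw [hκ]; positivity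
  have hηB : η ≤ B * η := le_mul_of_one_le_left hη hB
  have hτB : 0 ≤ B * τ := by positivity
  have hρη : 0 ≤ ρ - η := by linarith
  have hρ0 : 0 ≤ ρ := by linarith
  have hs : slack τ A α = 1 + τ * α + κ * A ^ 2 := by rw [slack, hκ]
  have hs1 : slack τ A α ≤ 1 + τ + κ := by
    have h1 : τ * α ≤ τ := mul_le_of_le_one_right hτ (hαA.trans hA1)
    have h2 : κ * A ^ 2 ≤ κ := mul_le_of_le_one_right hκ0 (pow_le_one₀ hA0 hA1)
    rw [hs]; linarith
  -- The inflated terms `τ α c` and `η α` are at most `B τ α` and `B η α`. This is the origin of the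
  -- threshold `B (η + τ)` for `ρ`.
  have k1 : slack τ A α * (c - α * (ρ - η)) ≤
      c + κ * B * A ^ 2 - (ρ - B * (η + τ)) * α := by
    have i1 : τ * α * c ≤ τ * α * B := mul_le_mul_of_nonneg_left hcB (by positivity)
    have i2 : κ * A ^ 2 * c ≤ κ * A ^ 2 * B := mul_le_mul_of_nonneg_left hcB (by positivity)
    have i3 : 0 ≤ (τ * α + κ * A ^ 2) * (α * (ρ - η)) := by positivity
    have i4 : η * α ≤ B * η * α := mul_le_mul_of_nonneg_right hηB hα
    rw [hs]
    linarith
  have k2 := mul_le_mul_of_nonneg_right k1 hD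
  have k3 := mul_le_mul_of_nonneg_right hs1 (by positivity : 0 ≤ A ^ 2 * E)
  have k4 : 0 ≤ (c - 1 + κ * B * A ^ 2) * Q :=
    mul_nonneg (add_nonneg (by linarith) (by positivity)) hQ
  have k5 := mul_le_mul_of_nonneg_left (add_le_add k2 k3) (by linarith : 0 ≤ ρ / 2)
  linarith

end Pathwise

end IspPPA

namespace IspPPA

/-! ### Averaging over the new minibatch -/

section Expected

variable {d m : ℕ} {𝒮 : Type*} [MeasurableSpace 𝒮] {P : Measure 𝒮} [IsProbabilityMeasure P]
  {fm : Vec d → Vec d → 𝒮 → ℝ} {V C : Set (Vec d)} {R F : Vec d → ℝ} {ηb τb : ℝ}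
  {G : NNReal → NNReal} {Lf : 𝒮 → NNReal}

lemma ProxRegular.measurable_proxPt_subtype {g : Vec d → ℝ} {κ ρ μ L : ℝ}
    (h : ProxRegular C g κ ρ μ L) {Ω : Type*} [MeasurableSpace Ω]
    {N : Ω → {N : Vec d →L[ℝ] Vec d // IsMetric μ L N}} {x : Ω → Vec d}
    (hN : Measurable N) (hx : Measurable x) :
    Measurable fun ω => proxPt C g ρ (N ω).1 (x ω) := by
  have h1 := h.continuous_proxPt.measurable.comp (hN.prodMk hx)
  exact h1

lemma ProxRegular.measurable_proxPt {g : Vec d → ℝ} {κ ρ μ L : ℝ}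
    (h : ProxRegular C g κ ρ μ L) {Ω : Type*} [MeasurableSpace Ω] {N : Ω → Vec d →L[ℝ] Vec d}
    {x : Ω → Vec d} (hN : ∀ ω, IsMetric μ L (N ω)) (hNm : Measurable N) (hx : Measurable x) :
    Measurable fun ω => proxPt C g ρ (N ω) (x ω) :=
  h.measurable_proxPt_subtype (N := fun ω => ⟨N ω, hN ω⟩) hNm.subtype_mk hx

lemma ProxRegular.measurable_env {g : Vec d → ℝ} {κ ρ μ L : ℝ}
    (h : ProxRegular C g κ ρ μ L) (hg : Measurable g) {Ω : Type*} [MeasurableSpace Ω]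
    {N : Ω → Vec d →L[ℝ] Vec d} {x : Ω → Vec d} (hN : ∀ ω, IsMetric μ L (N ω))
    (hNm : Measurable N) (hx : Measurable x) :
    Measurable fun ω => env C g ρ (N ω) (x ω) := by
  have h1 := h.measurable_proxPt hN hNm hx
  exact (hg.comp h1).add
    ((continuous_quad_uncurry.measurable.comp (hNm.prodMk (h1.sub hx))).const_mul _)

lemma measurable_stepsize (h : Monotone G) {Ω : Type*}
    [MeasurableSpace Ω] {x : Ω → Vec d} (hx : Measurable x) (A : ℝ) :
    Measurable fun ω => stepsize G A (x ω) := by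
  have := h.measurable
  unfold stepsize
  fun_prop

variable {Ω : Type*} {𝓂 mΩ : MeasurableSpace Ω} {Prob : Measure Ω} [IsProbabilityMeasure Prob]
  {S : Fin m → Ω → 𝒮} {x y : Ω → Vec d} {u : Ω → ℝ}

lemma integrable_mul_of_sq {Ω : Type*} [MeasurableSpace Ω] {Prob : Measure Ω} {v w : Ω → ℝ} (hw : Integrable w Prob)
    (hw0 : ∀ ω, 0 ≤ w ω) (hv : AEStronglyMeasurable v Prob) (hv0 : ∀ ω, 0 ≤ v ω)
    (hwv : Integrable (fun ω => w ω * v ω ^ 2) Prob) :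
    Integrable (fun ω => w ω * v ω) Prob := by
  refine (hw.add hwv).mono' (hw.aestronglyMeasurable.mul hv) (Eventually.of_forall fun ω => ?_)
  rw [Real.norm_of_nonneg (mul_nonneg (hw0 ω) (hv0 ω)), Pi.add_apply]
  have : w ω * v ω ≤ w ω * (1 + v ω ^ 2) :=
    mul_le_mul_of_nonneg_left (by nlinarith [sq_nonneg (v ω - 1)]) (hw0 ω)
  linarith

/-- The expected model decrease is controlled by the decrease of the true cost. -/
lemma ModelCore.expected_model_le (h : ModelCore P fm V C R F ηb τb G Lf) (hm : 0 < m)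
    (hle : 𝓂 ≤ mΩ) (hS : ∀ i, Measurable (S i)) (hlaw : ∀ i, Prob.map (S i) = P)
    (hind : ∀ i, Indep 𝓂 (MeasurableSpace.comap (S i) inferInstance) Prob)
    (hxV : ∀ ω, x ω ∈ V) (hyV : ∀ ω, y ω ∈ V) (hxm : Measurable[𝓂] x) (hym : Measurable[𝓂] y)
    {A : ℝ} (hA : 0 < A) (hum : Measurable[𝓂] u) (hu0 : ∀ ω, 0 ≤ u ω) (hu : Integrable u Prob)
    (huy : Integrable (fun ω => u ω * ‖y ω - x ω‖ ^ 2) Prob) :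
    Integrable (fun ω => u ω * (stepsize G A (x ω) * ((1 / (m : ℝ)) *
      ∑ i, (fm (x ω) (y ω) (S i ω) - fm (x ω) (x ω) (S i ω)) - (F (y ω) - F (x ω))))) Prob ∧
    ∫ ω, u ω * (stepsize G A (x ω) * ((1 / (m : ℝ)) *
      ∑ i, (fm (x ω) (y ω) (S i ω) - fm (x ω) (x ω) (S i ω)) - (F (y ω) - F (x ω)))) ∂Prob ≤
    ∫ ω, u ω * (stepsize G A (x ω) * (ηb / 2 * ‖y ω - x ω‖ ^ 2)) ∂Prob := by
  have hm0 : (0 : ℝ) < m := by exact_mod_cast hm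
  set α : Ω → ℝ := fun ω => stepsize G A (x ω) with hα
  have hαm : Measurable[𝓂] α := @measurable_stepsize _ _ h.monotone _ 𝓂 _ hxm A
  have hα0 : ∀ ω, 0 < α ω := fun ω => stepsize_pos hA _
  have hαA : ∀ ω, α ω ≤ A := fun ω => stepsize_le hA _
  have hαG : ∀ ω, α ω * G ‖x ω‖₊ ≤ A := fun ω => stepsize_mul_le hA _
  have hxm' := hxm.mono hle le_rfl
  have hym' := hym.mono hle le_rfl
  have hum' := hum.mono hle le_rfl
  have hαm' := hαm.mono hle le_rfl
  have hdm : Measurable[𝓂] fun ω => ‖y ω - x ω‖ := measurable_norm.comp (hym.sub hxm)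
  have hdm' := hdm.mono hle le_rfl
  have hud : Integrable (fun ω => u ω * ‖y ω - x ω‖) Prob :=
    integrable_mul_of_sq hu hu0 hdm'.aestronglyMeasurable (fun ω => norm_nonneg _) huy
  -- Past and sample are separated: with `ω` frozen, integrating over `s` yields the expected model
  -- increment between `x` and `y`.
  set ψ : Ω → 𝒮 → ℝ := fun ω s =>
    u ω * (α ω * (fm (x ω) (y ω) s - fm (x ω) (x ω) s)) with hψ
  have hψm : @Measurable (Ω × 𝒮) ℝ (@Prod.instMeasurableSpace Ω 𝒮 𝓂 _) _
      (Function.uncurry ψ) := by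
    let _ : MeasurableSpace Ω := 𝓂
    have hx1 : Measurable fun q : Ω × 𝒮 => (⟨x q.1, hxV q.1⟩ : V) :=
      (hxm.comp measurable_fst).subtype_mk
    have hy1 : Measurable fun q : Ω × 𝒮 => (⟨y q.1, hyV q.1⟩ : V) :=
      (hym.comp measurable_fst).subtype_mk
    have a1 : Measurable fun q : Ω × 𝒮 => fm (x q.1) (y q.1) q.2 :=
      h.measurable.comp (hx1.prodMk (hy1.prodMk measurable_snd))
    have a2 : Measurable fun q : Ω × 𝒮 => fm (x q.1) (x q.1) q.2 :=
      h.measurable.comp (hx1.prodMk (hx1.prodMk measurable_snd))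
    exact (hum.comp measurable_fst).mul ((hαm.comp measurable_fst).mul (a1.sub a2))
  -- The Lipschitz condition and `α * G ≤ A` give a dominating product of a function of the past and
  -- a function of the sample.
  have hψb : ∀ᵐ s ∂P, ∀ ω, |ψ ω s| ≤ (A * (u ω * ‖y ω - x ω‖)) * Lf s := by
    filter_upwards [h.good] with s hs ω
    have h1 := hs.lipschitz (x ω) (hxV ω) (y ω) (hyV ω)
    rw [abs_sub_comm, norm_sub_rev] at h1
    simp only [hψ, abs_mul, abs_of_nonneg (hu0 ω), abs_of_pos (hα0 ω)]
    calc u ω * (α ω * |fm (x ω) (y ω) s - fm (x ω) (x ω) s|)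
        ≤ u ω * (α ω * (Lf s * G ‖x ω‖₊ * ‖y ω - x ω‖)) :=
          mul_le_mul_of_nonneg_left (mul_le_mul_of_nonneg_left h1 (hα0 ω).le) (hu0 ω)
      _ = (α ω * G ‖x ω‖₊) * (u ω * ‖y ω - x ω‖ * Lf s) := by ring
      _ ≤ A * (u ω * ‖y ω - x ω‖ * Lf s) :=
          mul_le_mul_of_nonneg_right (hαG ω)
            (mul_nonneg (mul_nonneg (hu0 ω) (norm_nonneg _)) (Lf s).2)
      _ = _ := by ring
  have hfr := fun i => integral_comp_indep hle (hS i) (hlaw i) (hind i) hψm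
    ((hum.mul hdm).const_mul A) (hud.const_mul A) h.integrable_lipschitz hψb
  have hF : Integrable (fun ω => u ω * (α ω * (F (y ω) - F (x ω)))) Prob := by
    set l₁ := ∫ s, (Lf s : ℝ) ∂P with hl₁
    have hl₁0 : 0 ≤ l₁ := integral_nonneg fun s => (Lf s).2
    refine ((hud.const_mul (A * l₁)).add (huy.const_mul (A * (ηb / 2)))).mono'
      (hum'.mul (hαm'.mul ((h.continuousF.measurable.comp hym').sub
        (h.continuousF.measurable.comp hxm')))).aestronglyMeasurable
      (Eventually.of_forall fun ω => ?_)
    have h1 := h.abs_sub_le (hxV ω) (hyV ω)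
    rw [← hl₁] at h1
    rw [Real.norm_eq_abs, abs_mul, abs_mul, abs_of_nonneg (hu0 ω), abs_of_pos (hα0 ω),
      Pi.add_apply]
    have hη := h.η_nonneg
    have h2 : α ω * (ηb / 2 * ‖y ω - x ω‖ ^ 2) ≤ A * (ηb / 2 * ‖y ω - x ω‖ ^ 2) :=
      mul_le_mul_of_nonneg_right (hαA ω) (by positivity)
    have h3 : (α ω * G ‖x ω‖₊) * (l₁ * ‖y ω - x ω‖) ≤ A * (l₁ * ‖y ω - x ω‖) :=
      mul_le_mul_of_nonneg_right (hαG ω) (by positivity)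
    have h4 := mul_le_mul_of_nonneg_left h1 (hα0 ω).le
    have h5 : α ω * |F (y ω) - F (x ω)| ≤
        A * (l₁ * ‖y ω - x ω‖) + A * (ηb / 2 * ‖y ω - x ω‖ ^ 2) := by linarith
    have h6 := mul_le_mul_of_nonneg_left h5 (hu0 ω)
    linarith
  have heq : (fun ω => u ω * (α ω * ((1 / (m : ℝ)) *
      ∑ i, (fm (x ω) (y ω) (S i ω) - fm (x ω) (x ω) (S i ω)) - (F (y ω) - F (x ω))))) =
      fun ω => (1 / (m : ℝ)) * ∑ i, ψ ω (S i ω) - u ω * (α ω * (F (y ω) - F (x ω))) := by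
    ext ω
    simp only [hψ, ← Finset.mul_sum]
    ring
  have hsum : Integrable (fun ω => (1 / (m : ℝ)) * ∑ i, ψ ω (S i ω)) Prob :=
    (integrable_finsetSum _ fun i _ => (hfr i).1).const_mul _
  rw [heq]
  refine ⟨hsum.sub hF, ?_⟩
  rw [integral_sub hsum hF, integral_const_mul, integral_finsetSum _ fun i _ => (hfr i).1]
  have hu2 : Integrable (fun ω => u ω * (α ω * (ηb / 2 * ‖y ω - x ω‖ ^ 2))) Prob := by
    refine (huy.const_mul (A * (ηb / 2))).mono' (hum'.mul (hαm'.mul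
      ((hdm'.pow_const 2).const_mul _))).aestronglyMeasurable (Eventually.of_forall fun ω => ?_)
    have hη := h.η_nonneg
    have hu := hu0 ω
    have hαω := (hα0 ω).le
    rw [Real.norm_of_nonneg (by positivity)]
    have h2 : α ω * (ηb / 2 * ‖y ω - x ω‖ ^ 2) ≤ A * (ηb / 2 * ‖y ω - x ω‖ ^ 2) :=
      mul_le_mul_of_nonneg_right (hαA ω) (by positivity)
    have := mul_le_mul_of_nonneg_left h2 hu
    linarith
  have hone : ∀ i, ∫ ω, ψ ω (S i ω) ∂Prob ≤ ∫ ω, u ω * (α ω * (F (y ω) - F (x ω))) ∂Prob +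
      ∫ ω, u ω * (α ω * (ηb / 2 * ‖y ω - x ω‖ ^ 2)) ∂Prob := by
    intro i
    rw [(hfr i).2.2, ← integral_add hF hu2]
    refine integral_mono (hfr i).2.1 (hF.add hu2) fun ω => ?_
    simp only [hψ]
    rw [integral_const_mul, integral_const_mul, integral_sub (h.integrable_model (hxV ω) (hyV ω))
      (h.integrable _ (hxV ω)), h.integral_eq _ (hxV ω), ← mul_add, ← mul_add]
    refine mul_le_mul_of_nonneg_left (mul_le_mul_of_nonneg_left ?_ (hα0 ω).le) (hu0 ω)
    linarith [h.integral_model_le (hxV ω) (hyV ω)]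
  have hs := Finset.sum_le_sum fun i (_ : i ∈ Finset.univ) => hone i
  rw [Finset.sum_const, Finset.card_univ, Fintype.card_fin, nsmul_eq_mul] at hs
  have := mul_le_mul_of_nonneg_left hs (by positivity : 0 ≤ 1 / (m : ℝ))
  rw [← mul_assoc, one_div_mul_cancel hm0.ne', one_mul] at this
  linarith

lemma ModelCore.expected_lipschitz_sq (h : ModelCore P fm V C R F ηb τb G Lf) (hm : 0 < m)
    (hle : 𝓂 ≤ mΩ) (hS : ∀ i, Measurable (S i)) (hlaw : ∀ i, Prob.map (S i) = P)
    (hind : ∀ i, Indep 𝓂 (MeasurableSpace.comap (S i) inferInstance) Prob)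
    (hum : Measurable[𝓂] u) (hu0 : ∀ ω, 0 ≤ u ω) (hu : Integrable u Prob) (a : ℝ) :
    Integrable (fun ω => u ω * (2 * ((1 / (m : ℝ)) * ∑ i, (Lf (S i ω) : ℝ) ^ 2) + a)) Prob ∧
    ∫ ω, u ω * (2 * ((1 / (m : ℝ)) * ∑ i, (Lf (S i ω) : ℝ) ^ 2) + a) ∂Prob =
      ∫ ω, u ω * (2 * (∫ s, (Lf s : ℝ) ^ 2 ∂P) + a) ∂Prob := by
  have hm0 : (0 : ℝ) < m := by exact_mod_cast hm
  have hψm : @Measurable (Ω × 𝒮) ℝ (@Prod.instMeasurableSpace Ω 𝒮 𝓂 _) _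
      (Function.uncurry fun ω s => u ω * (Lf s : ℝ) ^ 2) := by
    let _ : MeasurableSpace Ω := 𝓂
    exact (hum.comp measurable_fst).mul
      (((measurable_coe_nnreal_real.comp h.measurableL).comp measurable_snd).pow_const 2)
  have hfr := fun i => integral_comp_indep hle (hS i) (hlaw i) (hind i) hψm hum hu
    h.integrableL (Eventually.of_forall fun s ω => by
      rw [abs_of_nonneg (mul_nonneg (hu0 ω) (sq_nonneg _))])
  have heq : (fun ω => u ω * (2 * ((1 / (m : ℝ)) * ∑ i, (Lf (S i ω) : ℝ) ^ 2) + a)) =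
      fun ω => 2 * ((1 / (m : ℝ)) * ∑ i, u ω * (Lf (S i ω) : ℝ) ^ 2) + u ω * a := by
    ext ω
    rw [← Finset.mul_sum]
    ring
  have hsum : Integrable (fun ω => 2 * ((1 / (m : ℝ)) * ∑ i, u ω * (Lf (S i ω) : ℝ) ^ 2)) Prob :=
    ((integrable_finsetSum _ fun i _ => (hfr i).1).const_mul _).const_mul _
  rw [heq]
  refine ⟨hsum.add (hu.mul_const a), ?_⟩
  rw [integral_add hsum (hu.mul_const a), integral_const_mul, integral_const_mul,
    integral_finsetSum _ fun i _ => (hfr i).1]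
  simp only [(hfr _).2.2, integral_const_mul, integral_mul_const]
  rw [Finset.sum_const, Finset.card_univ, Fintype.card_fin, nsmul_eq_mul]
  field_simp

end Expected

end IspPPA

namespace IspPPA

/-! ### The conditional descent inequality -/

section OneStep

variable {Ω : Type*} {𝓂 mΩ : MeasurableSpace Ω} {Prob : Measure Ω}

/-- Serves to average the three minibatch-dependent terms separately: metric change, model
increment, squared Lipschitz constants. -/
lemma integral_add_three_le {f₀ f₁ f₂ f₃ g₁ g₂ g₃ : Ω → ℝ} {a₁ a₂ a₃ : ℝ} (h₁ : 0 ≤ a₁)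
    (h₂ : 0 ≤ a₂) (h₃ : 0 ≤ a₃) (if₀ : Integrable f₀ Prob) (if₁ : Integrable f₁ Prob)
    (if₂ : Integrable f₂ Prob) (if₃ : Integrable f₃ Prob) (ig₁ : Integrable g₁ Prob)
    (ig₂ : Integrable g₂ Prob) (ig₃ : Integrable g₃ Prob)
    (l₁ : ∫ ω, f₁ ω ∂Prob ≤ ∫ ω, g₁ ω ∂Prob) (l₂ : ∫ ω, f₂ ω ∂Prob ≤ ∫ ω, g₂ ω ∂Prob)
    (l₃ : ∫ ω, f₃ ω ∂Prob ≤ ∫ ω, g₃ ω ∂Prob) :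
    ∫ ω, (f₀ ω + a₁ * f₁ ω + a₂ * f₂ ω + a₃ * f₃ ω) ∂Prob ≤
      ∫ ω, (f₀ ω + a₁ * g₁ ω + a₂ * g₂ ω + a₃ * g₃ ω) ∂Prob := by
  have key : ∀ {k₁ k₂ k₃ : Ω → ℝ}, Integrable k₁ Prob → Integrable k₂ Prob →
      Integrable k₃ Prob → ∫ ω, (f₀ ω + a₁ * k₁ ω + a₂ * k₂ ω + a₃ * k₃ ω) ∂Prob =
      ∫ ω, f₀ ω ∂Prob + a₁ * ∫ ω, k₁ ω ∂Prob + a₂ * ∫ ω, k₂ ω ∂Prob + a₃ * ∫ ω, k₃ ω ∂Prob := by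
    intro k₁ k₂ k₃ i₁ i₂ i₃
    have j₁ : Integrable (fun ω => f₀ ω + a₁ * k₁ ω) Prob := if₀.add (i₁.const_mul a₁)
    have j₂ : Integrable (fun ω => f₀ ω + a₁ * k₁ ω + a₂ * k₂ ω) Prob :=
      j₁.add (i₂.const_mul a₂)
    rw [integral_add j₂ (i₃.const_mul a₃), integral_add j₁ (i₂.const_mul a₂),
      integral_add if₀ (i₁.const_mul a₁), integral_const_mul, integral_const_mul,
      integral_const_mul]
  rw [key if₁ if₂ if₃, key ig₁ ig₂ ig₃]
  have := mul_le_mul_of_nonneg_left l₁ h₁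
  have := mul_le_mul_of_nonneg_left l₂ h₂
  have := mul_le_mul_of_nonneg_left l₃ h₃
  linarith

variable {d m : ℕ} {𝒮 : Type*} [MeasurableSpace 𝒮] {P : Measure 𝒮} [IsProbabilityMeasure P]
  {fm : Vec d → Vec d → 𝒮 → ℝ} {V C : Set (Vec d)} {R F : Vec d → ℝ} {ηb τb : ℝ}
  {G : NNReal → NNReal} {Lf : 𝒮 → NNReal} [IsProbabilityMeasure Prob]
  {S : Fin m → Ω → 𝒮} {x x' : Ω → Vec d}

set_option maxHeartbeats 1000000 in
/-- The conditional descent inequality for one step of the algorithm, in weighted form. -/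
lemma ModelCore.expected_step (h : ModelCore P fm V C R F ηb τb G Lf) (hm : 0 < m)
    (hle : 𝓂 ≤ mΩ) (hS : ∀ i, Measurable (S i)) (hlaw : ∀ i, Prob.map (S i) = P)
    (hind : ∀ i, Indep 𝓂 (MeasurableSpace.comap (S i) inferInstance) Prob)
    {μ L ρ A γ m₀ c B κ E : ℝ} (hμ : 0 < μ) (hL : 0 < L) (hA : SmallStep ηb τb ρ μ L A)
    (hγ : 0 ≤ γ) (hB : 1 ≤ B) (hcB : c ≤ B) (hc1 : 1 ≤ c)
    (hρ : B * (L ^ 2 * ηb + L ^ 2 * τb) < ρ)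
    (hκ : κ = 1 + L ^ 2 * τb + 4 * (L ^ 2 * τb) ^ 2)
    (hE : E = 2 * L ^ 2 * (2 * (∫ s, (Lf s : ℝ) ^ 2 ∂P) + 2 * (∫ s, (Lf s : ℝ) ∂P) ^ 2))
    {r : Vec d → EReal} (hr : Represents r C R) (hm₀ : ∀ y ∈ C, m₀ ≤ F y + R y)
    {M N : Ω → Vec d →L[ℝ] Vec d} (hM : ∀ ω, IsMetric μ L (M ω))
    (hN : ∀ ω, IsMetric μ L (N ω)) (hMm : Measurable M) (hNm : Measurable[𝓂] N)
    (hcond : ∀ z, z ≠ 0 →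
      ∀ᵐ ω ∂Prob, (Prob[fun ω' => quad (M ω') z / quad (N ω') z | 𝓂]) ω ≤ c)
    (hxV : ∀ ω, x ω ∈ V) (hxm : Measurable[𝓂] x) (hxm' : Measurable x')
    {α : Ω → ℝ} (hα : ∀ ω, α ω = stepsize G A (x ω))
    (hstep : ∀ᵐ ω ∂Prob,
      CriterionA (M ω) (α ω) (γ * α ω ^ 2) (minibatchComposite fm r (x ω) fun i => S i ω)
        (x ω) (x' ω) ∨
      CriterionB (L ^ 2 * τb) (M ω) (α ω) (γ * α ω ^ 2)
        (minibatchComposite fm r (x ω) fun i => S i ω) (x ω) (x' ω) ∨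
      CriterionC (L ^ 2 * τb) (M ω) (α ω) (γ * α ω ^ 2)
        (minibatchComposite fm r (x ω) fun i => S i ω) (x ω) (x' ω))
    {w : Ω → ℝ} (hw : Measurable[𝓂] w) (hw0 : ∀ ω, 0 ≤ w ω) (hw1 : ∀ ω, w ω ≤ 1)
    (hint : Integrable
      (fun ω => w ω * (env C (fun y => F y + R y) ρ (N ω) (x ω) - m₀)) Prob) :
    Integrable (fun ω => w ω * (env C (fun y => F y + R y) ρ (M ω) (x' ω) - m₀)) Prob ∧
    Integrable (fun ω => w ω * (α ω *
      quad (N ω) (proxPt C (fun y => F y + R y) ρ (N ω) (x ω) - x ω))) Prob ∧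
    ∫ ω, w ω * (env C (fun y => F y + R y) ρ (M ω) (x' ω) - m₀) ∂Prob ≤
      ∫ ω, w ω * ((1 + (c - 1 + κ * B * A ^ 2)) *
          (env C (fun y => F y + R y) ρ (N ω) (x ω) - m₀) -
        ρ / 2 * (ρ - B * (L ^ 2 * ηb + L ^ 2 * τb)) * (α ω *
          quad (N ω) (proxPt C (fun y => F y + R y) ρ (N ω) (x ω) - x ω)) +
        ρ / 2 * ((1 + L ^ 2 * τb + κ) * E + 2 * γ ^ 2) * A ^ 2) ∂Prob := by
  have hη0 : 0 ≤ L ^ 2 * ηb := mul_nonneg (sq_nonneg _) h.η_nonneg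
  have hτ0 : 0 ≤ L ^ 2 * τb := mul_nonneg (sq_nonneg _) h.τ_nonneg
  have hκ0 : 0 ≤ κ := by rw [hκ]; positivity
  have hρ' : L ^ 2 * (ηb + τb) < ρ := by
    have : L ^ 2 * ηb + L ^ 2 * τb ≤ B * (L ^ 2 * ηb + L ^ 2 * τb) :=
      le_mul_of_one_le_left (add_nonneg hη0 hτ0) hB
    linarith
  have hreg := h.proxRegular hμ hL hρ'
  have hρ0 := hreg.ρ_pos
  set g : Vec d → ℝ := fun y => F y + R y with hg
  have hgm : Measurable g := h.continuousF.measurable.add h.measurableR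
  set y : Ω → Vec d := fun ω => proxPt C g ρ (N ω) (x ω) with hy
  have hym : Measurable[𝓂] y := @ProxRegular.measurable_proxPt _ _ _ _ _ _ _ hreg _ 𝓂 _ _ hN hNm hxm
  have hyC : ∀ ω, y ω ∈ C := fun ω => (hreg.proxPt_spec (hN ω) (x ω)).1
  have hyV : ∀ ω, y ω ∈ V := fun ω => h.subset (hyC ω)
  set D : Ω → ℝ := fun ω => quad (N ω) (y ω - x ω) with hD
  have hD0 : ∀ ω, 0 ≤ D ω := fun ω => (hN ω).quad_nonneg hL _
  have hDm : Measurable[𝓂] D :=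
    continuous_quad_uncurry.measurable.comp (hNm.prodMk (hym.sub hxm))
  set Q : Ω → ℝ := fun ω => g (y ω) - m₀ with hQ
  have hQ0 : ∀ ω, 0 ≤ Q ω := fun ω => sub_nonneg.2 (hm₀ _ (hyC ω))
  have hQm : Measurable[𝓂] Q := (hgm.comp hym).sub_const _
  have hVeq : ∀ ω, env C g ρ (N ω) (x ω) - m₀ = Q ω + ρ / 2 * D ω := fun ω => by
    simp only [env, hQ, hD, hy]; ring
  simp only [hVeq] at hint ⊢
  have hαm : Measurable[𝓂] α := by
    have : α = fun ω => stepsize G A (x ω) := funext hα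
    rw [this]
    exact @measurable_stepsize _ _ h.monotone _ 𝓂 _ hxm A
  have hα0 : ∀ ω, 0 < α ω := fun ω => hα ω ▸ stepsize_pos hA.pos _
  have hαA : ∀ ω, α ω ≤ A := fun ω => hα ω ▸ stepsize_le hA.pos _
  -- The slack factor is random but known from the past, so it is absorbed into the weight.
  set u : Ω → ℝ := fun ω => w ω * slack (L ^ 2 * τb) A (α ω) with hu
  have hslack : ∀ ω, 0 ≤ slack (L ^ 2 * τb) A (α ω) ∧
      slack (L ^ 2 * τb) A (α ω) ≤ 1 + L ^ 2 * τb + κ := fun ω => by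
    have h0 := (hα0 ω).le
    have h1 : L ^ 2 * τb * α ω ≤ L ^ 2 * τb :=
      mul_le_of_le_one_right hτ0 ((hαA ω).trans hA.le_one)
    have h2 : κ * A ^ 2 ≤ κ := mul_le_of_le_one_right hκ0 (pow_le_one₀ hA.pos.le hA.le_one)
    rw [slack, ← hκ]
    exact ⟨by positivity, by linarith⟩
  have hum : Measurable[𝓂] u := by
    unfold slack at hu
    exact hw.mul (((hαm.const_mul _).const_add _).add_const _)
  have hu0 : ∀ ω, 0 ≤ u ω := fun ω => mul_nonneg (hw0 ω) (hslack ω).1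
  have huw : ∀ ω, u ω ≤ (1 + L ^ 2 * τb + κ) * w ω := fun ω => by
    rw [mul_comm]; exact mul_le_mul_of_nonneg_left (hslack ω).2 (hw0 ω)
  have hwint : Integrable w Prob :=
    (integrable_const (1 : ℝ)).mono' (hw.mono hle le_rfl).aestronglyMeasurable
      (Eventually.of_forall fun ω => by rw [Real.norm_of_nonneg (hw0 ω)]; exact hw1 ω)
  have hdom : ∀ {k : Ω → ℝ}, Measurable[𝓂] k → (∀ ω, 0 ≤ k ω) →
      Integrable (fun ω => w ω * k ω) Prob → Integrable (fun ω => u ω * k ω) Prob := by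
    intro k hk hk0 hki
    refine (hki.const_mul (1 + L ^ 2 * τb + κ)).mono'
      ((hum.mul hk).mono hle le_rfl).aestronglyMeasurable (Eventually.of_forall fun ω => ?_)
    rw [Real.norm_of_nonneg (mul_nonneg (hu0 ω) (hk0 ω)), ← mul_assoc]
    exact mul_le_mul_of_nonneg_right (huw ω) (hk0 ω)
  -- Since `Q ≥ 0`, the distance term is at most `2 / ρ` times the envelope gap, whose weighted
  -- integrability is assumed.
  have hwD : Integrable (fun ω => w ω * D ω) Prob := by
    refine (hint.const_mul (2 / ρ)).mono' ((hw.mul hDm).mono hle le_rfl).aestronglyMeasurable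
      (Eventually.of_forall fun ω => ?_)
    rw [Real.norm_of_nonneg (mul_nonneg (hw0 ω) (hD0 ω))]
    have h1 : 0 ≤ 2 / ρ * (w ω * Q ω) :=
      mul_nonneg (by positivity) (mul_nonneg (hw0 ω) (hQ0 ω))
    have h2 : 2 / ρ * (w ω * (Q ω + ρ / 2 * D ω)) = 2 / ρ * (w ω * Q ω) + w ω * D ω := by
      field_simp
    linarith
  have hwQ : Integrable (fun ω => w ω * Q ω) Prob :=
    (hint.sub (hwD.const_mul (ρ / 2))).congr (Eventually.of_forall fun ω => by
      simp only [Pi.sub_apply]; ring)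
  have hwαD : Integrable (fun ω => w ω * (α ω * D ω)) Prob := by
    refine (hwD.const_mul A).mono' ((hw.mul (hαm.mul hDm)).mono hle le_rfl).aestronglyMeasurable
      (Eventually.of_forall fun ω => ?_)
    rw [Real.norm_of_nonneg (mul_nonneg (hw0 ω) (mul_nonneg (hα0 ω).le (hD0 ω)))]
    have := mul_le_mul_of_nonneg_left
      (mul_le_mul_of_nonneg_right (hαA ω) (hD0 ω)) (hw0 ω)
    linarith
  have huint : Integrable u Prob := by
    have := hdom (k := fun _ => 1) measurable_const (fun _ => zero_le_one) (by simpa using hwint)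
    simpa using this
  have huD := hdom hDm hD0 hwD
  have huαD : Integrable (fun ω => u ω * (α ω * D ω)) Prob := hdom (hαm.mul hDm) (fun ω => mul_nonneg (hα0 ω).le (hD0 ω)) hwαD
  have hnorm : ∀ ω, ‖y ω - x ω‖ ^ 2 ≤ L ^ 2 * D ω := fun ω => (hN ω).lower _
  have hnm : Measurable[𝓂] fun ω => ‖y ω - x ω‖ ^ 2 :=
    (measurable_norm.comp (hym.sub hxm)).pow_const 2
  have hun : Integrable (fun ω => u ω * ‖y ω - x ω‖ ^ 2) Prob := by
    refine (huD.const_mul (L ^ 2)).mono' ((hum.mul hnm).mono hle le_rfl).aestronglyMeasurable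
      (Eventually.of_forall fun ω => ?_)
    rw [Real.norm_of_nonneg (mul_nonneg (hu0 ω) (sq_nonneg _))]
    have := mul_le_mul_of_nonneg_left (hnorm ω) (hu0 ω)
    linarith
  obtain ⟨i₁, l₁⟩ := integral_quad_le_of_condExp_le hle hμ hL hM hN hMm hNm hcond
    (hym.sub hxm) hum hu0 hun
  obtain ⟨i₂, l₂⟩ := h.expected_model_le hm hle hS hlaw hind hxV hyV hxm hym hA.pos hum hu0
    huint hun
  simp only [← hα] at i₂ l₂
  obtain ⟨i₃, l₃⟩ := h.expected_lipschitz_sq hm hle hS hlaw hind hum hu0 huint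
    (2 * (∫ s, (Lf s : ℝ) ∂P) ^ 2)
  have l₂' : ∫ ω, u ω * (α ω * (ηb / 2 * ‖y ω - x ω‖ ^ 2)) ∂Prob ≤
      ∫ ω, L ^ 2 * ηb / 2 * (u ω * (α ω * D ω)) ∂Prob := by
    have hpt : ∀ ω, u ω * (α ω * (ηb / 2 * ‖y ω - x ω‖ ^ 2)) ≤
        L ^ 2 * ηb / 2 * (u ω * (α ω * D ω)) := fun ω => by
      have h1 := mul_le_mul_of_nonneg_left (hnorm ω) (by linarith [h.η_nonneg] : 0 ≤ ηb / 2)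
      have h2 := mul_le_mul_of_nonneg_left h1 (mul_nonneg (hu0 ω) (hα0 ω).le)
      linarith
    exact integral_mono_of_nonneg (Eventually.of_forall fun ω => mul_nonneg (hu0 ω)
      (mul_nonneg (hα0 ω).le (mul_nonneg (by linarith [h.η_nonneg]) (sq_nonneg _))))
      (huαD.const_mul _) (Eventually.of_forall hpt)
  set f₀ : Ω → ℝ := fun ω => w ω * Q ω + (-(ρ / 2 * ρ)) * (u ω * (α ω * D ω)) +
    ρ / 2 * (2 * γ ^ 2 * A ^ 2) * w ω with hf₀
  have i₀ : Integrable f₀ Prob := (hwQ.add (huαD.const_mul _)).add (hwint.const_mul _)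
  have hcomb := integral_add_three_le (a₁ := ρ / 2) (a₂ := ρ) (a₃ := ρ * A ^ 2 * L ^ 2)
    (by positivity) hρ0.le (by positivity) i₀ i₁ i₂ i₃ (huD.const_mul c)
    (huαD.const_mul (L ^ 2 * ηb / 2)) (huint.mul_const _) l₁ (l₂.trans l₂') l₃.le
  have hgoodS : ∀ᵐ ω ∂Prob, ∀ i, GoodSample fm V C R ηb τb G Lf (S i ω) :=
    ae_all_iff.2 fun i => ae_of_ae_map (hS i).aemeasurable ((hlaw i).symm ▸ h.good)
  have hpath : ∀ᵐ ω ∂Prob, w ω * (env C g ρ (M ω) (x' ω) - m₀) ≤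
      f₀ ω + ρ / 2 * (u ω * quad (M ω) (y ω - x ω)) + ρ * (u ω * (α ω * ((1 / (m : ℝ)) *
        ∑ i, (fm (x ω) (y ω) (S i ω) - fm (x ω) (x ω) (S i ω)) - (F (y ω) - F (x ω))))) +
      ρ * A ^ 2 * L ^ 2 * (u ω * (2 * ((1 / (m : ℝ)) * ∑ i, (Lf (S i ω) : ℝ) ^ 2) +
        2 * (∫ s, (Lf s : ℝ) ∂P) ^ 2)) := by
    filter_upwards [hgoodS, hstep] with ω hs hst
    have h1 := h.step_pathwise (m₀ := m₀) hm hμ hL hρ' hA hγ hr (hM ω) (hN ω) hs (hxV ω)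
      (hα ω) (rfl : y ω = _) hst
    have h2 := mul_le_mul_of_nonneg_left h1 (hw0 ω)
    refine h2.trans_eq ?_
    simp only [hf₀, hu, hQ, hD, hg]
    ring
  have hV'0 : ∀ ω, 0 ≤ w ω * (env C g ρ (M ω) (x' ω) - m₀) := fun ω => by
    refine mul_nonneg (hw0 ω) (sub_nonneg.2 ?_)
    have h1 := hm₀ _ (hreg.proxPt_spec (hM ω) (x' ω)).1
    have h2 := (hM ω).quad_nonneg hL (proxPt C g ρ (M ω) (x' ω) - x' ω)
    have h3 : 0 ≤ ρ / 2 * quad (M ω) (proxPt C g ρ (M ω) (x' ω) - x' ω) := by positivity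
    unfold env
    linarith
  have iUB := ((i₀.add (i₁.const_mul (ρ / 2))).add (i₂.const_mul ρ)).add
    (i₃.const_mul (ρ * A ^ 2 * L ^ 2))
  have hV'm : Measurable fun ω => w ω * (env C g ρ (M ω) (x' ω) - m₀) :=
    (hw.mono hle le_rfl).mul ((hreg.measurable_env hgm hM hMm hxm').sub_const _)
  -- Integrability of the new value is not assumed: it is nonnegative and dominated by the
  -- integrable pathwise bound.
  refine ⟨?_, hwαD, ?_⟩
  · refine iUB.mono' hV'm.aestronglyMeasurable ?_
    filter_upwards [hpath] with ω hω
    rw [Real.norm_of_nonneg (hV'0 ω)]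
    exact hω
  · refine (integral_mono_of_nonneg (Eventually.of_forall hV'0) iUB hpath).trans
      (hcomb.trans ?_)
    refine integral_mono (((i₀.add ((huD.const_mul c).const_mul (ρ / 2))).add
      ((huαD.const_mul (L ^ 2 * ηb / 2)).const_mul ρ)).add
      ((huint.mul_const _).const_mul (ρ * A ^ 2 * L ^ 2))) ?_ fun ω => ?_
    · have : Integrable (fun ω => (1 + (c - 1 + κ * B * A ^ 2)) * (w ω * (Q ω + ρ / 2 * D ω)) -
          ρ / 2 * (ρ - B * (L ^ 2 * ηb + L ^ 2 * τb)) * (w ω * (α ω * D ω)) +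
          ρ / 2 * ((1 + L ^ 2 * τb + κ) * E + 2 * γ ^ 2) * A ^ 2 * w ω) Prob :=
        ((hint.const_mul _).sub (hwαD.const_mul _)).add (hwint.const_mul _)
      refine this.congr (Eventually.of_forall fun ω => ?_)
      simp only
      ring
    · have hE0 : 0 ≤ E := by
        rw [hE]
        have : 0 ≤ ∫ s, (Lf s : ℝ) ^ 2 ∂P := integral_nonneg fun s => sq_nonneg _
        positivity
      have h1 := drift_bound (γ := γ) (hα0 ω).le (hαA ω) hA.le_one hτ0 hη0 hB hcB hc1 hρ (hD0 ω)
        (hQ0 ω) hE0 hκ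
      have h2 := mul_le_mul_of_nonneg_left h1 (hw0 ω)
      refine le_trans (le_of_eq ?_) h2
      simp only [hf₀, hu, hE]
      ring

end OneStep

end IspPPA

namespace IspPPA

/-! ### Independence of the new samples from the past -/

section Samples

variable {m : ℕ} {𝒮 Ω : Type*} [MeasurableSpace 𝒮] {S : ℕ → Fin m → Ω → 𝒮}

lemma sampleFiltration_mono : Monotone (sampleFiltration S) := fun _ _ h =>
  biSup_mono fun _ hi => Finset.Icc_subset_Icc_right h hi

variable [mΩ : MeasurableSpace Ω] {Prob : Measure Ω} {P : Measure 𝒮}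

lemma IIDSamples.sampleFiltration_le (hS : IIDSamples Prob P S) (k : ℕ) :
    sampleFiltration S k ≤ mΩ :=
  iSup₂_le fun j hj => iSup_le fun i =>
    (hS.measurable j (Finset.mem_Icc.1 hj).1 i).comap_le

/-- The two σ-algebras are generated by disjoint index blocks of an independent family. -/
lemma IIDSamples.indep_sampleFiltration (hS : IIDSamples Prob P S) (k : ℕ) (i : Fin m) :
    Indep (sampleFiltration S k) (MeasurableSpace.comap (S (k + 1) i) inferInstance) Prob := by
  set T : Set (ℕ+ × Fin m) := {q | (q.1 : ℕ) ≤ k} with hT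
  set U : Set (ℕ+ × Fin m) := {(⟨k + 1, Nat.succ_pos k⟩, i)} with hU
  have hdis : Disjoint T U := by
    rw [hU, Set.disjoint_singleton_right, hT]
    simp
  have h1 := indep_iSup_of_disjoint
    (fun q : ℕ+ × Fin m => (hS.measurable q.1 q.1.2 q.2).comap_le) hS.indep hdis
  refine indep_of_indep_of_le_left (indep_of_indep_of_le_right h1 ?_) ?_
  · exact le_iSup₂_of_le (⟨k + 1, Nat.succ_pos k⟩, i) rfl le_rfl
  · refine iSup₂_le fun j hj => iSup_le fun i' => ?_
    have hj' := Finset.mem_Icc.1 hj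
    exact le_iSup₂_of_le (f := fun (q : ℕ+ × Fin m) (_ : q ∈ T) =>
      MeasurableSpace.comap (S q.1 q.2) inferInstance) (⟨j, hj'.1⟩, i') hj'.2 le_rfl

end Samples

/-! ### Boundedness and summability along the iterates -/

section Convergence

lemma one_add_sum_sub_one_le_prod {ρ : ℕ → ℝ} (h : ∀ k, 1 ≤ ρ k) (n : ℕ) :
    1 + ∑ i ∈ Finset.range n, (ρ i - 1) ≤ ∏ i ∈ Finset.range n, ρ i := by
  induction n with
  | zero => simp
  | succ n ih =>
    rw [Finset.sum_range_succ, Finset.prod_range_succ]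
    have h0 : 0 ≤ ∑ i ∈ Finset.range n, (ρ i - 1) :=
      Finset.sum_nonneg fun i _ => by linarith [h i]
    have h1 := h n
    nlinarith

/-- Consequences of the convergence of the product of the constants `ρ k`. -/
lemma summable_sq_sub_one_of_prod {ρ : ℕ → ℝ} (h : ∀ k, 1 ≤ ρ k) {ν : ℝ}
    (hν : Tendsto (fun k => ∏ i ∈ Finset.range k, ρ i) atTop (𝓝 ν)) :
    (∀ k, ρ k ≤ ν) ∧ Summable fun k => ρ k ^ 2 - 1 := by
  have hp1 : ∀ n, 1 ≤ ∏ i ∈ Finset.range n, ρ i := fun n =>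
    Finset.prod_induction _ (1 ≤ ·) (fun _ _ => one_le_mul_of_one_le_of_one_le) le_rfl
      fun j _ => h j
  have hmono : Monotone fun k => ∏ i ∈ Finset.range k, ρ i := monotone_nat_of_le_succ fun n => by
    rw [Finset.prod_range_succ]
    exact le_mul_of_one_le_right (zero_le_one.trans (hp1 n)) (h n)
  have hle : ∀ n, ∏ i ∈ Finset.range n, ρ i ≤ ν := fun n => hmono.ge_of_tendsto hν n
  have hρν : ∀ k, ρ k ≤ ν := fun k => by
    refine le_trans ?_ (hle (k + 1))
    rw [Finset.prod_range_succ]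
    exact le_mul_of_one_le_left (zero_le_one.trans (h k)) (hp1 k)
  refine ⟨hρν, ?_⟩
  have hs : Summable fun k => ρ k - 1 :=
    summable_of_sum_range_le (c := ν - 1) (fun k => by linarith [h k]) fun n => by
      linarith [one_add_sum_sub_one_le_prod h n, hle n]
  -- Factor `ρ² - 1 = (ρ + 1)(ρ - 1)` and use `ρ ≤ ν`.
  refine Summable.of_nonneg_of_le (fun k => ?_) (fun k => ?_) (hs.mul_left (ν + 1))
  · nlinarith [h k]
  · nlinarith [h k, hρν k]

variable {d m : ℕ} {𝒮 Ω : Type*} [MeasurableSpace 𝒮] [mΩ : MeasurableSpace Ω]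
  {P : Measure 𝒮} [IsProbabilityMeasure P] {Prob : Measure Ω} [IsProbabilityMeasure Prob]
  {fm : Vec d → Vec d → 𝒮 → ℝ} {V C : Set (Vec d)} {R F : Vec d → ℝ} {ηb τb : ℝ}
  {G : NNReal → NNReal} {Lf : 𝒮 → NNReal} {S : ℕ → Fin m → Ω → 𝒮}

/-- Square summability forces `A k → 0`, so the descent inequality is available from some index `j`
on, which suffices for asymptotic claims. -/
lemma eventually_smallStep {ηb τb ρ μ L : ℝ} {A : ℕ → ℝ} (hA0 : ∀ k, 0 < A k)
    (hA : Summable fun k => A k ^ 2) : ∃ j, ∀ n, SmallStep ηb τb ρ μ L (A (n + j)) := by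
  have h0 : Tendsto A atTop (𝓝 0) := by
    have h1 := (Real.continuous_sqrt.tendsto 0).comp hA.tendsto_atTop_zero
    rw [Real.sqrt_zero] at h1
    exact h1.congr fun k => Real.sqrt_sq (hA0 k).le
  have e1 : ∀ᶠ k in atTop, A k ≤ 1 := h0.eventually (ge_mem_nhds zero_lt_one)
  have e2 : ∀ᶠ k in atTop, L ^ 2 * τb * A k ≤ 1 / 2 := by
    have := h0.const_mul (L ^ 2 * τb)
    rw [mul_zero] at this
    exact this.eventually (ge_mem_nhds (by norm_num))
  have e3 : ∀ᶠ k in atTop, A k * (ρ * (L ^ 2 / μ ^ 2) + L ^ 2 * ηb) ≤ 1 / 2 := by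
    have := h0.mul_const (ρ * (L ^ 2 / μ ^ 2) + L ^ 2 * ηb)
    rw [zero_mul] at this
    exact this.eventually (ge_mem_nhds (by norm_num))
  obtain ⟨j, hj⟩ := eventually_atTop.1 (e1.and (e2.and e3))
  exact ⟨j, fun n => ⟨hA0 _, (hj _ (Nat.le_add_left _ _)).1, (hj _ (Nat.le_add_left _ _)).2.1,
    (hj _ (Nat.le_add_left _ _)).2.2⟩⟩

set_option maxHeartbeats 1000000 in
/-- Along the iterates the Moreau envelope stays bounded and the weighted squared distances to the
proximal points are summable. Here `A k` and `x k` belong to the `(k + 1)`-st iteration. -/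
theorem ModelCore.bounded_and_summable (h : ModelCore P fm V C R F ηb τb G Lf) (hm : 0 < m)
    (hS : IIDSamples Prob P S) {μ L ρ γ m₀ B : ℝ} (hμ : 0 < μ) (hL : 0 < L) (hγ : 0 ≤ γ)
    (hB : 1 ≤ B) (hρ : B * (L ^ 2 * ηb + L ^ 2 * τb) < ρ) {c : ℕ → ℝ} (hc1 : ∀ k, 1 ≤ c k)
    (hcB : ∀ k, c k ≤ B) (hc : Summable fun k => c k - 1) {A : ℕ → ℝ} (hA0 : ∀ k, 0 < A k)
    (hA : Summable fun k => A k ^ 2) {r : Vec d → EReal} (hr : Represents r C R)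
    (hm₀ : ∀ y ∈ C, m₀ ≤ F y + R y) {M : ℕ → Ω → Vec d →L[ℝ] Vec d}
    (hM : ∀ k ω, IsMetric μ L (M k ω)) (hMm : ∀ k, Measurable[sampleFiltration S k] (M k))
    (hcond : ∀ k z, z ≠ 0 → ∀ᵐ ω ∂Prob,
      (Prob[fun ω' => quad (M (k + 1) ω') z / quad (M k ω') z | sampleFiltration S k]) ω ≤ c k)
    {x : ℕ → Ω → Vec d} (hxV : ∀ k ω, x k ω ∈ V)
    (hxm : ∀ k, Measurable[sampleFiltration S k] (x k)) {α : ℕ → Ω → ℝ}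
    (hα : ∀ k ω, α k ω = stepsize G (A k) (x k ω))
    (hstep : ∀ᵐ ω ∂Prob, ∀ k,
      CriterionA (M (k + 1) ω) (α k ω) (γ * α k ω ^ 2)
        (minibatchComposite fm r (x k ω) fun i => S (k + 1) i ω) (x k ω) (x (k + 1) ω) ∨
      CriterionB (L ^ 2 * τb) (M (k + 1) ω) (α k ω) (γ * α k ω ^ 2)
        (minibatchComposite fm r (x k ω) fun i => S (k + 1) i ω) (x k ω) (x (k + 1) ω) ∨
      CriterionC (L ^ 2 * τb) (M (k + 1) ω) (α k ω) (γ * α k ω ^ 2)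
        (minibatchComposite fm r (x k ω) fun i => S (k + 1) i ω) (x k ω) (x (k + 1) ω)) :
    ∃ j, ∀ᵐ ω ∂Prob,
      BddAbove (Set.range fun n =>
        env C (fun y => F y + R y) ρ (M (n + j) ω) (x (n + j) ω) - m₀) ∧
      Summable fun n => α (n + j) ω * quad (M (n + j) ω)
        (proxPt C (fun y => F y + R y) ρ (M (n + j) ω) (x (n + j) ω) - x (n + j) ω) := by
  obtain ⟨j, hj⟩ := eventually_smallStep (ηb := ηb) (τb := τb) (ρ := ρ) (μ := μ) (L := L) hA0 hA
  refine ⟨j, ?_⟩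
  have hη0 : 0 ≤ L ^ 2 * ηb := mul_nonneg (sq_nonneg _) h.η_nonneg
  have hτ0 : 0 ≤ L ^ 2 * τb := mul_nonneg (sq_nonneg _) h.τ_nonneg
  have hρ' : L ^ 2 * (ηb + τb) < ρ := by
    have : L ^ 2 * ηb + L ^ 2 * τb ≤ B * (L ^ 2 * ηb + L ^ 2 * τb) :=
      le_mul_of_one_le_left (add_nonneg hη0 hτ0) hB
    linarith
  have hreg := h.proxRegular hμ hL hρ'
  have hρ0 := hreg.ρ_pos
  set g : Vec d → ℝ := fun y => F y + R y with hg
  have hgm : Measurable g := h.continuousF.measurable.add h.measurableR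
  set W : ℕ → Ω → ℝ := fun k ω => env C g ρ (M k ω) (x k ω) - m₀ with hW
  set D : ℕ → Ω → ℝ := fun k ω => quad (M k ω) (proxPt C g ρ (M k ω) (x k ω) - x k ω) with hD
  have hWm : ∀ k, Measurable[sampleFiltration S k] (W k) := fun k =>
    (@ProxRegular.measurable_env _ _ _ _ _ _ _ hreg hgm _ (sampleFiltration S k) _ _
      (hM k) (hMm k) (hxm k)).sub_const _
  have hDm : ∀ k, Measurable[sampleFiltration S k] (D k) := fun k =>
    continuous_quad_uncurry.measurable.comp ((hMm k).prodMk
      ((@ProxRegular.measurable_proxPt _ _ _ _ _ _ _ hreg _ (sampleFiltration S k) _ _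
        (hM k) (hMm k) (hxm k)).sub (hxm k)))
  have hαm : ∀ k, Measurable[sampleFiltration S k] (α k) := fun k => by
    have : α k = fun ω => stepsize G (A k) (x k ω) := funext (hα k)
    rw [this]
    exact @measurable_stepsize _ _ h.monotone _ (sampleFiltration S k) _ (hxm k) (A k)
  have hα0 : ∀ k ω, 0 < α k ω := fun k ω => hα k ω ▸ stepsize_pos (hA0 k) _
  have hD0 : ∀ k ω, 0 ≤ D k ω := fun k ω => (hM k ω).quad_nonneg hL _
  have hW0 : ∀ k ω, 0 ≤ W k ω := fun k ω => by
    have h1 := hm₀ _ (hreg.proxPt_spec (hM k ω) (x k ω)).1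
    have h2 : 0 ≤ ρ / 2 * D k ω := mul_nonneg (by positivity) (hD0 k ω)
    simp only [hW, env, hg, hD] at h2 ⊢
    linarith
  set κ : ℝ := 1 + L ^ 2 * τb + 4 * (L ^ 2 * τb) ^ 2 with hκ
  set E : ℝ := 2 * L ^ 2 * (2 * (∫ s, (Lf s : ℝ) ^ 2 ∂P) + 2 * (∫ s, (Lf s : ℝ) ∂P) ^ 2) with hE
  have hE0 : 0 ≤ E := by
    have : 0 ≤ ∫ s, (Lf s : ℝ) ^ 2 ∂P := integral_nonneg fun s => sq_nonneg _
    positivity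
  set δ : ℝ := ρ / 2 * (ρ - B * (L ^ 2 * ηb + L ^ 2 * τb)) with hδ
  have hδ0 : 0 < δ := mul_pos (by positivity) (by linarith)
  set β : ℝ := ρ / 2 * ((1 + L ^ 2 * τb + κ) * E + 2 * γ ^ 2) with hβ
  have hβ0 : 0 ≤ β := by positivity
  -- The first `j` steps give no control on the expectation of `W j`. This positive weight, known at
  -- time `j`, makes `w₀ * W j ≤ 1` integrable and can be divided out pathwise at the end.
  set w₀ : Ω → ℝ := fun ω => (1 + W j ω)⁻¹ with hw₀
  have hw₀m : Measurable[sampleFiltration S j] w₀ := ((hWm j).const_add 1).inv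
  have hw₀0 : ∀ ω, 0 < w₀ ω := fun ω => inv_pos.2 (by linarith [hW0 j ω])
  have hw₀1 : ∀ ω, w₀ ω ≤ 1 := fun ω => inv_le_one_of_one_le₀ (by linarith [hW0 j ω])
  set ℱ : Filtration ℕ mΩ :=
    { seq := fun n => sampleFiltration S (n + j)
      mono' := fun _ _ hn => sampleFiltration_mono (Nat.add_le_add_right hn j)
      le' := fun n => hS.sampleFiltration_le _ } with hℱ
  have hw₀n : ∀ n, Measurable[sampleFiltration S (n + j)] w₀ := fun n =>
    hw₀m.mono (sampleFiltration_mono (Nat.le_add_left j n)) le_rfl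
  -- The weight stays free: `w₀` propagates integrability, and indicators times `w₀` give the
  -- set-integral form of the conditional inequality.
  have hone := fun (n : ℕ) {w : Ω → ℝ} (hw : Measurable[sampleFiltration S (n + j)] w)
      (hw0 : ∀ ω, 0 ≤ w ω) (hw1 : ∀ ω, w ω ≤ 1)
      (hint : Integrable (fun ω => w ω * W (n + j) ω) Prob) =>
    h.expected_step (S := S (n + j + 1)) (x := x (n + j)) (x' := x (n + 1 + j)) hm
      (hS.sampleFiltration_le (n + j)) (hS.measurable _ (Nat.le_add_left 1 _))
      (hS.law _ (Nat.le_add_left 1 _)) (hS.indep_sampleFiltration (n + j)) hμ hL (hj n) hγ hB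
      (hcB (n + j)) (hc1 (n + j)) hρ hκ hE hr hm₀ (hM (n + 1 + j)) (hM (n + j))
      ((hMm (n + 1 + j)).mono (hS.sampleFiltration_le _) le_rfl) (hMm (n + j))
      (by rw [Nat.add_right_comm]; exact hcond (n + j)) (hxV (n + j)) (hxm (n + j))
      ((hxm (n + 1 + j)).mono (hS.sampleFiltration_le _) le_rfl) (hα (n + j))
      (by rw [Nat.add_right_comm]; filter_upwards [hstep] with ω hω using hω (n + j))
      hw hw0 hw1 hint
  have hRS := robbins_siegmund (Prob := Prob) ℱ (V := fun n ω => w₀ ω * W (n + j) ω)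
    (Z := fun n ω => δ * (w₀ ω * (α (n + j) ω * D (n + j) ω)))
    (a := fun n => c (n + j) - 1 + κ * B * A (n + j) ^ 2) (b := fun n => β * A (n + j) ^ 2)
    (fun n => (hw₀n n).mul (hWm _))
    (fun n => ((hw₀n n).mul ((hαm _).mul (hDm _))).const_mul _)
    (fun n ω => mul_nonneg (hw₀0 ω).le (hW0 _ ω))
    (fun n ω => mul_nonneg hδ0.le
      (mul_nonneg (hw₀0 ω).le (mul_nonneg (hα0 _ ω).le (hD0 _ ω))))
    (fun n => add_nonneg (by linarith [hc1 (n + j)])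
      (mul_nonneg (mul_nonneg (by positivity) (by linarith)) (sq_nonneg _)))
    (fun n => mul_nonneg hβ0 (sq_nonneg _))
    (((summable_nat_add_iff j).2 hc).add (((summable_nat_add_iff j).2 hA).mul_left _))
    (((summable_nat_add_iff j).2 hA).mul_left _)
    ?_ ?_ ?_
  · filter_upwards [hRS] with ω hω
    obtain ⟨⟨b, hb⟩, hsum⟩ := hω
    refine ⟨⟨b / w₀ ω, ?_⟩, ?_⟩
    · rintro _ ⟨n, rfl⟩
      rw [le_div_iff₀' (hw₀0 ω)]
      exact hb ⟨n, rfl⟩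
    · refine (hsum.mul_left (δ * w₀ ω)⁻¹).congr fun n => ?_
      have := (hw₀0 ω).ne'
      field_simp
      rfl
  · refine (integrable_const (1 : ℝ)).mono'
      (((hw₀n 0).mul (hWm _)).mono (hS.sampleFiltration_le _) le_rfl).aestronglyMeasurable
      (Eventually.of_forall fun ω => ?_)
    rw [Real.norm_of_nonneg (mul_nonneg (hw₀0 ω).le (hW0 _ ω)), zero_add, inv_mul_eq_div]
    exact div_le_one_of_le₀ (by linarith) (by linarith [hW0 j ω])
  · intro n hn
    obtain ⟨i1, i2, -⟩ := hone n (hw₀n n) (fun ω => (hw₀0 ω).le) hw₀1 hn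
    exact ⟨i1, i2.const_mul δ⟩
  · intro n hn s hs
    have hs' : MeasurableSet s := hS.sampleFiltration_le _ _ hs
    obtain ⟨i1, i2, -⟩ := hone n (hw₀n n) (fun ω => (hw₀0 ω).le) hw₀1 hn
    have hind : ∀ k : Ω → ℝ, (fun ω => s.indicator w₀ ω * k ω) =
        s.indicator fun ω => w₀ ω * k ω := fun k => by
      ext ω
      by_cases hω : ω ∈ s <;> simp [hω]
    obtain ⟨-, -, h3⟩ := hone n (w := s.indicator w₀) ((hw₀n n).indicator hs)
      (fun ω => Set.indicator_nonneg (fun ω _ => (hw₀0 ω).le) ω)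
      (fun ω => Set.indicator_le' (fun ω _ => hw₀1 ω) (fun _ _ => zero_le_one) ω)
      (by rw [hind]; exact hn.indicator hs')
    rw [hind, hind, integral_indicator hs', integral_indicator hs'] at h3
    refine h3.trans ?_
    have hwint : Integrable w₀ Prob :=
      (integrable_const (1 : ℝ)).mono'
        ((hw₀n 0).mono (hS.sampleFiltration_le _) le_rfl).aestronglyMeasurable
        (Eventually.of_forall fun ω => by
          rw [Real.norm_of_nonneg (hw₀0 ω).le]; exact hw₀1 ω)
    have j1 := ((hn.const_mul (1 + (c (n + j) - 1 + κ * B * A (n + j) ^ 2))).sub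
      (i2.const_mul δ))
    -- As `w₀ ≤ 1`, the weighted noise is bounded by the deterministic `β * A (n + j) ^ 2`.
    refine integral_mono_ae (Integrable.integrableOn ?_) (Integrable.integrableOn ?_)
      (Eventually.of_forall fun ω => ?_)
    · refine (j1.add (hwint.const_mul (β * A (n + j) ^ 2))).congr
        (Eventually.of_forall fun ω => ?_)
      simp only [Pi.add_apply, Pi.sub_apply, hβ, hδ, hW]
      ring
    · exact j1.add (integrable_const _)
    · have h4 := mul_le_mul_of_nonneg_right (hw₀1 ω) (mul_nonneg hβ0 (sq_nonneg (A (n + j))))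
      simp only [hβ, hδ, hW, hD] at h4 ⊢
      linarith

end Convergence

end IspPPA

namespace IspPPA

/-! ### Translation of the assumptions -/

section Assumptions

variable {d : ℕ} {𝒮 : Type*} [MeasurableSpace 𝒮] {P : Measure 𝒮} [IsProbabilityMeasure P]
  {f : Vec d → 𝒮 → EReal} {r : Vec d → EReal} {fm : Vec d → Vec d → 𝒮 → ℝ} {V : Set (Vec d)}
  {ηbar τbar : ℝ} {G : NNReal → NNReal}

lemma represents_toReal (hr : ∀ y, r y ≠ ⊥) :
    Represents r {y | r y ≠ ⊤} (fun y => (r y).toReal) :=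
  ⟨fun y hy => (EReal.coe_toReal hy (hr y)).symm, fun y hy => by simpa using hy⟩

lemma Represents.const_add {C : Set (Vec d)} {R : Vec d → ℝ} (h : Represents r C R)
    (k : Vec d → ℝ) : Represents (fun y => (k y : EReal) + r y) C (fun y => k y + R y) := by
  refine ⟨fun y hy => ?_, fun y hy => ?_⟩
  · simp only [h.1 y hy]
    exact (EReal.coe_add _ _).symm
  · simp only [h.2 y hy]
    exact EReal.coe_add_top _

/-- The assumptions of the theorem provide the real-valued model assumptions. -/
lemma exists_modelCore [Nontrivial (Vec d)] (hModel : ModelAssumption P f r fm V ηbar)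
    (hReg : RegularityAssumption P f r fm V τbar) (hLip : GrowthLipschitzAssumption P fm V G) :
    ∃ Lf : 𝒮 → NNReal, ModelCore P fm V {y | r y ≠ ⊤} (fun y => (r y).toReal)
      (expectedCost P f) ηbar τbar G Lf := by
  obtain ⟨Lf, -, hLm, hLi, -, hL⟩ := hLip.lipschitz
  have hrep := represents_toReal hReg.proper_r.1
  have hmod : ∀ᵐ s ∂P, ∀ x ∈ V, ∀ y ∈ V, f x s = (fm x x s : EReal) ∧
      |fm x y s - fm y y s| ≤ ηbar / 2 * ‖y - x‖ ^ 2 := by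
    filter_upwards [hModel.model] with s hs x hx y hy
    obtain ⟨h1, h2, h3⟩ := hs x hx y hy
    rw [← (hs y hy y hy).1] at h2 h3
    refine ⟨h1.symm, abs_le.2 ⟨?_, ?_⟩⟩
    · have : fm y y s - fm x y s ≤ ηbar / 2 * ‖y - x‖ ^ 2 := by exact_mod_cast h3
      linarith
    · exact_mod_cast h2
  have hfx : ∀ x ∈ V, (fun s => (f x s).toReal) =ᵐ[P] fun s => fm x x s := by
    intro x hx
    filter_upwards [hmod] with s hs
    rw [(hs x hx x hx).1, EReal.toReal_coe]
  obtain ⟨x₀, hx₀⟩ := hReg.proper_r.2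
  refine ⟨Lf, ?_⟩
  exact
    { isOpen := hModel.isOpen
      subset := hModel.dom_subset
      nonempty := ⟨x₀, hx₀⟩
      closedOn := hrep.closedOn hReg.closed_r
      measurableR := hReg.closed_r.measurable.ereal_toReal
      continuousF := hReg.locallyLipschitz.continuous
      measurable := hModel.measurable
      good := by
        filter_upwards [hmod, hL, hReg.weaklyConvex] with s h1 h2 h3
        have h4 : ∀ x, Represents (modelComposite fm r x s) {y | r y ≠ ⊤}
            (fun y => fm x y s + (r y).toReal) := fun x => hrep.const_add fun y => fm x y s
        exact ⟨fun x hx y hy => (h1 x hx y hy).2, h2,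
          fun x hx => (h4 x).modulusConvexOn (h3 x hx),
          fun x hx => (h4 x).closedOn_of_weaklyConvex (h3 x hx)⟩
      -- In positive dimension the open set `V` contains a point other than `x₀`; the model bound
      -- there is nonnegative, which forces the sign of `ηbar`.
      η_nonneg := by
        have hV : V ∈ 𝓝 x₀ := hModel.isOpen.mem_nhds (hModel.dom_subset hx₀)
        have hV' : ∀ᶠ y in 𝓝[≠] x₀, y ∈ V := eventually_nhdsWithin_of_eventually_nhds hV
        obtain ⟨y, hyV, hy⟩ := (hV'.and eventually_mem_nhdsWithin).exists
        obtain ⟨s, hs⟩ := hmod.exists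
        have h1 := (abs_nonneg _).trans (hs x₀ (hModel.dom_subset hx₀) y hyV).2
        have h2 : 0 < ‖y - x₀‖ ^ 2 := by
          have := norm_pos_iff.2 (sub_ne_zero.2 hy)
          positivity
        linarith [nonneg_of_mul_nonneg_left h1 h2]
      τ_nonneg := hReg.nonneg
      monotone := hLip.monotone
      measurableL := hLm
      integrableL := hLi
      integrable := fun x hx => (hReg.finite x).2.congr (hfx x hx)
      integral_eq := fun x hx => (integral_congr_ae (hfx x hx)).symm }

variable {m : ℕ} {Ω : Type*} [MeasurableSpace Ω] {Prob : Measure Ω} {S : ℕ → Fin m → Ω → 𝒮}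
  {M : ℕ → Ω → Vec d →L[ℝ] Vec d} {μinf Linf : ℝ} {ρ : ℕ → ℝ}

/-- The bounds depending on `k` are weakened to the uniform constants, and `μinf ≤ 1 ≤ Linf` admits
the identity at `k = 0`, so one class of metrics covers all iterations. -/
lemma PreconditionerAssumption.ae_isMetric
    (hM : PreconditionerAssumption Prob S M μinf Linf ρ) :
    ∀ᵐ ω ∂Prob, ∀ k, IsMetric μinf Linf (M k ω) := by
  refine ae_all_iff.2 fun k => ?_
  rcases Nat.eq_zero_or_pos k with rfl | hk
  · exact Eventually.of_forall fun ω =>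
      (hM.zero ω).symm ▸ isMetric_id hM.μinf_pos hM.μinf_le hM.Linf_ge
  · obtain ⟨μ, L, hμ, hL0, hL, hb⟩ := hM.norm_bounds k hk
    filter_upwards [hb, hM.spd] with ω h1 h2
    have h0 : ∀ v, 0 ≤ quad (M k ω) v := fun v => by
      rcases eq_or_ne v 0 with rfl | hv
      · simp [quad]
      · exact ((h2 k hk).2 v hv).le
    refine ⟨(h2 k hk).1, fun v => ?_, fun v => ?_⟩
    · rw [← normM_sq h0, ← mul_pow]
      have hn : 0 ≤ normM (M k ω) v := Real.sqrt_nonneg _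
      exact pow_le_pow_left₀ (norm_nonneg v)
        ((h1 v).2.trans (mul_le_mul_of_nonneg_right hL hn)) 2
    · rw [← normM_sq h0, ← mul_pow]
      have hn : 0 ≤ normM (M k ω) v := Real.sqrt_nonneg _
      exact pow_le_pow_left₀ (mul_nonneg hM.μinf_pos.le hn)
        ((mul_le_mul_of_nonneg_right hμ hn).trans (h1 v).1) 2

lemma PreconditionerAssumption.one_le (hM : PreconditionerAssumption Prob S M μinf Linf ρ)
    (k : ℕ) : 1 ≤ ρ k := by
  rcases Nat.eq_zero_or_pos k with rfl | hk
  · exact hM.ρ_zero.ge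
  · exact hM.ρ_ge k hk

end Assumptions

/-! ### From bounded envelopes and summability to the conclusions -/

section Conclusion

lemma not_summable_succ_of_tendsto {a : ℕ → ℝ} (ha : ∀ k, 1 ≤ k → 0 < a k)
    (h : Tendsto (fun n => ∑ k ∈ Finset.Icc 1 n, a k) atTop atTop) :
    ¬ Summable fun k => a (k + 1) := by
  rw [not_summable_iff_tendsto_nat_atTop_of_nonneg fun k => (ha (k + 1) (by omega)).le]
  refine h.congr fun n => ?_
  rw [Finset.range_eq_Ico, Finset.sum_Ico_add' a 0 n 1]
  rfl

/-- A weighted summable sequence has arbitrarily small terms if the weights are not summable. -/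
lemma frequently_le_of_summable_mul {a D : ℕ → ℝ} (ha : ∀ n, 0 ≤ a n)
    (hs : Summable fun n => a n * D n) (hns : ¬ Summable a) {δ : ℝ} (hδ : 0 < δ) :
    ∃ᶠ n in atTop, D n ≤ δ := by
  intro hev
  refine hns ?_
  refine Summable.of_norm_bounded_eventually_nat (hs.mul_left δ⁻¹) ?_
  filter_upwards [hev] with n hn
  push Not at hn
  rw [Real.norm_of_nonneg (ha n), inv_mul_eq_div, le_div_iff₀' hδ, mul_comm]
  exact mul_le_mul_of_nonneg_left hn.le (ha n)

variable {d : ℕ}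

/-- With `v` the displacement from the proximal point, the left side is the squared norm of the
envelope gradient. -/
lemma norm_gradient_sq_le {μ L ρ : ℝ} {N : Vec d →L[ℝ] Vec d} (hN : IsMetric μ L N) (hμ : 0 < μ)
    (hL : 0 < L) (v : Vec d) : ‖ρ • N v‖ ^ 2 ≤ (ρ / μ) ^ 2 * quad N v := by
  have h1 := hN.norm_apply_sq_le hμ hL v
  have h2 : ‖N v‖ ^ 2 ≤ quad N v / μ ^ 2 := by
    rw [le_div_iff₀' (by positivity)]; exact h1
  rw [norm_smul, mul_pow, Real.norm_eq_abs, sq_abs]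
  calc ρ ^ 2 * ‖N v‖ ^ 2 ≤ ρ ^ 2 * (quad N v / μ ^ 2) :=
        mul_le_mul_of_nonneg_left h2 (sq_nonneg _)
    _ = _ := by ring

lemma liminf_enorm_eq_zero {u : ℕ → Vec d} (h : ∀ ε > 0, ∃ᶠ n in atTop, ‖u n‖ ≤ ε) :
    liminf (fun n => ‖u n‖ₑ) atTop = 0 := by
  refine le_antisymm (ENNReal.le_of_forall_pos_le_add fun ε hε _ => ?_) bot_le
  rw [zero_add]
  refine liminf_le_of_frequently_le ((h ε hε).mono fun n hn => ?_)
  rw [← ofReal_norm, ← ENNReal.ofReal_coe_nnreal]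
  exact ENNReal.ofReal_le_ofReal hn

/-- Boundedness of the Moreau envelope along a sequence implies boundedness of the sequence. -/
lemma ProxRegular.exists_norm_bound {C : Set (Vec d)} {g : Vec d → ℝ} {κ ρ μ L m₀ b : ℝ}
    (h : ProxRegular C g κ ρ μ L) (hm₀ : ∀ y ∈ C, m₀ ≤ g y)
    (hbd : ∀ t : ℝ, Bornology.IsBounded {y | y ∈ C ∧ g y ≤ t}) :
    ∃ K, ∀ N : Vec d →L[ℝ] Vec d, IsMetric μ L N → ∀ x, env C g ρ N x - m₀ ≤ b → ‖x‖ ≤ K := by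
  obtain ⟨K, hK⟩ := (hbd (m₀ + b)).exists_norm_le
  refine ⟨K + √(L ^ 2 * (2 / ρ * b)), fun N hN x hx => ?_⟩
  have hρ := h.ρ_pos
  set y := proxPt C g ρ N x with hy
  have hyC := (h.proxPt_spec hN x).1
  rw [← hy] at hyC
  have he : env C g ρ N x = g y + ρ / 2 * quad N (y - x) := rfl
  rw [he] at hx
  have hq := hN.quad_nonneg h.L_pos (y - x)
  have hq' : 0 ≤ ρ / 2 * quad N (y - x) := by positivity
  have h1 : ‖y‖ ≤ K := hK y ⟨hyC, by linarith⟩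
  have h2 : quad N (y - x) ≤ 2 / ρ * b := by
    have := hm₀ y hyC
    rw [div_mul_eq_mul_div, le_div_iff₀' hρ]
    linarith
  have h3 : ‖y - x‖ ≤ √(L ^ 2 * (2 / ρ * b)) :=
    Real.le_sqrt_of_sq_le ((hN.lower _).trans (mul_le_mul_of_nonneg_left h2 (sq_nonneg _)))
  calc ‖x‖ = ‖y - (y - x)‖ := by rw [sub_sub_cancel]
    _ ≤ ‖y‖ + ‖y - x‖ := norm_sub_le _ _
    _ ≤ _ := add_le_add h1 h3

end Conclusion

/-! ### The zero-dimensional case -/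

section DimensionZero

lemma moreauEnvelope_of_subsingleton {d : ℕ} [Subsingleton (Vec d)] (M : Vec d →L[ℝ] Vec d)
    (α : ℝ) (p : Vec d → EReal) (x : Vec d) : moreauEnvelope M α p x = p x := by
  have : ∀ y, proxObjective M α p x y = p x := fun y => by
    rw [proxObjective, normM, Subsingleton.elim (y - x) 0, Subsingleton.elim y x]
    simp
  simp [moreauEnvelope, this]

end DimensionZero

end IspPPA


/-! ### The theorem -/

theorem mainTheorem1 {d m : ℕ} (hm : 0 < m)
    {𝒮 Ω : Type*} [MeasurableSpace 𝒮] [MeasurableSpace Ω]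
    (P : Measure 𝒮) [IsProbabilityMeasure P] (Prob : Measure Ω) [IsProbabilityMeasure Prob]
    (f : Vec d → 𝒮 → EReal) (r : Vec d → EReal)
    (fm : Vec d → Vec d → 𝒮 → ℝ) (V : Set (Vec d)) (ηbar τbar : ℝ)
    (G : NNReal → NNReal)
    (S : ℕ → Fin m → Ω → 𝒮) (M : ℕ → Ω → Vec d →L[ℝ] Vec d) (μinf Linf : ℝ) (ρ : ℕ → ℝ)
    (hModel : ModelAssumption P f r fm V ηbar)
    (hReg : RegularityAssumption P f r fm V τbar)
    (hSub : SublevelAssumption (objective P f r))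
    (hLip : GrowthLipschitzAssumption P fm V G)
    (hS : IIDSamples Prob P S)
    (hM : PreconditionerAssumption Prob S M μinf Linf ρ)
    (η τ Bρ : ℝ) (hη : η = Linf ^ 2 * ηbar) (hτ : τ = Linf ^ 2 * τbar)
    (hBρ : Bρ = ⨆ k : ℕ+, ρ k ^ 2)
    (γ ρbar : ℝ) (hγ : 0 ≤ γ) (hρbar : Bρ * (η + τ) < ρbar)
    (αbar : ℕ → ℝ) (α ε : ℕ → Ω → ℝ) (x : ℕ → Ω → Vec d)
    (hαbar : ∀ k, 1 ≤ k → 0 < αbar k)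
    (hα : ∀ k, 1 ≤ k → ∀ ω, α k ω = αbar k / max 1 (G ‖x k ω‖₊ : ℝ))
    (hε : ∀ k, 1 ≤ k → ∀ ω, ε k ω = γ * α k ω ^ 2)
    (hαsup : (⨆ k : ℕ+, αbar k) < (ρbar * max 2 Bρ + η)⁻¹)
    (hαsq : Summable (fun k : ℕ+ => αbar k ^ 2))
    (hx : IsIspPPA Prob r fm V τ S M α ε x) :
    (∀ᵐ ω ∂Prob, BddAbove (Set.range fun k : ℕ+ => ‖x k ω‖)) ∧
    (Tendsto (fun n => ∑ k ∈ Finset.Icc 1 n, αbar k) atTop atTop →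
      ∀ᵐ ω ∂Prob,
        (∀ k, 1 ≤ k →
          (∀ z, moreauEnvelope (M (k - 1) ω) ρbar⁻¹ (objective P f r) z ≠ ⊥ ∧
            moreauEnvelope (M (k - 1) ω) ρbar⁻¹ (objective P f r) z ≠ ⊤) ∧
          DifferentiableAt ℝ
            (fun z => (moreauEnvelope (M (k - 1) ω) ρbar⁻¹ (objective P f r) z).toReal)
            (x k ω)) ∧
        liminf (fun k =>
          ‖gradient (fun z => (moreauEnvelope (M (k - 1) ω) ρbar⁻¹ (objective P f r) z).toReal)
            (x k ω)‖ₑ) atTop = 0) := by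
  -- For `d = 0` the model assumption does not determine the sign of `ηbar`, but all claims are
  -- trivial.
  rcases Nat.eq_zero_or_pos d with rfl | hd
  · have hφ : objective P f r 0 ≠ ⊥ ∧ objective P f r 0 ≠ ⊤ := by
      obtain ⟨y, hy⟩ := hReg.proper_r.2
      rw [Subsingleton.elim y 0] at hy
      have h := (represents_toReal hReg.proper_r.1).const_add (expectedCost P f)
      have h0 : objective P f r 0 = ((expectedCost P f 0 + (r 0).toReal : ℝ) : EReal) := h.1 0 hy
      rw [h0]
      exact ⟨EReal.coe_ne_bot _, EReal.coe_ne_top _⟩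
    refine ⟨Eventually.of_forall fun ω => ⟨0, ?_⟩, fun _ => Eventually.of_forall fun ω =>
      ⟨fun k _ => ⟨fun z => ?_, ?_⟩, ?_⟩⟩
    · rintro _ ⟨k, rfl⟩
      simp [Subsingleton.elim (x k ω) 0]
    · rw [moreauEnvelope_of_subsingleton, Subsingleton.elim z 0]
      exact hφ
    · exact (hasFDerivAt_of_subsingleton _ _).differentiableAt
    · refine liminf_enorm_eq_zero fun ε hε => Eventually.frequently (Eventually.of_forall fun k => ?_)
      rw [Subsingleton.elim (gradient _ _) 0, norm_zero]
      exact hε.le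
  have : Nonempty (Fin d) := ⟨⟨0, hd⟩⟩
  obtain ⟨Lf, hcore⟩ := exists_modelCore hModel hReg hLip
  have hrep := represents_toReal hReg.proper_r.1
  have hobj : Represents (objective P f r) {y | r y ≠ ⊤}
      (fun y => expectedCost P f y + (r y).toReal) := hrep.const_add (expectedCost P f)
  set C : Set (Vec d) := {y | r y ≠ ⊤} with hC
  set R : Vec d → ℝ := fun y => (r y).toReal with hR
  set F : Vec d → ℝ := expectedCost P f with hF
  have hμ := hM.μinf_pos
  have hL : 0 < Linf := zero_lt_one.trans_le hM.Linf_ge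
  obtain ⟨νinf, hν⟩ := hM.prod_converges
  obtain ⟨hρν, hρsum⟩ := summable_sq_sub_one_of_prod hM.one_le hν
  have hρsq1 : ∀ k, 1 ≤ ρ k ^ 2 := fun k => one_le_pow₀ (hM.one_le k)
  -- Without boundedness the real supremum `Bρ` would take the default value `0`.
  have hbdd : BddAbove (Set.range fun k : ℕ+ => ρ k ^ 2) := by
    refine ⟨νinf ^ 2, ?_⟩
    rintro _ ⟨k, rfl⟩
    exact pow_le_pow_left₀ (zero_le_one.trans (hM.one_le k)) (hρν k) 2
  have hρB : ∀ k, ρ (k + 1) ^ 2 ≤ Bρ := fun k => by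
    rw [hBρ]
    exact le_ciSup hbdd (⟨k + 1, Nat.succ_pos k⟩ : ℕ+)
  have hB1 : 1 ≤ Bρ := (hρsq1 1).trans (hρB 0)
  subst hη hτ
  have hη0 : 0 ≤ Linf ^ 2 * ηbar := mul_nonneg (sq_nonneg _) hcore.η_nonneg
  have hτ0 : 0 ≤ Linf ^ 2 * τbar := mul_nonneg (sq_nonneg _) hcore.τ_nonneg
  have hρ' : Linf ^ 2 * (ηbar + τbar) < ρbar := by
    have : Linf ^ 2 * ηbar + Linf ^ 2 * τbar ≤ Bρ * (Linf ^ 2 * ηbar + Linf ^ 2 * τbar) :=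
      le_mul_of_one_le_left (add_nonneg hη0 hτ0) hB1
    linarith
  have hreg := hcore.proxRegular hμ hL hρ'
  obtain ⟨m₀, -, hm₀'⟩ := EReal.lt_iff_exists_real_btwn.1 hSub.bddBelow
  have hm₀ : ∀ y ∈ C, m₀ ≤ F y + R y := fun y hy => by
    have h1 := hm₀'.le.trans (iInf_le _ y)
    rw [hobj.1 y hy] at h1
    exact_mod_cast h1
  have hbnd : ∀ t : ℝ, Bornology.IsBounded {y | y ∈ C ∧ F y + R y ≤ t} := fun t => by
    refine (hSub.bounded t).subset fun y hy => ?_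
    have h1 := hobj.1 y hy.1
    simp only [Set.mem_ofPred_eq, h1]
    exact_mod_cast hy.2
  obtain ⟨v₀, hv₀⟩ := hcore.nonempty
  classical
  -- Altering the data on null sets makes the metric bounds and membership in `V` hold for every
  -- `ω`, while preserving adaptedness.
  set M' : ℕ → Ω → Vec d →L[ℝ] Vec d := fun k ω =>
    if IsMetric μinf Linf (M k ω) then M k ω else ContinuousLinearMap.id ℝ (Vec d) with hM'
  -- The index shift pairs the iterate `x (k + 1)` with the metric `M k`, both known after `k`
  -- minibatches.
  set x' : ℕ → Ω → Vec d := fun k ω => if x (k + 1) ω ∈ V then x (k + 1) ω else v₀ with hx'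
  have hM'metric : ∀ k ω, IsMetric μinf Linf (M' k ω) := fun k ω => by
    simp only [hM']
    split_ifs with h
    · exact h
    · exact isMetric_id hμ hM.μinf_le hM.Linf_ge
  have hMeq : ∀ᵐ ω ∂Prob, ∀ k, M' k ω = M k ω := by
    filter_upwards [hM.ae_isMetric] with ω hω k
    exact if_pos (hω k)
  have hx'V : ∀ k ω, x' k ω ∈ V := fun k ω => by
    simp only [hx']
    split_ifs with h
    · exact h
    · exact hcore.subset hv₀
  have hxeq : ∀ᵐ ω ∂Prob, ∀ k, x' k ω = x (k + 1) ω := by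
    filter_upwards [hx.mem] with ω hω k
    exact if_pos (hω (k + 1) (Nat.le_add_left 1 k))
  have hM'm : ∀ k, Measurable[sampleFiltration S k] (M' k) := fun k => by
    have h1 : Measurable fun N : Vec d →L[ℝ] Vec d =>
        if IsMetric μinf Linf N then N else ContinuousLinearMap.id ℝ (Vec d) :=
      Measurable.ite (isClosed_isMetric μinf Linf).measurableSet measurable_id measurable_const
    refine h1.comp ?_
    rcases Nat.eq_zero_or_pos k with rfl | hk
    · have : M 0 = fun _ => ContinuousLinearMap.id ℝ (Vec d) := funext hM.zero
      rw [this]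
      exact measurable_const
    · exact hM.adapted k hk
  have hx'm : ∀ k, Measurable[sampleFiltration S k] (x' k) := fun k => by
    have h1 : Measurable fun v : Vec d => if v ∈ V then v else v₀ :=
      Measurable.ite hcore.isOpen.measurableSet measurable_id measurable_const
    exact h1.comp (hx.adapted (k + 1) (Nat.le_add_left 1 k))
  have hcond : ∀ k z, z ≠ 0 → ∀ᵐ ω ∂Prob,
      (Prob[fun ω' => quad (M' (k + 1) ω') z / quad (M' k ω') z | sampleFiltration S k]) ω ≤
        ρ (k + 1) ^ 2 := by
    intro k z hz
    have h1 : (fun ω' => quad (M' (k + 1) ω') z / quad (M' k ω') z) =ᵐ[Prob]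
        fun ω' => normM (M (k + 1) ω') z ^ 2 / normM (M k ω') z ^ 2 := by
      filter_upwards [hMeq] with ω hω
      rw [← hω, ← hω, normM_sq ((hM'metric _ ω).quad_nonneg hL),
        normM_sq ((hM'metric _ ω).quad_nonneg hL)]
    filter_upwards [condExp_congr_ae (m := sampleFiltration S k) h1,
      hM.condExp_bounds (k + 1) (Nat.le_add_left 1 k) z hz] with ω h2 h3
    rw [h2]
    exact h3.2
  have hαsq' : Summable fun k => αbar (k + 1) ^ 2 :=
    (Equiv.pnatEquivNat.symm.summable_iff (f := fun k : ℕ+ => αbar k ^ 2)).2 hαsq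
  obtain ⟨j, hj⟩ := hcore.bounded_and_summable hm hS hμ hL hγ hB1 hρbar
    (c := fun k => ρ (k + 1) ^ 2) (fun k => hρsq1 (k + 1)) hρB
    ((summable_nat_add_iff 1).2 hρsum) (fun k => hαbar (k + 1) (Nat.le_add_left 1 k)) hαsq' hrep
    hm₀ hM'metric hM'm hcond hx'V hx'm
    (α := fun k ω => stepsize G (αbar (k + 1)) (x' k ω)) (fun _ _ => rfl) (by
      filter_upwards [hx.step, hMeq, hxeq] with ω h1 h2 h3 k
      have h4 := h1 (k + 1) (Nat.le_add_left 1 k)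
      rw [hε _ (Nat.le_add_left 1 k), hα _ (Nat.le_add_left 1 k)] at h4
      rw [h2, h3, h3]
      exact h4)
  have hbound : ∀ᵐ ω ∂Prob, ∃ K, ∀ k, ‖x (k + 1) ω‖ ≤ K := by
    filter_upwards [hj, hxeq] with ω hω h1
    obtain ⟨b, hb⟩ := hω.1
    obtain ⟨K, hK⟩ := hreg.exists_norm_bound (b := b) hm₀ hbnd
    -- The finite sum covers the iterates before the descent inequality starts to apply.
    refine ⟨max K 0 + ∑ i ∈ Finset.range j, ‖x (i + 1) ω‖, fun k => ?_⟩
    have hs0 : 0 ≤ ∑ i ∈ Finset.range j, ‖x (i + 1) ω‖ :=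
      Finset.sum_nonneg fun _ _ => norm_nonneg _
    rcases lt_or_ge k j with hk | hk
    · have := Finset.single_le_sum (f := fun i => ‖x (i + 1) ω‖) (fun _ _ => norm_nonneg _)
        (Finset.mem_range.2 hk)
      exact this.trans (le_add_of_nonneg_left (le_max_right _ _))
    · obtain ⟨n, rfl⟩ := Nat.exists_eq_add_of_le' hk
      have h2 := hK _ (hM'metric (n + j) ω) (x' (n + j) ω) (hb ⟨n, rfl⟩)
      rw [h1] at h2
      exact (h2.trans (le_max_left _ _)).trans (le_add_of_nonneg_right hs0)
  refine ⟨?_, fun hαdiv => ?_⟩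
  · filter_upwards [hbound] with ω ⟨K, hK⟩
    refine ⟨K, ?_⟩
    rintro _ ⟨k, rfl⟩
    have := hK (k.natPred)
    rwa [PNat.natPred_add_one] at this
  · filter_upwards [hj, hbound, hM.ae_isMetric, hMeq, hxeq] with ω hω ⟨K, hK⟩ hmet hMω hxω
    have henv : ∀ k z, moreauEnvelope (M k ω) ρbar⁻¹ (objective P f r) z =
        (env C (fun y => F y + R y) ρbar (M k ω) z : EReal) := fun k z =>
      hreg.moreauEnvelope_eq (hmet k) hobj z
    have henv' : ∀ k, (fun z => (moreauEnvelope (M k ω) ρbar⁻¹ (objective P f r) z).toReal) =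
        env C (fun y => F y + R y) ρbar (M k ω) := fun k => by
      ext z
      rw [henv, EReal.toReal_coe]
    refine ⟨fun k _ => ⟨fun z => ?_, ?_⟩, ?_⟩
    · rw [henv]
      exact ⟨EReal.coe_ne_bot _, EReal.coe_ne_top _⟩
    · rw [henv']
      exact (hreg.hasGradientAt_env (hmet (k - 1)) (x k ω)).differentiableAt
    · simp only [henv', (hreg.hasGradientAt_env (hmet _) _).gradient]
      set D : ℕ → ℝ := fun n => quad (M (n + j) ω)
        (proxPt C (fun y => F y + R y) ρbar (M (n + j) ω) (x (n + j + 1) ω) -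
          x (n + j + 1) ω) with hD
      have hsum : Summable fun n => stepsize G (αbar (n + j + 1)) (x (n + j + 1) ω) * D n := by
        have := hω.2
        simpa only [hMω, hxω] using this
      -- On a path bounded by `K`, the base stepsizes are at most `max 1 (G K)` times the actual
      -- ones, so divergence carries over.
      have hns : ¬ Summable fun n => stepsize G (αbar (n + j + 1)) (x (n + j + 1) ω) := by
        intro hs
        refine not_summable_succ_of_tendsto hαbar hαdiv ?_
        rw [← summable_nat_add_iff j]
        have hK0 : 0 ≤ K := (norm_nonneg _).trans (hK 0)
        refine Summable.of_nonneg_of_le (fun n => (hαbar _ (Nat.le_add_left 1 _)).le) (fun n => ?_)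
          (hs.mul_left (max 1 (G K.toNNReal : ℝ)))
        have h1 : (0 : ℝ) < max 1 (G ‖x (n + j + 1) ω‖₊ : ℝ) := lt_max_of_lt_left one_pos
        have h2 : max 1 (G ‖x (n + j + 1) ω‖₊ : ℝ) ≤ max 1 (G K.toNNReal : ℝ) := by
          refine max_le_max le_rfl (NNReal.coe_le_coe.2 (hcore.monotone ?_))
          rw [← NNReal.coe_le_coe, coe_nnnorm, Real.coe_toNNReal _ hK0]
          exact hK _
        rw [stepsize, mul_div_assoc', le_div_iff₀' h1]
        exact mul_le_mul_of_nonneg_right h2 (hαbar _ (Nat.le_add_left 1 _)).le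
      refine liminf_enorm_eq_zero fun ε hε => ?_
      have hρ0 := hreg.ρ_pos
      -- The threshold is chosen so that `(ρbar / μinf) ^ 2` times it equals `ε ^ 2`.
      have hfreq := frequently_le_of_summable_mul
        (fun n => (stepsize_pos (hαbar _ (Nat.le_add_left 1 _)) _).le) hsum hns
        (δ := (ε * (μinf / ρbar)) ^ 2) (by positivity)
      have htend : Tendsto (fun n => n + j + 1) atTop atTop :=
        tendsto_atTop_mono (fun n => (by omega : n ≤ n + j + 1)) tendsto_id
      refine htend.frequently (hfreq.mono fun n hn => ?_)
      rw [Nat.add_sub_cancel]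
      refine abs_le_of_sq_le_sq' ?_ hε.le |>.2
      refine (norm_gradient_sq_le (hmet (n + j)) hμ hL _).trans ?_
      rw [quad_sub_comm]
      calc (ρbar / μinf) ^ 2 * D n ≤ (ρbar / μinf) ^ 2 * (ε * (μinf / ρbar)) ^ 2 :=
            mul_le_mul_of_nonneg_left hn (sq_nonneg _)
        _ = ε ^ 2 := by field_simp
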